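/- **Notation.** A partition in $(N,M)$ is a sequence of integers $M\ge p_N\ge p_{N-1}\ge\dots\ge p_1\ge 0$; its weight $\mathrm{wt}$ is the sum of its parts. For $a,b,\alpha,\beta\ge 0$ with $a+b>0$, $\alpha+\beta>0$, let $R(N,M,a,b,\alpha,\beta)=\sum q^{\mathrm{wt}(\bar q)+\mathrm{wt}(\bar p)}$, the sum over all pairs $(\bar q,\bar p)$ of partitions in $(N,M)$ such that $\bar p_i-\bar q_{i+1-a}\ge 1-\alpha$ for $\max\{1,a\}\le i\le\min\{N,N+a-1\}$, $\bar q_i-\bar p_{i+1-b}\ge 1-\beta$ for $\max\{1,b\}\le i\le\min\{N,N+b-1\}$, and, if $a=0$, $\bar q_1\le\alpha-1$ and $\bar p_N\ge M-\alpha+1$, and, if $b=0$, $\bar p_1\le\beta-1$ and $\bar q_N\ge M-\beta+1$ (where, if $N=0$, a part with subscript $0$ is read as $0$ and a part with subscript $1$ as $M$). Put $(q)_n=\prod_{i=1}^n(1-q^i)$ and $\left[{P\atop N}\right]=\frac{(q)_P}{(q)_N(q)_{P-N}}$ if $P\ge N\ge0$, and $0$ otherwise. The continued fraction of a pair $(s:r)$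 of positive coprime integers (or $s=1$, $r=0$) is empty for $(1:0)$, and otherwise is $c_1=\lfloor s/r\rfloor$ followed by the continued fraction of $(r:s-c_1r)$; in addition $(c_1,\dots,c_{k-1},1)$ with $k>1$ is identified with $(c_1,\dots,c_{k-1}+1)$. **Theorem.** Let $p,p'$ be positive coprime integers and let $(p':p)$ have continued fraction $(c_1,\dots,c_{t-1},c_t+2)$ with $t\ge1$ and all $c_k\ge 0$. Let $1\le u\le t$ and $1\le d\le c_u$, and let $(s:r)$ have continued fraction $(c_1,\dots,c_{u-1},d)$. Let $N\ge0$, and set $(f_1,\dots,f_{t+1})=(c_1,\dots,c_{u-1},d,c_u-d,c_{u+1},\dots,c_t)$. Consider all sequences $n^{(1)},\dots,n^{(x)}$ of partitions, $u\le x\le t+1$, where $n^{(k)}$ has $f_k$ parts $n_{k,0}\ge n_{k,1}\ge\dots\ge n_{k,f_k}\ge0$ and $\mathrm{wt}(n^{(k)})\le w_k$ for $1\le k\le x$; $\mathrm{wt}(n^{(x)})=w_x$; $\mathrm{wt}(n^{(u)})<w_u$ if $u<x$; $n_{k,f_k}>0$ if $u<k<x$; and $n_{x,f_x}=0$ if $x<t+1$.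 Here $w_1=\infty$, $n_{1,0}=N$, and recursively $$w_k=n_{k-1,f_{k-1}}\ (2\le k\le u),\quad w_{u+1}=w_u-1-\mathrm{wt}(n^{(u)}),\quad w_k=n_{k-1,f_{k-1}}-1\ (u+2\le k\le x),$$ $$n_{k,0}=w_{k-1}-\mathrm{wt}(n^{(k-1)})\ (2\le k\le u),\quad n_{u+1,0}=n_{u,f_u}+1,\quad n_{k,0}=w_{k-1}+1-\mathrm{wt}(n^{(k-1)})\ (u+2\le k\le x),$$ with $\infty\pm a=\infty$ for integers $a$. There are only finitely many such sequences. Moreover, the limit being that of formal power series in $q$ (coefficientwise) and the sums being over all these sequences: if $u>1$, then $$\lim_{M\to\infty}R(N,M,r,p-r,s,p'-s)=\sum q^{E}\,\frac1{(q)_{2n_{1,f_1}}}\prod_{i=1}^{f_1}\frac1{(q)_{n_{1,i-1}-n_{1,i}}}\prod_{k=2}^{x}\prod_{i=1+\delta_{2,k}}^{f_k}\left[{2(w_k-\sum_{j=1}^in_{k,j})+n_{k,i-1}+n_{k,i}\atop n_{k,i-1}-n_{k,i}}\right];$$ if $u=1$, then $$\lim_{M\to\infty}R(N,M,r,p-r,s,p'-s)=\sum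 q^{E}\,\frac1{(q)_{2(n_{2,f_2}-1)}}\prod_{i=1}^{f_1}\frac1{(q)_{n_{1,i-1}-n_{1,i}}}\prod_{i=1}^{f_2}\frac1{(q)_{n_{2,i-1}-n_{2,i}}}\prod_{k=3}^{x}\prod_{i=1+\delta_{3,k}}^{f_k}\left[{2(w_k-\sum_{j=1}^in_{k,j})+n_{k,i-1}+n_{k,i}\atop n_{k,i-1}-n_{k,i}}\right],$$ where $$E=n_{u,d}+\sum_{k=1}^{u}\sum_{i=1}^{f_k}n_{k,i}^2+\sum_{k=u+1}^{x}\sum_{i=1}^{f_k}n_{k,i}(n_{k,i}-1).$$ (If $u=1$ every sequence in the sum has $x\ge3$ and $n_{2,f_2}\ge1$; an empty sum is $0$.) -/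

import Mathlib

open Filter Topology
open scoped PowerSeries.WithPiTopology

namespace Burge

/-! ## Restricted partition pairs -/

/-- The part `p_i` of a partition `M ≥ p_N ≥ ⋯ ≥ p_1 ≥ 0` in `(N, M)`, where `p_i` is the value of
the monotone function `p` at the index `i - 1`.  Boundary conventions: `p_i = 0` for `i ≤ 0` and
`p_i = M` for `i > N` (they are only used for partitions without parts, i.e. when `N = 0`). -/
def boxPart {N M : ℕ} (p : Fin N → Fin (M + 1)) (i : ℤ) : ℤ :=
  if i ≤ 0 then 0
  else if h : i.toNat - 1 < N then ((p ⟨i.toNat - 1, h⟩ : ℕ) : ℤ)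
  else (M : ℤ)

/-- `(q, p)` is a restricted partition pair in `(N₁, M₁) × (N₂, M₂)` for the parameters
`a, b, α, β`. -/
structure IsRestrictedPair {N₁ M₁ N₂ M₂ : ℕ} (a b α β : ℤ)
    (q : Fin N₁ → Fin (M₁ + 1)) (p : Fin N₂ → Fin (M₂ + 1)) : Prop where
  monotone_left : Monotone q
  monotone_right : Monotone p
  ineq_left : ∀ i : ℤ, max 1 a ≤ i → i ≤ min (N₂ : ℤ) (N₁ + a - 1) →
    1 - α ≤ boxPart p i - boxPart q (i + 1 - a)
  ineq_right : ∀ i : ℤ, max 1 b ≤ i → i ≤ min (N₁ : ℤ) (N₂ + b - 1) →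
    1 - β ≤ boxPart q i - boxPart p (i + 1 - b)
  special_a_zero : a = 0 → boxPart q 1 ≤ α - 1
  special_b_zero : b = 0 → boxPart p 1 ≤ β - 1
  special_a_max : a = (N₂ : ℤ) - N₁ → M₁ - α + 1 ≤ boxPart p N₂
  special_b_max : b = (N₁ : ℤ) - N₂ → M₂ - β + 1 ≤ boxPart q N₁

open Classical in
/-- The generating function `R(N₁, M₁, N₂, M₂, a, b, α, β)`: the sum of `q ^ (wt q + wt p)` over
all restricted partition pairs `(q, p)`. -/
noncomputable def genFun (N₁ M₁ N₂ M₂ : ℕ) (a b α β : ℤ) : Polynomial ℤ :=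
  ∑ x : (Fin N₁ → Fin (M₁ + 1)) × (Fin N₂ → Fin (M₂ + 1)) with
    IsRestrictedPair a b α β x.1 x.2,
    Polynomial.X ^ ((∑ i, (x.1 i : ℕ)) + ∑ i, (x.2 i : ℕ))

/-- `R(N, M, a, b, α, β) = R(N, M, N, M, a, b, α, β)`. -/
noncomputable def R (N M : ℕ) (a b α β : ℤ) : Polynomial ℤ :=
  genFun N M N M a b α β

/-! ## `q`-factorials and Gaussian polynomials, as formal power series in `q` -/

/-- `(q)_n = (1 - q)(1 - q²)⋯(1 - qⁿ)`. -/
noncomputable def qFact (n : ℕ) : PowerSeries ℤ :=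
  ∏ i ∈ Finset.range n, (1 - PowerSeries.X ^ (i + 1))

/-- `1 / (q)_n`. -/
noncomputable def invQFact (n : ℕ) : PowerSeries ℤ :=
  PowerSeries.invOfUnit (qFact n) 1

theorem qFact_mul_invQFact (n : ℕ) : qFact n * invQFact n = 1 := by
  apply PowerSeries.mul_invOfUnit
  simp [qFact, map_prod]

/-- The Gaussian polynomial `(q)_P / ((q)_N (q)_{P-N})` if `P ≥ N ≥ 0`, and `0` otherwise. -/
noncomputable def gauss (P N : ℤ) : PowerSeries ℤ :=
  if 0 ≤ N ∧ N ≤ P then qFact P.toNat * invQFact N.toNat * invQFact (P - N).toNat else 0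

/-! ## Continued fractions -/

/-- The continued fraction of the pair `s : r`: empty if `r = 0`, otherwise `⌊s / r⌋` followed by
the continued fraction of `r : s - ⌊s / r⌋ r`. -/
def contFrac (s r : ℕ) : List ℕ :=
  if _h : r = 0 then [] else (s / r) :: contFrac r (s % r)
termination_by r
decreasing_by exact Nat.mod_lt _ (Nat.pos_of_ne_zero _h)

/-- `l` is a continued fraction of `s : r`, where `s`, `r` are positive coprime integers or
`s = 1`, `r = 0`.  As usual `(c_1, …, c_{t-1}, 1)` is also allowed in place of
`(c_1, …, c_{t-1} + 1)`. -/
def IsContFrac (s r : ℕ) (l : List ℕ) : Prop :=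
  0 < s ∧ s.Coprime r ∧
    (l = contFrac s r ∨ ∃ l' e, l = l' ++ [e, 1] ∧ contFrac s r = l' ++ [e + 1])

/-! ## Sequences of partitions

A sequence `n^{(1)}, …, n^{(x)}` of partitions is a list `S` of lists; `x = S.length`, and the
`k`-th list holds the parts `n_{k,1}, n_{k,2}, …` of `n^{(k)}`. -/

/-- `(f_1, …, f_{t+1}) = (c_1, …, c_{u-1}, d, c_u - d, c_{u+1}, …, c_t)`. -/
def fSeq (c : ℕ → ℕ) (u d : ℕ) (k : ℕ) : ℕ :=
  if k < u then c k else if k = u then d else if k = u + 1 then c u - d else c (k - 1)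

/-- The `k`-th partition `n^{(k)}` (`k ≥ 1`). -/
def nPartition (S : List (List ℕ)) (k : ℕ) : List ℕ := S.getD (k - 1) []

/-- `n_{k,i}` for `k ≥ 1`, `i ≥ 1`. -/
def nPart (S : List (List ℕ)) (k i : ℕ) : ℕ := (nPartition S k).getD (i - 1) 0

/-- `wt(n^{(k)})`. -/
def nWt (S : List (List ℕ)) (k : ℕ) : ℕ := (nPartition S k).sum

/-- The pair `(w_{j+1}, n_{j+1,0})`, defined recursively from `(w_1, n_{1,0}) = (w₁, n₁₀)`.
Here `n_{k,f_k}` means `n_{k,0}` if `f_k = 0`.  The values lie in `ℕ∞`, where `⊤ ± a = ⊤`.  The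
subtractions never truncate for the sequences satisfying `Admissible` below. -/
def bounds (f : ℕ → ℕ) (u : ℕ) (w₁ n₁₀ : ℕ∞) (S : List (List ℕ)) : ℕ → ℕ∞ × ℕ∞
  | 0 => (w₁, n₁₀)
  | j + 1 =>
    let k := j + 1
    let w := (bounds f u w₁ n₁₀ S j).1
    let n0 := (bounds f u w₁ n₁₀ S j).2
    let last : ℕ∞ := if f k = 0 then n0 else (nPart S k (f k) : ℕ∞)
    let wt : ℕ∞ := (nWt S k : ℕ∞)
    if k < u then (last, w - wt)
    else if k = u then (w - 1 - wt, last + 1)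
    else (last - 1, w + 1 - wt)

/-- `w_k` for `k ≥ 1`. -/
def wBound (f : ℕ → ℕ) (u : ℕ) (w₁ n₁₀ : ℕ∞) (S : List (List ℕ)) (k : ℕ) : ℕ∞ :=
  (bounds f u w₁ n₁₀ S (k - 1)).1

/-- `n_{k,i}` for `k ≥ 1`, `i ≥ 0`, including the recursively defined `n_{k,0}`. -/
def nExt (f : ℕ → ℕ) (u : ℕ) (w₁ n₁₀ : ℕ∞) (S : List (List ℕ)) (k i : ℕ) : ℕ∞ :=
  if i = 0 then (bounds f u w₁ n₁₀ S (k - 1)).2 else (nPart S k i : ℕ∞)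

/-- The conditions on the sequences of partitions over which the fermionic sums are taken. -/
structure Admissible (f : ℕ → ℕ) (t u : ℕ) (w₁ n₁₀ : ℕ∞) (S : List (List ℕ)) : Prop where
  le_length : u ≤ S.length
  length_le : S.length ≤ t + 1
  length_part : ∀ k, 1 ≤ k → k ≤ S.length → (nPartition S k).length = f k
  antitone : ∀ k, 1 ≤ k → k ≤ S.length → ∀ i, 1 ≤ i → i ≤ f k →
    nExt f u w₁ n₁₀ S k i ≤ nExt f u w₁ n₁₀ S k (i - 1)
  wt_le : ∀ k, 1 ≤ k → k ≤ S.length → (nWt S k : ℕ∞) ≤ wBound f u w₁ n₁₀ S k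
  wt_last : (nWt S S.length : ℕ∞) = wBound f u w₁ n₁₀ S S.length
  wt_u_lt : u < S.length → (nWt S u : ℕ∞) < wBound f u w₁ n₁₀ S u
  pos : ∀ k, u < k → k < S.length → 0 < nExt f u w₁ n₁₀ S k (f k)
  last_zero : S.length < t + 1 → nExt f u w₁ n₁₀ S S.length (f S.length) = 0

/-- The exponent
`n_{u,d} + ∑_{k=1}^u ∑_{i=1}^{f_k} n_{k,i}² + ∑_{k=u+1}^x ∑_{i=1}^{f_k} n_{k,i}(n_{k,i} - 1)`. -/
def fermExponent (f : ℕ → ℕ) (u d : ℕ) (S : List (List ℕ)) : ℕ :=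
  nPart S u d
    + ∑ k ∈ Finset.Icc 1 u, ∑ i ∈ Finset.Icc 1 (f k), nPart S k i ^ 2
    + ∑ k ∈ Finset.Icc (u + 1) S.length, ∑ i ∈ Finset.Icc 1 (f k),
        nPart S k i * (nPart S k i - 1)

/-- The Gaussian
`[ 2 (w_k - ∑_{j=1}^i n_{k,j}) + n_{k,i-1} + n_{k,i} ; n_{k,i-1} - n_{k,i} ]`,
meant for `k`, `i` with `w_k` and `n_{k,i-1}` finite. -/
noncomputable def gaussFactor (f : ℕ → ℕ) (u : ℕ) (w₁ n₁₀ : ℕ∞) (S : List (List ℕ))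
    (k i : ℕ) : PowerSeries ℤ :=
  gauss
    (2 * (((wBound f u w₁ n₁₀ S k).toNat : ℤ) - ∑ j ∈ Finset.Icc 1 i, (nPart S k j : ℤ))
      + ((nExt f u w₁ n₁₀ S k (i - 1)).toNat : ℤ) + ((nExt f u w₁ n₁₀ S k i).toNat : ℤ))
    (((nExt f u w₁ n₁₀ S k (i - 1)).toNat : ℤ) - ((nExt f u w₁ n₁₀ S k i).toNat : ℤ))

/-- `∏_{i=1}^{f_k} 1 / (q)_{n_{k,i-1} - n_{k,i}}`. -/
noncomputable def qFactLevel (f : ℕ → ℕ) (u : ℕ) (w₁ n₁₀ : ℕ∞) (S : List (List ℕ))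
    (k : ℕ) : PowerSeries ℤ :=
  ∏ i ∈ Finset.Icc 1 (f k),
    invQFact ((nExt f u w₁ n₁₀ S k (i - 1)).toNat - (nExt f u w₁ n₁₀ S k i).toNat)

/-- `∏_{k=m}^x ∏_{i=1+δ_{m,k}}^{f_k}` of the Gaussians. -/
noncomputable def gaussLevels (f : ℕ → ℕ) (u : ℕ) (w₁ n₁₀ : ℕ∞) (S : List (List ℕ))
    (m : ℕ) : PowerSeries ℤ :=
  ∏ k ∈ Finset.Icc m S.length, ∏ i ∈ Finset.Icc (1 + if k = m then 1 else 0) (f k),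
    gaussFactor f u w₁ n₁₀ S k i

/-- The summand for `u > 1` (where `w_1 = ∞`, `n_{1,0} = N`). -/
noncomputable def termOfOneLt (f : ℕ → ℕ) (u d N : ℕ) (S : List (List ℕ)) : PowerSeries ℤ :=
  PowerSeries.X ^ fermExponent f u d S
    * invQFact (2 * (nExt f u ⊤ N S 1 (f 1)).toNat)
    * qFactLevel f u ⊤ N S 1
    * gaussLevels f u ⊤ N S 2

/-- The summand for `u = 1` (where `w_1 = ∞`, `n_{1,0} = N`).  The second factor is
`1 / (q)_{2 w_3}` with `w_3 = n_{2,f_2} - 1`; every admissible sequence has `x ≥ 3` and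
`n_{2,f_2} ≥ 1` in this case. -/
noncomputable def termOfEqOne (f : ℕ → ℕ) (d N : ℕ) (S : List (List ℕ)) : PowerSeries ℤ :=
  PowerSeries.X ^ fermExponent f 1 d S
    * invQFact (2 * ((nExt f 1 ⊤ N S 2 (f 2)).toNat - 1))
    * qFactLevel f 1 ⊤ N S 1
    * qFactLevel f 1 ⊤ N S 2
    * gaussLevels f 1 ⊤ N S 3

end Burge

namespace Burge

/-! ## The parts of a partition as a function on the integers -/

section BoxPart

variable {N M : ℕ}

/-! A partition in `(N, M)` is a lattice path across a box, and a restricted pair is a pair of paths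
kept apart by the parameters `a, b, α, β`. Deleting the last step of one path either drops a part or
narrows the box (`pairSum_succ_succ`, `pairGFInt_trim`). Together with the vanishing when the
endpoints collide and the trivial cases, this recursion controls every generating function. Two
identities are proved by checking that both sides obey it. Conjugation (`pairSum_conj`) exchanges
`N` with `M` and `(a, b)` with `(α, β)`. The Burge transform (`burge_transform`) expands the
function with `(α + a, β + b)` in functions with `(α, β)` on smaller boxes, with Gaussian
coefficients; Pascal's rule makes the expansion obey the recursion.

Undoing transforms and conjugating is the Euclidean algorithm on the parameters. For `a = r`, `b = p
- r`, `α = s`, `β = p' - s` it follows the partial quotients shared by `s : r` and `p' : p`, and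
after `d` transforms at level `u` it reaches `a = 1`, `α = 0`. There `p_i > q_i`, and lowering all
parts of `p` (`pairSum_shift`) produces the extra exponent `n_{u,d}`. The remaining pairs have `a =
α = 1`. For them an unequal-box form of the transform (`burge_transform_ordered`), with exponent `x
(x - 1)`, and `orderedGF_conj` consume the other partial quotients, until only trivial pairs survive
(`pairSum_terminal`). The recursion `fermSum` records this descent: `fermSum_eq` equates it with the
pair generating function, and `params_append` identifies the parameters with those of the two
continued fractions.

For `M → ∞` the limit is taken inside the finite recursion (`ContLeft`, `ContRight`): each Gaussian
tends to a Gaussian or to a reciprocal `q`-factorial. Unrolling the limit gives a finite sum over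
sequences of partitions (`fermSum_eq_sum`). The index set is the one defined by `Admissible`
(`mem_admSeqs`), and the summands are the stated products (`seqTerm_eq`, `termOfOneLt_eq`,
`termOfEqOne_eq`). -/

theorem boxPart_of_nonpos (p : Fin N → Fin (M + 1)) {i : ℤ} (hi : i ≤ 0) : boxPart p i = 0 := by
  simp [boxPart, hi]

theorem boxPart_of_lt (p : Fin N → Fin (M + 1)) {i : ℤ} (hi : (N : ℤ) < i) :
    boxPart p i = M := by
  have h1 : ¬ i ≤ 0 := by omega
  have h2 : ¬ i.toNat - 1 < N := by omega
  simp [boxPart, h1, h2]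

theorem boxPart_natCast_add_one (p : Fin N → Fin (M + 1)) (j : ℕ) (hj : j < N) :
    boxPart p ((j : ℤ) + 1) = ((p ⟨j, hj⟩ : ℕ) : ℤ) := by
  have h1 : ¬ ((j : ℤ) + 1) ≤ 0 := by omega
  have h2 : ((j : ℤ) + 1).toNat - 1 = j := by omega
  simp [boxPart, h1, hj]

/-- To know `boxPart p i`, distinguish `i ≤ 0`, `1 ≤ i ≤ N` and `N < i`. -/
theorem boxPart_cases (N : ℕ) (i : ℤ) : i ≤ 0 ∨ (∃ j : ℕ, j < N ∧ i = j + 1) ∨ (N : ℤ) < i := by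
  rcases le_or_gt i 0 with h | h
  · exact Or.inl h
  rcases le_or_gt i N with h' | h'
  · exact Or.inr (Or.inl ⟨(i - 1).toNat, by omega, by omega⟩)
  · exact Or.inr (Or.inr h')

theorem boxPart_nonneg (p : Fin N → Fin (M + 1)) (i : ℤ) : 0 ≤ boxPart p i := by
  unfold boxPart
  split_ifs <;> omega

theorem boxPart_le (p : Fin N → Fin (M + 1)) (i : ℤ) : boxPart p i ≤ M := by
  unfold boxPart
  split_ifs with h1 h2
  · omega
  · have := (p ⟨i.toNat - 1, h2⟩).is_lt
    omega
  · omega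

theorem monotone_iff_boxPart (p : Fin N → Fin (M + 1)) : Monotone p ↔ Monotone (boxPart p) := by
  constructor
  · intro h i j hij
    rcases boxPart_cases N i with hi | ⟨i', hi', rfl⟩ | hi
    · rw [boxPart_of_nonpos p hi]
      exact boxPart_nonneg p j
    · rcases boxPart_cases N j with hj | ⟨j', hj', rfl⟩ | hj
      · omega
      · rw [boxPart_natCast_add_one p _ hi', boxPart_natCast_add_one p _ hj']
        have : p ⟨i', hi'⟩ ≤ p ⟨j', hj'⟩ := h (by simp [Fin.le_def]; omega)
        exact_mod_cast this
      · rw [boxPart_of_lt p hj]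
        exact boxPart_le p _
    · rw [boxPart_of_lt p (lt_of_lt_of_le hi hij), boxPart_of_lt p hi]
  · intro h i j hij
    have := h (show ((i : ℕ) : ℤ) + 1 ≤ ((j : ℕ) : ℤ) + 1 by
      have : (i : ℕ) ≤ j := hij
      omega)
    rw [boxPart_natCast_add_one p _ i.2, boxPart_natCast_add_one p _ j.2] at this
    exact_mod_cast this

theorem boxPart_snoc (p : Fin N → Fin (M + 1)) (i : ℤ) :
    boxPart (Fin.snoc p (Fin.last M) : Fin (N + 1) → Fin (M + 1)) i = boxPart p i := by
  rcases boxPart_cases (N + 1) i with hi | ⟨j, hj, rfl⟩ | hi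
  · rw [boxPart_of_nonpos _ hi, boxPart_of_nonpos _ hi]
  · rw [boxPart_natCast_add_one _ _ hj]
    rcases Nat.lt_succ_iff_lt_or_eq.mp hj with h | rfl
    · rw [boxPart_natCast_add_one _ _ h]
      simp [Fin.snoc, h]
    · rw [boxPart_of_lt p (by omega)]
      simp [Fin.snoc]
  · rw [boxPart_of_lt _ hi, boxPart_of_lt _ (by push_cast at hi; omega)]

theorem boxPart_cons (p : Fin N → Fin (M + 1)) (i : ℤ) :
    boxPart (Fin.cons 0 p : Fin (N + 1) → Fin (M + 1)) (i + 1) = boxPart p i := by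
  rcases boxPart_cases N i with hi | ⟨j, hj, rfl⟩ | hi
  · rw [boxPart_of_nonpos p hi]
    rcases eq_or_lt_of_le hi with rfl | h
    · have := boxPart_natCast_add_one (Fin.cons 0 p : Fin (N + 1) → Fin (M + 1)) 0 (by omega)
      simpa using this
    · rw [boxPart_of_nonpos _ (by omega)]
  · rw [boxPart_natCast_add_one _ _ hj]
    have := boxPart_natCast_add_one (Fin.cons 0 p : Fin (N + 1) → Fin (M + 1)) (j + 1) (by omega)
    push_cast at this
    rw [this]
    rfl
  · rw [boxPart_of_lt _ hi, boxPart_of_lt _ (by push_cast; omega)]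

theorem boxPart_castSucc (p : Fin N → Fin (M + 1)) {i : ℤ} (hi : i ≤ N) :
    boxPart (fun j => (p j).castSucc) i = boxPart p i := by
  rcases boxPart_cases N i with hi | ⟨j, hj, rfl⟩ | hi'
  · rw [boxPart_of_nonpos _ hi, boxPart_of_nonpos _ hi]
  · rw [boxPart_natCast_add_one _ _ hj, boxPart_natCast_add_one _ _ hj]
    simp
  · omega

theorem boxPart_succ (p : Fin N → Fin (M + 1)) {i : ℤ} (hi : 0 < i) :
    boxPart (fun j => (p j).succ) i = boxPart p i + 1 := by
  rcases boxPart_cases N i with hi | ⟨j, hj, rfl⟩ | hi'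
  · omega
  · rw [boxPart_natCast_add_one _ _ hj, boxPart_natCast_add_one _ _ hj]
    simp
  · rw [boxPart_of_lt _ hi', boxPart_of_lt _ hi']
    push_cast
    rfl

theorem boxPart_rev (p : Fin N → Fin (M + 1)) (i : ℤ) :
    boxPart (fun j => (p j.rev).rev) i = M - boxPart p (N + 1 - i) := by
  rcases boxPart_cases N i with hi | ⟨j, hj, rfl⟩ | hi
  · rw [boxPart_of_nonpos _ hi, boxPart_of_lt _ (by omega)]
    simp
  · rw [boxPart_natCast_add_one _ _ hj]
    have : ((N : ℤ) + 1 - (j + 1)) = ((N - 1 - j : ℕ) : ℤ) + 1 := by omega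
    rw [this, boxPart_natCast_add_one _ _ (by omega)]
    have h2 : (Fin.rev (⟨j, hj⟩ : Fin N)) = ⟨N - 1 - j, by omega⟩ := by
      ext; simp [Fin.val_rev]; omega
    rw [h2, Fin.val_rev]
    have := (p ⟨N - 1 - j, by omega⟩).is_lt
    omega
  · rw [boxPart_of_lt _ hi, boxPart_of_nonpos _ (by omega)]
    simp

end BoxPart

/-- The conditions on a restricted partition pair, as conditions on the two functions `boxPart`. -/
structure PairCond (N₁ M₁ N₂ M₂ a b α β : ℤ) (Q P : ℤ → ℤ) : Prop where
  left : ∀ i : ℤ, max 1 a ≤ i → i ≤ min N₂ (N₁ + a - 1) → 1 - α ≤ P i - Q (i + 1 - a)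
  right : ∀ i : ℤ, max 1 b ≤ i → i ≤ min N₁ (N₂ + b - 1) → 1 - β ≤ Q i - P (i + 1 - b)
  a_zero : a = 0 → Q 1 ≤ α - 1
  b_zero : b = 0 → P 1 ≤ β - 1
  a_max : a = N₂ - N₁ → M₁ - α + 1 ≤ P N₂
  b_max : b = N₁ - N₂ → M₂ - β + 1 ≤ Q N₁

theorem PairCond.symm {N₁ M₁ N₂ M₂ a b α β : ℤ} {Q P : ℤ → ℤ}
    (h : PairCond N₁ M₁ N₂ M₂ a b α β Q P) : PairCond N₂ M₂ N₁ M₁ b a β α P Q :=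
  ⟨h.right, h.left, h.b_zero, h.a_zero, h.b_max, h.a_max⟩

theorem isRestrictedPair_iff {N₁ M₁ N₂ M₂ : ℕ} (a b α β : ℤ)
    (q : Fin N₁ → Fin (M₁ + 1)) (p : Fin N₂ → Fin (M₂ + 1)) :
    IsRestrictedPair a b α β q p ↔
      Monotone q ∧ Monotone p ∧ PairCond N₁ M₁ N₂ M₂ a b α β (boxPart q) (boxPart p) :=
  ⟨fun h => ⟨h.1, h.2, h.3, h.4, h.5, h.6, h.7, h.8⟩,
    fun h => ⟨h.1, h.2.1, h.2.2.1, h.2.2.2, h.2.2.3, h.2.2.4, h.2.2.5, h.2.2.6⟩⟩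

open Classical in
/-- The sum of `φ (wt q) (wt p)` over all restricted partition pairs `(q, p)`. -/
noncomputable def pairSum {A : Type*} [AddCommMonoid A] (N₁ M₁ N₂ M₂ : ℕ) (a b α β : ℤ)
    (φ : ℤ → ℤ → A) : A :=
  ∑ x : (Fin N₁ → Fin (M₁ + 1)) × (Fin N₂ → Fin (M₂ + 1)) with
    IsRestrictedPair a b α β x.1 x.2,
    φ (∑ i, ((x.1 i : ℕ) : ℤ)) (∑ i, ((x.2 i : ℕ) : ℤ))

/-! ### Symmetry and trimming recursions for sums over restricted pairs -/

section PairSum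

variable {A : Type*} [AddCommMonoid A]

theorem isRestrictedPair_comm {N₁ M₁ N₂ M₂ : ℕ} {a b α β : ℤ}
    {q : Fin N₁ → Fin (M₁ + 1)} {p : Fin N₂ → Fin (M₂ + 1)} :
    IsRestrictedPair a b α β q p ↔ IsRestrictedPair b a β α p q := by
  rw [isRestrictedPair_iff, isRestrictedPair_iff]
  exact ⟨fun h => ⟨h.2.1, h.1, h.2.2.symm⟩, fun h => ⟨h.2.1, h.1, h.2.2.symm⟩⟩

theorem pairSum_swap (N₁ M₁ N₂ M₂ : ℕ) (a b α β : ℤ) (φ : ℤ → ℤ → A) :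
    pairSum N₁ M₁ N₂ M₂ a b α β φ = pairSum N₂ M₂ N₁ M₁ b a β α (fun i j => φ j i) := by
  unfold pairSum
  refine Finset.sum_nbij' Prod.swap Prod.swap ?_ ?_ ?_ ?_ ?_ <;>
    simp [isRestrictedPair_comm (a := a)]

open Classical in
/-- The pairs in which the largest part of `q` is maximal. -/
theorem sum_last_eq (N₁ M₁ N₂ M₂ : ℕ) (a b α β : ℤ) (φ : ℤ → ℤ → A)
    (ha : 0 ≤ a) (hxa : (N₂ : ℤ) - (N₁ + 1) < a) (hxb : -b ≤ (N₂ : ℤ) - (N₁ + 1)) (hy : (M₂ : ℤ) - M₁ < β) :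
    (∑ x : (Fin (N₁ + 1) → Fin (M₁ + 1)) × (Fin N₂ → Fin (M₂ + 1)) with
      IsRestrictedPair a b α β x.1 x.2 ∧ x.1 (Fin.last N₁) = Fin.last M₁,
      φ (∑ i, ((x.1 i : ℕ) : ℤ)) (∑ i, ((x.2 i : ℕ) : ℤ)))
    = pairSum N₁ M₁ N₂ M₂ a b α β (fun i j => φ (M₁ + i) j) := by
  have key : ∀ (q : Fin N₁ → Fin (M₁ + 1)) (p : Fin N₂ → Fin (M₂ + 1)),
      IsRestrictedPair a b α β (Fin.snoc q (Fin.last M₁) : Fin (N₁ + 1) → Fin (M₁ + 1)) p ↔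
        IsRestrictedPair a b α β q p := by
    intro q p
    have hb : boxPart (Fin.snoc q (Fin.last M₁) : Fin (N₁ + 1) → Fin (M₁ + 1)) = boxPart q :=
      funext (boxPart_snoc q)
    rw [isRestrictedPair_iff, isRestrictedPair_iff, monotone_iff_boxPart, monotone_iff_boxPart q,
      hb]
    refine and_congr_right fun _ => and_congr_right fun _ => ?_
    -- The removed part is still visible through the convention that parts beyond the last equal
    -- `M₁`. The comparison with it becomes the condition `a_max` of the smaller pair; its
    -- comparison in `right` holds automatically by `hy`.
    have hlast : boxPart q (N₁ + 1) = M₁ := boxPart_of_lt q (by omega)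
    have hP := boxPart_le p
    constructor
    · intro h
      refine ⟨fun i h1 h2 => h.left i h1 (by push_cast; omega),
        fun i h1 h2 => h.right i h1 (by push_cast; omega), h.a_zero, h.b_zero, ?_, ?_⟩
      · intro ha
        rcases Nat.eq_zero_or_pos N₂ with h0 | h0
        · subst h0
          have h1 := h.a_zero (by omega)
          have h2 := boxPart_nonneg p ((0 : ℕ) : ℤ)
          obtain rfl : N₁ = 0 := by omega
          simp only [Nat.cast_zero, zero_add] at hlast h2 ⊢
          omega
        · have := h.left N₂ (by omega) (by push_cast; omega)
          rw [show (N₂ : ℤ) + 1 - a = N₁ + 1 by omega, hlast] at this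
          omega
      · intro hb
        omega
    · intro h
      refine ⟨fun i h1 h2 => ?_, fun i h1 h2 => ?_, h.a_zero, h.b_zero, ?_, ?_⟩
      · push_cast at h2
        rcases le_or_gt i ((N₁ : ℤ) + a - 1) with h3 | h3
        · exact h.left i h1 (by omega)
        · have h4 : i = N₁ + a := by omega
          have h5 : i = N₂ := by omega
          have := h.a_max (by omega)
          rw [show i + 1 - a = (N₁ : ℤ) + 1 by omega, hlast, h5]
          omega
      · push_cast at h2
        rcases le_or_gt i (N₁ : ℤ) with h3 | h3
        · exact h.right i h1 (by omega)
        · obtain rfl : i = N₁ + 1 := by omega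
          have h5 := hP ((N₁ : ℤ) + 1 + 1 - b)
          rw [hlast]
          omega
      · intro ha
        push_cast at ha
        omega
      · intro _
        push_cast
        rw [hlast]
        omega
  unfold pairSum
  refine Finset.sum_nbij' (fun x => (Fin.init x.1, x.2))
    (fun x => ((Fin.snoc x.1 (Fin.last M₁) : Fin (N₁ + 1) → Fin (M₁ + 1)), x.2)) ?_ ?_ ?_ ?_ ?_
  · rintro ⟨q, p⟩ hx
    simp only [Finset.mem_filter, Finset.mem_univ, true_and] at hx ⊢
    rw [← key, ← hx.2, Fin.snoc_init_self]
    exact hx.1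
  · rintro ⟨q, p⟩ hx
    simp only [Finset.mem_filter, Finset.mem_univ, true_and] at hx ⊢
    exact ⟨(key q p).2 hx, by simp⟩
  · rintro ⟨q, p⟩ hx
    simp only [Finset.mem_filter, Finset.mem_univ, true_and] at hx
    simp only [Prod.mk.injEq, and_true]
    rw [← hx.2, Fin.snoc_init_self]
  · rintro ⟨q, p⟩ hx
    simp
  · rintro ⟨q, p⟩ hx
    simp only [Finset.mem_filter, Finset.mem_univ, true_and] at hx
    simp only [Fin.sum_univ_castSucc, hx.2, Fin.val_last, Fin.init]
    rw [add_comm]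

open Classical in
/-- The pairs in which the largest part of `q` is not maximal. -/
theorem sum_last_ne (N₁ M₁ N₂ M₂ : ℕ) (a b α β : ℤ) (φ : ℤ → ℤ → A)
    (hxa : (N₂ : ℤ) - N₁ < a) :
    (∑ x : (Fin N₁ → Fin (M₁ + 1 + 1)) × (Fin N₂ → Fin (M₂ + 1)) with
      IsRestrictedPair a b α β x.1 x.2 ∧ ∀ i, x.1 i ≠ Fin.last (M₁ + 1),
      φ (∑ i, ((x.1 i : ℕ) : ℤ)) (∑ i, ((x.2 i : ℕ) : ℤ)))
    = pairSum N₁ M₁ N₂ M₂ a b α β φ := by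
  have key : ∀ (q : Fin N₁ → Fin (M₁ + 1)) (p : Fin N₂ → Fin (M₂ + 1)),
      IsRestrictedPair a b α β (fun i => (q i).castSucc) p ↔
        IsRestrictedPair a b α β q p := by
    intro q p
    have hmono : Monotone (fun i => (q i).castSucc) ↔ Monotone q := by
      simp only [Monotone, Fin.castSucc_le_castSucc_iff]
    rw [isRestrictedPair_iff, isRestrictedPair_iff, hmono]
    refine and_congr_right fun _ => and_congr_right fun _ => ?_
    constructor
    · intro h
      refine ⟨fun i h1 h2 => ?_, fun i h1 h2 => ?_, fun h1 => ?_, h.b_zero, fun h1 => ?_,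
        fun h1 => ?_⟩
      · have := h.left i h1 h2
        rwa [boxPart_castSucc q (by omega)] at this
      · have := h.right i h1 h2
        rwa [boxPart_castSucc q (by omega)] at this
      · have := h.a_zero h1
        rwa [boxPart_castSucc q (by omega)] at this
      · omega
      · have := h.b_max h1
        rwa [boxPart_castSucc q (by omega)] at this
    · intro h
      refine ⟨fun i h1 h2 => ?_, fun i h1 h2 => ?_, fun h1 => ?_, h.b_zero, fun h1 => ?_,
        fun h1 => ?_⟩
      · rw [boxPart_castSucc q (by omega)]
        exact h.left i h1 h2
      · rw [boxPart_castSucc q (by omega)]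
        exact h.right i h1 h2
      · rw [boxPart_castSucc q (by omega)]
        exact h.a_zero h1
      · omega
      · rw [boxPart_castSucc q (by omega)]
        exact h.b_max h1
  -- The `min` never takes effect on such `q`; it only makes the inverse of `castSucc` total.
  have hlt : ∀ q : Fin N₁ → Fin (M₁ + 1 + 1), (∀ i, q i ≠ Fin.last (M₁ + 1)) →
      (fun i => (⟨min (q i : ℕ) M₁, by omega⟩ : Fin (M₁ + 1)).castSucc) = q := by
    intro q hq
    ext i
    have h1 := hq i
    have h2 := (q i).is_lt
    simp only [ne_eq, Fin.ext_iff, Fin.val_last] at h1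
    simp only [Fin.castSucc_mk]
    omega
  unfold pairSum
  refine Finset.sum_nbij' (fun x => ((fun i => ⟨min (x.1 i : ℕ) M₁, by omega⟩), x.2))
    (fun x => ((fun i => (x.1 i).castSucc), x.2)) ?_ ?_ ?_ ?_ ?_
  · rintro ⟨q, p⟩ hx
    simp only [Finset.mem_filter, Finset.mem_univ, true_and] at hx ⊢
    rw [← key, hlt q hx.2]
    exact hx.1
  · rintro ⟨q, p⟩ hx
    simp only [Finset.mem_filter, Finset.mem_univ, true_and] at hx ⊢
    exact ⟨(key q p).2 hx, fun i => (Fin.castSucc_lt_last _).ne⟩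
  · rintro ⟨q, p⟩ hx
    simp only [Finset.mem_filter, Finset.mem_univ, true_and] at hx
    simp only [Prod.mk.injEq, and_true]
    exact hlt q hx.2
  · rintro ⟨q, p⟩ hx
    simp only [Prod.mk.injEq, and_true]
    ext i
    have := (q i).is_lt
    simp
    omega
  · rintro ⟨q, p⟩ hx
    simp only [Finset.mem_filter, Finset.mem_univ, true_and] at hx
    congr 1
    refine Finset.sum_congr rfl fun i _ => ?_
    have := congrArg Fin.val (congrFun (hlt q hx.2) i)
    simp only [Fin.val_castSucc] at this
    simp only [this]

/-- Either the largest part of `q` fills the box, and removing it costs `M₁ + 1` in weight, or by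
monotonicity no part does and the box can be narrowed. -/
theorem pairSum_succ_succ (N₁ M₁ N₂ M₂ : ℕ) (a b α β : ℤ) (φ : ℤ → ℤ → A)
    (ha : 0 ≤ a) (hxa : (N₂ : ℤ) - (N₁ + 1) < a) (hxb : -b ≤ (N₂ : ℤ) - (N₁ + 1))
    (hy : (M₂ : ℤ) - (M₁ + 1) < β) :
    pairSum (N₁ + 1) (M₁ + 1) N₂ M₂ a b α β φ =
      pairSum N₁ (M₁ + 1) N₂ M₂ a b α β (fun i j => φ ((M₁ + 1) + i) j)
        + pairSum (N₁ + 1) M₁ N₂ M₂ a b α β φ := by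
  classical
  have h1 := sum_last_eq N₁ (M₁ + 1) N₂ M₂ a b α β φ ha hxa hxb (by push_cast; omega)
  have h2 := sum_last_ne (N₁ + 1) M₁ N₂ M₂ a b α β φ (by push_cast; omega)
  push_cast at h1
  rw [← h1, ← h2]
  conv_lhs => unfold pairSum
  rw [← Finset.sum_filter_add_sum_filter_not _ (fun x => x.1 (Fin.last N₁) = Fin.last (M₁ + 1)),
    Finset.filter_filter, Finset.filter_filter]
  congr 1
  refine Finset.sum_congr ?_ fun _ _ => rfl
  ext ⟨q, p⟩
  simp only [Finset.mem_filter, Finset.mem_univ, true_and]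
  refine and_congr_right fun h => ⟨fun h2 i hi => h2 ?_, fun h => h _⟩
  exact le_antisymm (Fin.le_last _) (hi ▸ h.monotone_left (Fin.le_last i))

theorem pairSum_succ_zero (N₁ N₂ M₂ : ℕ) (a b α β : ℤ) (φ : ℤ → ℤ → A)
    (ha : 0 ≤ a) (hxa : (N₂ : ℤ) - (N₁ + 1) < a) (hxb : -b ≤ (N₂ : ℤ) - (N₁ + 1))
    (hy : (M₂ : ℤ) < β) :
    pairSum (N₁ + 1) 0 N₂ M₂ a b α β φ = pairSum N₁ 0 N₂ M₂ a b α β φ := by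
  classical
  have h1 := sum_last_eq N₁ 0 N₂ M₂ a b α β φ ha hxa hxb (by push_cast; omega)
  simp only [Nat.cast_zero, zero_add] at h1
  rw [← h1]
  unfold pairSum
  refine Finset.sum_congr ?_ fun _ _ => rfl
  ext ⟨q, p⟩
  simp only [Finset.mem_filter, Finset.mem_univ, true_and]
  exact ⟨fun h => ⟨h, Subsingleton.elim (α := Fin 1) _ _⟩, fun h => h.1⟩

theorem pairSum_zero_succ (M₁ N₂ M₂ : ℕ) (a b α β : ℤ) (φ : ℤ → ℤ → A)
    (hxa : (N₂ : ℤ) < a) :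
    pairSum 0 (M₁ + 1) N₂ M₂ a b α β φ = pairSum 0 M₁ N₂ M₂ a b α β φ := by
  classical
  have h1 := sum_last_ne 0 M₁ N₂ M₂ a b α β φ (by push_cast; omega)
  rw [← h1]
  unfold pairSum
  refine Finset.sum_congr ?_ fun _ _ => rfl
  ext ⟨q, p⟩
  simp only [Finset.mem_filter, Finset.mem_univ, true_and]
  exact ⟨fun h => ⟨h, fun i => i.elim0⟩, fun h => h.1⟩

/-- There are no restricted pairs if the endpoints of the two lattice paths collide. -/
theorem pairSum_eq_zero_of_collision (N₁ M₁ N₂ M₂ : ℕ) (a b α β : ℤ) (φ : ℤ → ℤ → A)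
    (hx : (N₂ : ℤ) - N₁ = a) (hy : (M₂ : ℤ) - M₁ = -α) :
    pairSum N₁ M₁ N₂ M₂ a b α β φ = 0 := by
  classical
  unfold pairSum
  rw [Finset.filter_false_of_mem, Finset.sum_empty]
  rintro ⟨q, p⟩ - h
  have h1 := h.special_a_max hx.symm
  have h2 := boxPart_le p N₂
  simp only at h1
  omega

/-- All restricted pairs in which both partitions are trivial. -/
theorem pairSum_trivial (N₁ M₁ N₂ M₂ : ℕ) (a b α β : ℤ) (φ : ℤ → ℤ → A)
    (h1 : N₁ = 0 ∨ M₁ = 0) (h2 : N₂ = 0 ∨ M₂ = 0)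
    (h : IsRestrictedPair a b α β (0 : Fin N₁ → Fin (M₁ + 1)) (0 : Fin N₂ → Fin (M₂ + 1))) :
    pairSum N₁ M₁ N₂ M₂ a b α β φ = φ 0 0 := by
  classical
  have hs : ∀ N M : ℕ, N = 0 ∨ M = 0 → ∀ q : Fin N → Fin (M + 1), q = 0 := by
    rintro N M (rfl | rfl) q
    · exact Subsingleton.elim _ _
    · exact Subsingleton.elim (α := Fin N → Fin 1) _ _
  unfold pairSum
  rw [Finset.sum_eq_single (0, 0)]
  · simp
  · rintro ⟨q, p⟩ - hne
    exact absurd (Prod.ext (hs _ _ h1 q) (hs _ _ h2 p)) hne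
  · intro hn
    simp [h] at hn

end PairSum

/-! ## Conjugation of restricted partition pairs -/

section Conjugation

variable {A : Type*} [AddCommMonoid A]

theorem pairSum_congr {N₁ M₁ N₂ M₂ : ℕ} {a b α β : ℤ} {φ ψ : ℤ → ℤ → A}
    (h : ∀ i j, φ i j = ψ i j) :
    pairSum N₁ M₁ N₂ M₂ a b α β φ = pairSum N₁ M₁ N₂ M₂ a b α β ψ := by
  rw [show φ = ψ from funext₂ h]

theorem pairSum_eq_zero_of_collision' (N₁ M₁ N₂ M₂ : ℕ) (a b α β : ℤ) (φ : ℤ → ℤ → A)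
    (hx : (N₂ : ℤ) - N₁ = -b) (hy : (M₂ : ℤ) - M₁ = β) :
    pairSum N₁ M₁ N₂ M₂ a b α β φ = 0 := by
  rw [pairSum_swap]
  exact pairSum_eq_zero_of_collision _ _ _ _ _ _ _ _ _ (by omega) (by omega)

theorem boxPart_zero_of_le {N M : ℕ} {i : ℤ} (hi : i ≤ N) :
    boxPart (0 : Fin N → Fin (M + 1)) i = 0 := by
  rcases boxPart_cases N i with hi | ⟨j, hj, rfl⟩ | hi'
  · rw [boxPart_of_nonpos _ hi]
  · rw [boxPart_natCast_add_one _ _ hj]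
    simp
  · omega

theorem isRestrictedPair_trivial {N₂ M₂ : ℕ} {a b α β : ℤ}
    (h1 : a = 0 → 1 ≤ α) (h2 : a = N₂ → 1 ≤ α) (h3 : b = 0 → M₂ < β) (hb : 0 ≤ b) :
    IsRestrictedPair a b α β (0 : Fin 0 → Fin (0 + 1)) (0 : Fin N₂ → Fin (M₂ + 1)) := by
  refine (isRestrictedPair_iff _ _ _ _ _ _).2 ⟨fun _ _ _ => le_rfl, fun _ _ _ => le_rfl, ?_⟩
  have hQ : ∀ i, boxPart (0 : Fin 0 → Fin (0 + 1)) i = 0 := fun i =>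
    le_antisymm (by simpa using boxPart_le (0 : Fin 0 → Fin (0 + 1)) i) (boxPart_nonneg _ _)
  refine ⟨fun i h4 h5 => ?_, fun i h4 h5 => ?_, fun h4 => ?_, fun h4 => ?_, fun h4 => ?_,
    fun h4 => ?_⟩
  · simp only [Nat.cast_zero] at h5
    omega
  · simp only [Nat.cast_zero] at h5
    omega
  · rw [hQ]
    have := h1 h4
    omega
  · have := h3 h4
    have := boxPart_le (0 : Fin N₂ → Fin (M₂ + 1)) 1
    omega
  · rw [boxPart_zero_of_le le_rfl]
    simp only [Nat.cast_zero] at h4 ⊢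
    have := h2 (by omega)
    omega
  · rw [hQ]
    simp only [Nat.cast_zero] at h4
    have := h3 (by omega)
    omega

/-- Reflection in the main diagonal of the two lattice paths, which is conjugation followed by
complementation. -/
def Reflects (A : Type*) [AddCommMonoid A] (N₁ M₁ N₂ M₂ : ℕ) (a b α β : ℤ) : Prop :=
  ∀ φ : ℤ → ℤ → A, pairSum N₁ M₁ N₂ M₂ a b α β φ =
    pairSum M₁ N₁ M₂ N₂ β α b a (fun i j => φ (N₁ * M₁ - i) (N₂ * M₂ - j))

theorem Reflects.swap {N₁ M₁ N₂ M₂ : ℕ} {a b α β : ℤ} (h : Reflects A N₁ M₁ N₂ M₂ a b α β) :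
    Reflects A N₂ M₂ N₁ M₁ b a β α := by
  intro φ
  rw [pairSum_swap, h, pairSum_swap]

/-- Reflection interchanges the two terms of the trimming recursion: dropping a part on one side is
narrowing the box on the other. The complemented weights then match term by term. -/
theorem Reflects.step {N₁ M₁ N₂ M₂ : ℕ} {a b α β : ℤ} (ha : 0 ≤ a) (hβ : 0 ≤ β)
    (hxa : (N₂ : ℤ) - N₁ < a) (hxb : -b ≤ (N₂ : ℤ) - N₁)
    (hyβ : (M₂ : ℤ) - M₁ < β) (hyα : -α ≤ (M₂ : ℤ) - M₁) (hpos : 0 < N₁ + M₁)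
    (hN : 0 < N₁ → Reflects A (N₁ - 1) M₁ N₂ M₂ a b α β)
    (hM : 0 < M₁ → Reflects A N₁ (M₁ - 1) N₂ M₂ a b α β) :
    Reflects A N₁ M₁ N₂ M₂ a b α β := by
  intro φ
  rcases N₁ with _ | N₁ <;> rcases M₁ with _ | M₁
  · omega
  · have h := hM (by omega)
    simp only [add_tsub_cancel_right] at h
    push_cast at hyβ hyα hxa hxb
    rw [pairSum_zero_succ _ _ _ _ _ _ _ _ (by omega),
      pairSum_succ_zero _ _ _ _ _ _ _ _ hβ (by omega) (by omega) (by omega), h]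
    exact pairSum_congr fun i j => by simp
  · have h := hN (by omega)
    simp only [add_tsub_cancel_right] at h
    push_cast at hyβ hyα hxa hxb
    rw [pairSum_zero_succ _ _ _ _ _ _ _ _ (by omega),
      pairSum_succ_zero _ _ _ _ _ _ _ _ ha (by omega) (by omega) (by omega), h]
    exact pairSum_congr fun i j => by simp
  · have h1 := hN (by omega)
    have h2 := hM (by omega)
    simp only [add_tsub_cancel_right] at h1 h2
    push_cast at hyβ hyα hxa hxb
    rw [pairSum_succ_succ _ _ _ _ _ _ _ _ _ ha (by omega) (by omega) (by omega),
      pairSum_succ_succ _ _ _ _ _ _ _ _ _ hβ (by omega) (by omega) (by omega), h1, h2, add_comm]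
    congr 1
    · refine pairSum_congr fun i j => ?_
      congr 1
      push_cast
      ring
    · refine pairSum_congr fun i j => ?_
      congr 1
      push_cast
      ring

theorem reflects_of_trivial {N₂ M₂ : ℕ} {a b α β : ℤ} (h : N₂ = 0 ∨ M₂ = 0)
    (h1 : a = 0 → 1 ≤ α) (h2 : a = N₂ → 1 ≤ α) (h3 : b = 0 → M₂ < β) (hb : 0 ≤ b)
    (h4 : β = 0 → 1 ≤ b) (h5 : β = M₂ → 1 ≤ b) (h6 : α = 0 → N₂ < a) (hα : 0 ≤ α) :
    Reflects A 0 0 N₂ M₂ a b α β := by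
  intro φ
  rw [pairSum_trivial _ _ _ _ _ _ _ _ _ (Or.inl rfl) h (isRestrictedPair_trivial h1 h2 h3 hb),
    pairSum_trivial _ _ _ _ _ _ _ _ _ (Or.inl rfl) h.symm
      (isRestrictedPair_trivial h4 h5 h6 hα)]
  rcases h with rfl | rfl <;> simp

/-- Induction on the total size of the boxes. Both sides vanish when the endpoints collide;
otherwise a path is trimmed on both sides. -/
theorem reflects (n : ℕ) : ∀ (N₁ M₁ N₂ M₂ : ℕ) (a b α β : ℤ), N₁ + M₁ + N₂ + M₂ = n →
    0 ≤ a → 0 ≤ b → 0 ≤ α → 0 ≤ β → 0 < a + b → 0 < α + β →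
    (N₂ : ℤ) - N₁ ≤ a → -b ≤ (N₂ : ℤ) - N₁ → (M₂ : ℤ) - M₁ ≤ β → -α ≤ (M₂ : ℤ) - M₁ →
    Reflects A N₁ M₁ N₂ M₂ a b α β := by
  induction n using Nat.strong_induction_on with
  | _ n ih =>
  intro N₁ M₁ N₂ M₂ a b α β hn ha hb hα hβ hab hαβ hxa hxb hyβ hyα
  by_cases hc1 : (N₂ : ℤ) - N₁ = a ∧ (M₂ : ℤ) - M₁ = -α
  · intro φ
    rw [pairSum_eq_zero_of_collision _ _ _ _ _ _ _ _ _ hc1.1 hc1.2,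
      pairSum_eq_zero_of_collision' _ _ _ _ _ _ _ _ _ hc1.2 hc1.1]
  by_cases hc2 : (N₂ : ℤ) - N₁ = -b ∧ (M₂ : ℤ) - M₁ = β
  · intro φ
    rw [pairSum_eq_zero_of_collision' _ _ _ _ _ _ _ _ _ hc2.1 hc2.2,
      pairSum_eq_zero_of_collision _ _ _ _ _ _ _ _ _ hc2.2 hc2.1]
  by_cases hQ : 0 < N₁ + M₁ ∧ (N₂ : ℤ) - N₁ < a ∧ (M₂ : ℤ) - M₁ < β
  · exact Reflects.step ha hβ hQ.2.1 hxb hQ.2.2 hyα hQ.1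
      (fun h => ih (n - 1) (by omega) _ _ _ _ _ _ _ _ (by omega) ha hb hα hβ hab hαβ
        (by omega) (by omega) (by omega) (by omega))
      (fun h => ih (n - 1) (by omega) _ _ _ _ _ _ _ _ (by omega) ha hb hα hβ hab hαβ
        (by omega) (by omega) (by omega) (by omega))
  by_cases hP : 0 < N₂ + M₂ ∧ -b < (N₂ : ℤ) - N₁ ∧ -α < (M₂ : ℤ) - M₁
  · exact (Reflects.step hb hα (by omega) (by omega) (by omega) (by omega) hP.1
      (fun h => ih (n - 1) (by omega) _ _ _ _ _ _ _ _ (by omega) hb ha hβ hα (by omega) (by omega)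
        (by omega) (by omega) (by omega) (by omega))
      (fun h => ih (n - 1) (by omega) _ _ _ _ _ _ _ _ (by omega) hb ha hβ hα (by omega) (by omega)
        (by omega) (by omega) (by omega) (by omega))).swap
  -- If both paths were nonempty and neither could be trimmed, the endpoints would either collide or
  -- give `a = -b` or `β = -α`, which `hab` and `hαβ` exclude. So one path is empty.
  by_cases h0 : N₁ = 0 ∧ M₁ = 0
  · obtain ⟨rfl, rfl⟩ := h0
    simp only [Nat.cast_zero, sub_zero] at *
    exact reflects_of_trivial (by omega) (by omega) (by omega) (by omega) (by omega) (by omega)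
      (by omega) (by omega) (by omega)
  · obtain ⟨rfl, rfl⟩ : N₂ = 0 ∧ M₂ = 0 := by omega
    simp only [Nat.cast_zero, zero_sub] at *
    exact (reflects_of_trivial (by omega) (by omega) (by omega) (by omega) (by omega) (by omega)
      (by omega) (by omega) (by omega)).swap

theorem IsRestrictedPair.rev {N M : ℕ} {a b α β : ℤ} {q p : Fin N → Fin (M + 1)}
    (h : IsRestrictedPair a b α β q p) :
    IsRestrictedPair b a β α (fun j : Fin N => (q j.rev).rev) (fun j : Fin N => (p j.rev).rev) := by
  have hm : ∀ q : Fin N → Fin (M + 1), Monotone q → Monotone (fun j : Fin N => (q j.rev).rev) :=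
    fun q hq i j hij => Fin.rev_le_rev.2 (hq (Fin.rev_le_rev.2 hij))
  rw [isRestrictedPair_iff] at h ⊢
  obtain ⟨hq, hp, h⟩ := h
  refine ⟨hm q hq, hm p hp, ⟨fun i h1 h2 => ?_, fun i h1 h2 => ?_, fun h1 => ?_, fun h1 => ?_,
    fun h1 => ?_, fun h1 => ?_⟩⟩ <;> simp only [boxPart_rev]
  · have := h.right (N - i + b) (by omega) (by omega)
    rw [show (N : ℤ) - i + b + 1 - b = N + 1 - i by ring] at this
    rw [show (N : ℤ) + 1 - (i + 1 - b) = N - i + b by ring]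
    omega
  · have := h.left (N - i + a) (by omega) (by omega)
    rw [show (N : ℤ) - i + a + 1 - a = N + 1 - i by ring] at this
    rw [show (N : ℤ) + 1 - (i + 1 - a) = N - i + a by ring]
    omega
  · have := h.b_max (by omega)
    rw [show (N : ℤ) + 1 - 1 = N by ring]
    omega
  · have := h.a_max (by omega)
    rw [show (N : ℤ) + 1 - 1 = N by ring]
    omega
  · have := h.b_zero (by omega)
    rw [show (N : ℤ) + 1 - N = 1 by ring]
    omega
  · have := h.a_zero (by omega)
    rw [show (N : ℤ) + 1 - N = 1 by ring]
    omega

/-- A half-turn of the box reverses the order of the parts and complements them, which exchanges the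
roles of `(a, α)` and `(b, β)`. -/
theorem pairSum_rotate (N M : ℕ) (a b α β : ℤ) (φ : ℤ → ℤ → A) :
    pairSum N M N M a b α β φ =
      pairSum N M N M b a β α (fun i j => φ (N * M - i) (N * M - j)) := by
  have hs : ∀ q : Fin N → Fin (M + 1),
      ∑ i, ((q i : ℕ) : ℤ) = N * M - ∑ i : Fin N, (((q i.rev).rev : ℕ) : ℤ) := by
    intro q
    have h1 : ∑ i : Fin N, (((q i.rev).rev : ℕ) : ℤ) = ∑ i : Fin N, (((q i).rev : ℕ) : ℤ) :=
      Equiv.sum_comp Fin.revPerm (fun i => (((q i).rev : ℕ) : ℤ))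
    have h2 : ∀ i, (((q i).rev : ℕ) : ℤ) = M - ((q i : ℕ) : ℤ) := by
      intro i
      have := (q i).is_lt
      rw [Fin.val_rev]
      omega
    rw [h1, Finset.sum_congr rfl fun i _ => h2 i]
    simp
  classical
  unfold pairSum
  refine Finset.sum_nbij' (fun x => (fun j : Fin N => (x.1 j.rev).rev, fun j : Fin N => (x.2 j.rev).rev))
    (fun x => (fun j : Fin N => (x.1 j.rev).rev, fun j : Fin N => (x.2 j.rev).rev)) ?_ ?_ ?_ ?_ ?_
  · rintro ⟨q, p⟩ h
    simp only [Finset.mem_filter, Finset.mem_univ, true_and] at h ⊢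
    exact h.rev
  · rintro ⟨q, p⟩ h
    simp only [Finset.mem_filter, Finset.mem_univ, true_and] at h ⊢
    exact h.rev
  · rintro ⟨q, p⟩ -
    simp
  · rintro ⟨q, p⟩ -
    simp
  · rintro ⟨q, p⟩ -
    rw [hs q, hs p]

/-- Conjugation of both partitions. -/
theorem pairSum_conj (N M : ℕ) {a b α β : ℤ} (ha : 0 ≤ a) (hb : 0 ≤ b) (hα : 0 ≤ α) (hβ : 0 ≤ β)
    (hab : 0 < a + b) (hαβ : 0 < α + β) (φ : ℤ → ℤ → A) :
    pairSum N M N M a b α β φ = pairSum M N M N α β a b φ := by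
  -- A reflection followed by a half-turn is conjugation; the two complementations of the weight
  -- cancel.
  rw [reflects _ N M N M a b α β rfl ha hb hα hβ hab hαβ (by omega) (by omega) (by omega)
    (by omega), pairSum_rotate]
  exact pairSum_congr fun i j => by congr 1 <;> ring

end Conjugation

/-! ## Pairs with a part removed or with all parts shifted -/

section Special

variable {A : Type*} [AddCommMonoid A]

/-- The prepended zero shifts the indices of `q` by one, which turns `0, b + 1` into `1, b`. For `b
= 0` and `N > 0`, its comparison with `p_1` becomes the condition `b_zero`. -/
theorem isRestrictedPair_cons {N M : ℕ} {b β : ℤ} (hb : 0 ≤ b) (q p : Fin N → Fin (M + 1)) :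
    IsRestrictedPair 0 (b + 1) 1 β (Fin.cons 0 q : Fin (N + 1) → Fin (M + 1)) p ↔
      IsRestrictedPair 1 b 1 β q p := by
  have hm : Monotone (Fin.cons 0 q : Fin (N + 1) → Fin (M + 1)) ↔ Monotone q := by
    constructor
    · intro h i j hij
      simpa using h (Fin.succ_le_succ_iff.2 hij)
    · intro h i j
      refine Fin.cases ?_ (fun i => ?_) i
      · simp
      · refine Fin.cases ?_ (fun j => ?_) j
        · simp
        · intro hij
          simpa using h (Fin.succ_le_succ_iff.1 hij)
  have hc : ∀ i, boxPart (Fin.cons 0 q : Fin (N + 1) → Fin (M + 1)) i = boxPart q (i - 1) := by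
    intro i
    rw [← boxPart_cons q (i - 1), sub_add_cancel]
  rw [isRestrictedPair_iff, isRestrictedPair_iff, hm]
  refine and_congr_right fun _ => and_congr_right fun _ => ?_
  have h0 : boxPart q 0 = 0 := boxPart_of_nonpos q le_rfl
  constructor
  · intro h
    refine ⟨fun i h1 h2 => ?_, fun i h1 h2 => ?_, fun h1 => ?_, fun h1 => ?_, fun h1 => ?_,
      fun h1 => ?_⟩
    · have := h.left i (by omega) (by push_cast; omega)
      rw [hc] at this
      convert this using 3
      ring
    · have := h.right (i + 1) (by omega) (by push_cast; omega)
      rw [hc] at this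
      convert this using 3 <;> ring
    · omega
    · subst h1
      rcases Nat.eq_zero_or_pos N with rfl | hN
      · have := h.b_max (by simp)
        rw [hc] at this
        simp only [Nat.cast_one, zero_add, sub_self, h0] at this
        have := boxPart_le p 1
        omega
      · have := h.right 1 (by omega) (by push_cast; omega)
        rw [hc] at this
        norm_num at this
        rw [h0] at this
        omega
    · omega
    · have := h.b_max (by push_cast; omega)
      rw [hc] at this
      simpa using this
  · intro h
    refine ⟨fun i h1 h2 => ?_, fun i h1 h2 => ?_, fun h1 => ?_, fun h1 => ?_, fun h1 => ?_,
      fun h1 => ?_⟩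
    · have := h.left i (by omega) (by push_cast at h2; omega)
      rw [hc]
      convert this using 3
      ring
    · push_cast at h2
      rw [hc]
      rcases eq_or_ne i 1 with rfl | hi
      · obtain rfl : b = 0 := by omega
        have := h.b_zero rfl
        norm_num
        rw [h0]
        omega
      · have := h.right (i - 1) (by omega) (by omega)
        convert this using 3
        ring
    · rw [hc]
      norm_num
      exact h0.le
    · omega
    · push_cast at h1
      omega
    · rw [hc]
      push_cast at h1 ⊢
      rw [add_sub_cancel_right]
      exact h.b_max (by omega)

/-- A first part of `q` that is forced to be zero can be removed. -/
theorem pairSum_cons (N M : ℕ) {b β : ℤ} (hb : 0 ≤ b) (φ : ℤ → ℤ → A) :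
    pairSum (N + 1) M N M 0 (b + 1) 1 β φ = pairSum N M N M 1 b 1 β φ := by
  have hz : ∀ (q : Fin (N + 1) → Fin (M + 1)) (p : Fin N → Fin (M + 1)),
      IsRestrictedPair 0 (b + 1) 1 β q p → (Fin.cons 0 (Fin.tail q) : Fin (N + 1) → _) = q := by
    intro q p h
    have h1 := h.special_a_zero rfl
    have h2 := boxPart_natCast_add_one q 0 (by omega)
    simp only [Nat.cast_zero, zero_add] at h2
    rw [h2] at h1
    have h3 : q 0 = 0 := by
      ext
      have : ((q 0 : ℕ) : ℤ) ≤ 1 - 1 := h1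
      change (q 0 : ℕ) = 0
      omega
    rw [← h3, Fin.cons_self_tail]
  classical
  unfold pairSum
  refine Finset.sum_nbij' (fun x => (Fin.tail x.1, x.2))
    (fun x => ((Fin.cons 0 x.1 : Fin (N + 1) → Fin (M + 1)), x.2)) ?_ ?_ ?_ ?_ ?_
  · rintro ⟨q, p⟩ h
    simp only [Finset.mem_filter, Finset.mem_univ, true_and] at h ⊢
    rw [← isRestrictedPair_cons hb, hz q p h]
    exact h
  · rintro ⟨q, p⟩ h
    simp only [Finset.mem_filter, Finset.mem_univ, true_and] at h ⊢
    exact (isRestrictedPair_cons hb q p).2 h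
  · rintro ⟨q, p⟩ h
    simp only [Finset.mem_filter, Finset.mem_univ, true_and] at h
    simp only [hz q p h]
  · rintro ⟨q, p⟩ h
    simp
  · rintro ⟨q, p⟩ h
    simp only [Finset.mem_filter, Finset.mem_univ, true_and] at h
    have := hz q p h
    congr 1
    conv_lhs => rw [show (q, p).1 = Fin.cons 0 (Fin.tail q) from this.symm]
    rw [Fin.sum_univ_succ]
    simp

theorem isRestrictedPair_shift {N M : ℕ} {b β : ℤ} (hb : 0 ≤ b) (q p : Fin N → Fin (M + 1)) :
    IsRestrictedPair 1 b 0 β (fun i => (q i).castSucc) (fun i => (p i).succ) ↔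
      IsRestrictedPair 1 b 1 (β - 1) q p := by
  have h1 : Monotone (fun i => (q i).castSucc) ↔ Monotone q := by
    simp only [Monotone, Fin.castSucc_le_castSucc_iff]
  have h2 : Monotone (fun i => (p i).succ) ↔ Monotone p := by
    simp only [Monotone, Fin.succ_le_succ_iff]
  rw [isRestrictedPair_iff, isRestrictedPair_iff, h1, h2]
  refine and_congr_right fun _ => and_congr_right fun _ => ?_
  constructor
  · intro h
    refine ⟨fun i h1 h2 => ?_, fun i h1 h2 => ?_, fun h1 => ?_, fun h1 => ?_, fun h1 => ?_,
      fun h1 => ?_⟩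
    · have := h.left i h1 h2
      rw [boxPart_castSucc _ (by omega), boxPart_succ _ (by omega)] at this
      omega
    · have := h.right i h1 h2
      rw [boxPart_castSucc _ (by omega), boxPart_succ _ (by omega)] at this
      omega
    · omega
    · have := h.b_zero h1
      rw [boxPart_succ _ (by omega)] at this
      omega
    · omega
    · have := h.b_max h1
      rw [boxPart_castSucc _ (by omega)] at this
      push_cast at this
      omega
  · intro h
    refine ⟨fun i h1 h2 => ?_, fun i h1 h2 => ?_, fun h1 => ?_, fun h1 => ?_, fun h1 => ?_,
      fun h1 => ?_⟩
    · have := h.left i h1 h2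
      rw [boxPart_castSucc _ (by omega), boxPart_succ _ (by omega)]
      omega
    · have := h.right i h1 h2
      rw [boxPart_castSucc _ (by omega), boxPart_succ _ (by omega)]
      omega
    · omega
    · have := h.b_zero h1
      rw [boxPart_succ _ (by omega)]
      omega
    · omega
    · have := h.b_max h1
      rw [boxPart_castSucc _ (by omega)]
      push_cast
      omega

/-- If `p_i > q_i` for all `i`, then all parts of `p` can be lowered by one. -/
theorem pairSum_shift (N M : ℕ) {b β : ℤ} (hb : 0 ≤ b) (φ : ℤ → ℤ → A) :
    pairSum N (M + 1) N (M + 1) 1 b 0 β φ =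
      pairSum N M N M 1 b 1 (β - 1) (fun i j => φ i (N + j)) := by
  have hz : ∀ (q p : Fin N → Fin (M + 1 + 1)), IsRestrictedPair 1 b 0 β q p →
      (fun i => (⟨min (q i : ℕ) M, by omega⟩ : Fin (M + 1)).castSucc) = q ∧
      (fun i => (⟨(p i : ℕ) - 1, by omega⟩ : Fin (M + 1)).succ) = p := by
    intro q p h
    have hlt : ∀ i, (q i : ℕ) + 1 ≤ p i := by
      intro i
      have h1 := h.ineq_left (((i : ℕ) : ℤ) + 1) (by omega) (by have := i.2; omega)
      rw [add_sub_cancel_right, boxPart_natCast_add_one _ _ i.2,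
        boxPart_natCast_add_one _ _ i.2] at h1
      have h2 : (1 : ℤ) - 0 ≤ ((p i : ℕ) : ℤ) - ((q i : ℕ) : ℤ) := h1
      omega
    constructor
    · ext i
      have := hlt i
      have := (p i).is_lt
      simp only [Fin.castSucc_mk]
      omega
    · ext i
      have := hlt i
      simp only [Fin.succ_mk]
      omega
  classical
  unfold pairSum
  refine Finset.sum_nbij'
    (fun x => ((fun i => ⟨min (x.1 i : ℕ) M, by omega⟩), (fun i => ⟨(x.2 i : ℕ) - 1, by omega⟩)))
    (fun x => ((fun i => (x.1 i).castSucc), (fun i => (x.2 i).succ))) ?_ ?_ ?_ ?_ ?_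
  · rintro ⟨q, p⟩ h
    simp only [Finset.mem_filter, Finset.mem_univ, true_and] at h ⊢
    rw [← isRestrictedPair_shift hb, (hz q p h).1, (hz q p h).2]
    exact h
  · rintro ⟨q, p⟩ h
    simp only [Finset.mem_filter, Finset.mem_univ, true_and] at h ⊢
    exact (isRestrictedPair_shift hb q p).2 h
  · rintro ⟨q, p⟩ h
    simp only [Finset.mem_filter, Finset.mem_univ, true_and] at h
    exact Prod.ext (hz q p h).1 (hz q p h).2
  · rintro ⟨q, p⟩ h
    refine Prod.ext (funext fun i => ?_) (funext fun i => ?_)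
    · have := (q i).is_lt
      ext
      simp
      omega
    · ext
      simp
  · rintro ⟨q, p⟩ h
    simp only [Finset.mem_filter, Finset.mem_univ, true_and] at h
    obtain ⟨h1, h2⟩ := hz q p h
    have h3 : ∀ i, ((q i : ℕ) : ℤ) = ((min (q i : ℕ) M : ℕ) : ℤ) := fun i => by
      conv_lhs => rw [← h1]
      rfl
    have h4 : ∀ i, ((p i : ℕ) : ℤ) = (((p i : ℕ) - 1 : ℕ) : ℤ) + 1 := fun i => by
      conv_lhs => rw [← h2]
      simp
    congr 1
    · exact Finset.sum_congr rfl fun i _ => h3 i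
    · rw [Finset.sum_congr rfl fun i _ => h4 i, Finset.sum_add_distrib]
      simp [add_comm]

/-- With `a = 1` and `α = 0` every `p_i` must exceed `q_i`, which is impossible in a box of width
zero that has a part. -/
theorem pairSum_zero_right (N : ℕ) {b β : ℤ} (hb : 0 ≤ b) (hβ : 1 ≤ β) (φ : ℤ → ℤ → A) :
    pairSum N 0 N 0 1 b 0 β φ = if N = 0 then φ 0 0 else 0 := by
  classical
  rcases Nat.eq_zero_or_pos N with rfl | hN
  · rw [pairSum_trivial _ _ _ _ _ _ _ _ _ (Or.inl rfl) (Or.inl rfl), if_pos rfl]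
    exact isRestrictedPair_trivial (by simp) (by simp)
      (fun _ => by simp; omega) hb
  · rw [if_neg hN.ne']
    unfold pairSum
    rw [Finset.filter_false_of_mem, Finset.sum_empty]
    rintro ⟨q, p⟩ - h
    have h1 := h.ineq_left 1 (by omega) (by omega)
    have h2 := boxPart_le p 1
    have h3 := boxPart_nonneg q (1 + 1 - 1)
    simp only at h1
    push_cast at h2
    omega

/-- The conditions interlace the parts as `0 ≥ p_1 ≥ q_1 ≥ p_2 ≥ q_2 ≥ ⋯ ≥ q_N ≥ M`, so all parts
vanish and `M = 0`. This ends the Euclidean descent. -/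
theorem pairSum_terminal (N M : ℕ) (φ : ℤ → ℤ → A) :
    pairSum N M N M 1 0 1 1 φ = if M = 0 then φ 0 0 else 0 := by
  classical
  rcases Nat.eq_zero_or_pos M with rfl | hM
  · rw [pairSum_trivial _ _ _ _ _ _ _ _ _ (Or.inr rfl) (Or.inr rfl), if_pos rfl]
    refine (isRestrictedPair_iff _ _ _ _ _ _).2 ⟨fun _ _ _ => le_rfl, fun _ _ _ => le_rfl, ?_⟩
    have hQ : ∀ i, boxPart (0 : Fin N → Fin (0 + 1)) i = 0 := fun i =>
      le_antisymm (by simpa using boxPart_le (0 : Fin N → Fin (0 + 1)) i) (boxPart_nonneg _ _)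
    constructor <;> simp [hQ]
  · rw [if_neg hM.ne']
    unfold pairSum
    rw [Finset.filter_false_of_mem, Finset.sum_empty]
    rintro ⟨q, p⟩ - h
    simp only at h
    have h1 := h.special_b_zero rfl
    have h2 := h.special_b_max (by omega)
    have h3 : ∀ i : ℕ, i ≤ N → boxPart q i = 0 := by
      intro i hi
      induction i with
      | zero => exact boxPart_of_nonpos _ le_rfl
      | succ i ih =>
        have h4 : boxPart p ((i : ℤ) + 1) ≤ 0 := by
          rcases Nat.eq_zero_or_pos i with rfl | hi0
          · simpa using h1
          · have h5 := h.ineq_right i (by omega) (by omega)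
            rw [ih (by omega), sub_zero] at h5
            omega
        have h6 := h.ineq_left (i + 1) (by omega) (by omega)
        rw [add_sub_cancel_right] at h6
        have h7 := boxPart_nonneg q ((i : ℤ) + 1)
        push_cast
        omega
    rw [h3 N le_rfl] at h2
    omega

end Special

/-! ## Gaussian polynomials -/

section Gauss

open PowerSeries

theorem qFact_succ (n : ℕ) : qFact (n + 1) = qFact n * (1 - X ^ (n + 1)) :=
  Finset.prod_range_succ _ _

theorem qFact_zero : qFact 0 = 1 := rfl

theorem invQFact_mul_qFact (n : ℕ) : invQFact n * qFact n = 1 := by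
  rw [mul_comm, qFact_mul_invQFact]

theorem invQFact_eq (n : ℕ) : invQFact n = invQFact (n + 1) * (1 - X ^ (n + 1)) := by
  calc invQFact n = invQFact n * (qFact (n + 1) * invQFact (n + 1)) := by
        rw [qFact_mul_invQFact, mul_one]
    _ = (invQFact n * qFact n) * (invQFact (n + 1) * (1 - X ^ (n + 1))) := by
        rw [qFact_succ]; ring
    _ = _ := by rw [invQFact_mul_qFact, one_mul]

theorem invQFact_zero : invQFact 0 = 1 := by
  have := qFact_mul_invQFact 0
  rwa [qFact_zero, one_mul] at this

theorem gauss_natCast_add (m k : ℕ) :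
    gauss ((m : ℤ) + k) k = qFact (m + k) * invQFact k * invQFact m := by
  unfold gauss
  rw [if_pos (by omega)]
  congr 2
  omega

theorem gauss_self (k : ℕ) : gauss (k : ℤ) k = 1 := by
  have := gauss_natCast_add 0 k
  simp only [Nat.cast_zero, zero_add, invQFact_zero, mul_one, qFact_mul_invQFact] at this
  exact this

theorem gauss_zero_right (m : ℕ) : gauss (m : ℤ) 0 = 1 := by
  have := gauss_natCast_add m 0
  simpa [invQFact_zero, qFact_mul_invQFact] using this

theorem gauss_of_neg {m k : ℤ} (hk : k < 0) : gauss m k = 0 :=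
  if_neg (by omega)

/-- The case `m = k = 0` must be excluded: there the left side is `1`, while both Gaussians on the
right vanish by convention. -/
theorem gauss_pascal {m : ℤ} (hm : 0 ≤ m) (k : ℕ) (h : 0 < m + k) :
    gauss (m + k) k = gauss (m - 1 + k) k + X ^ m.toNat * gauss (m + k - 1) (k - 1) := by
  lift m to ℕ using hm
  simp only [Int.toNat_natCast]
  rcases m with _ | m <;> rcases k with _ | k
  · simp at h
  · simp only [Nat.cast_zero, zero_add, pow_zero, one_mul]
    rw [gauss_self, gauss, if_neg (by omega)]
    push_cast
    rw [add_sub_cancel_right, gauss_self, zero_add]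
  · push_cast
    rw [gauss_of_neg (k := -1) (by omega)]
    simp only [add_zero, add_sub_cancel_right, mul_zero]
    rw [gauss_zero_right]
    exact_mod_cast gauss_zero_right (m + 1)
  · rw [gauss_natCast_add,
      show ((m + 1 : ℕ) : ℤ) - 1 + (k + 1 : ℕ) = (m : ℤ) + (k + 1 : ℕ) by push_cast; ring,
      show ((m + 1 : ℕ) : ℤ) + (k + 1 : ℕ) - 1 = ((m + 1 : ℕ) : ℤ) + k by push_cast; ring,
      show ((k + 1 : ℕ) : ℤ) - 1 = k by push_cast; ring, gauss_natCast_add, gauss_natCast_add,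
      show m + 1 + (k + 1) = m + k + 1 + 1 by ring, show m + (k + 1) = m + k + 1 by ring,
      show m + 1 + k = m + k + 1 by ring, qFact_succ (m + k + 1), invQFact_eq m, invQFact_eq k]
    ring

end Gauss

/-! ## The generating function with integer arguments -/

section PairGF

open PowerSeries

/-- The generating function of restricted partition pairs as a power series. -/
noncomputable def pairGF (N₁ M₁ N₂ M₂ : ℕ) (a b α β : ℤ) : PowerSeries ℤ :=
  pairSum N₁ M₁ N₂ M₂ a b α β (fun i j => X ^ (i + j).toNat)

theorem coe_genFun (N₁ M₁ N₂ M₂ : ℕ) (a b α β : ℤ) :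
    (genFun N₁ M₁ N₂ M₂ a b α β : PowerSeries ℤ) = pairGF N₁ M₁ N₂ M₂ a b α β := by
  unfold genFun pairGF pairSum
  rw [← Polynomial.coeToPowerSeries.ringHom_apply, map_sum]
  refine Finset.sum_congr rfl fun x _ => ?_
  rw [map_pow, Polynomial.coeToPowerSeries.ringHom_apply, Polynomial.coe_X]
  congr 1
  have : ∑ i, ((x.1 i : ℕ) : ℤ) + ∑ i, ((x.2 i : ℕ) : ℤ) =
      (((∑ i, (x.1 i : ℕ)) + ∑ i, (x.2 i : ℕ) : ℕ) : ℤ) := by push_cast; rfl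
  rw [this, Int.toNat_natCast]

theorem pairSum_X_pow (N₁ M₁ N₂ M₂ n : ℕ) (a b α β : ℤ) (φ : ℤ → ℤ → ℤ)
    (hφ : ∀ i j, φ i j = n + (i + j)) :
    pairSum N₁ M₁ N₂ M₂ a b α β (fun i j => (X : PowerSeries ℤ) ^ (φ i j).toNat) =
      X ^ n * pairGF N₁ M₁ N₂ M₂ a b α β := by
  unfold pairGF pairSum
  rw [Finset.mul_sum]
  refine Finset.sum_congr rfl fun x _ => ?_
  simp only [hφ]
  rw [← pow_add]
  congr 1
  have h1 : 0 ≤ ∑ i, ((x.1 i : ℕ) : ℤ) := Finset.sum_nonneg fun i _ => by positivity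
  have h2 : 0 ≤ ∑ i, ((x.2 i : ℕ) : ℤ) := Finset.sum_nonneg fun i _ => by positivity
  omega

theorem pairGF_swap (N₁ M₁ N₂ M₂ : ℕ) (a b α β : ℤ) :
    pairGF N₁ M₁ N₂ M₂ a b α β = pairGF N₂ M₂ N₁ M₁ b a β α := by
  unfold pairGF
  rw [pairSum_swap]
  exact pairSum_congr fun i j => by rw [add_comm]

/-- Without effective constraints, a pair with a trivial second partition is counted by a
Gaussian polynomial. -/
theorem pairGF_unconstrained (N₁ M₁ N₂ : ℕ) (K : ℕ) (hK : N₁ + M₁ + N₂ < K) :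
    pairGF N₁ M₁ N₂ 0 K K K K = gauss (N₁ + M₁) N₁ := by
  induction N₁ generalizing M₁ with
  | zero =>
    simp only [Nat.cast_zero, zero_add]
    rw [gauss_zero_right]
    induction M₁ with
    | zero =>
      rw [pairGF, pairSum_trivial _ _ _ _ _ _ _ _ _ (Or.inl rfl) (Or.inr rfl)]
      · simp
      · exact isRestrictedPair_trivial (by omega) (by omega) (by omega) (by omega)
    | succ M₁ ih =>
      rw [pairGF, pairSum_zero_succ _ _ _ _ _ _ _ _ (by omega)]
      exact ih (by omega)
  | succ N₁ ih =>
    induction M₁ with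
    | zero =>
      rw [pairGF, pairSum_succ_zero _ _ _ _ _ _ _ _ (by omega) (by omega) (by omega)
        (by push_cast; omega)]
      refine (ih 0 (by omega)).trans ?_
      simp only [Nat.cast_zero, add_zero, gauss_self]
    | succ M₁ ih2 =>
      rw [pairGF, pairSum_succ_succ _ _ _ _ _ _ _ _ _ (by omega) (by omega) (by omega)
        (by push_cast; omega),
        pairSum_X_pow _ _ _ _ (M₁ + 1) _ _ _ _ _ (fun i j => by push_cast; ring), ih _ (by omega)]
      have h2 := ih2 (by omega)
      rw [pairGF] at h2
      rw [h2]
      have h := gauss_pascal (m := (M₁ + 1 : ℕ)) (by omega) (N₁ + 1) (by omega)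
      rw [add_comm (((M₁ + 1 : ℕ) : ℤ))] at h
      rw [h, add_comm]
      congr 1
      · congr 1
        push_cast
        ring
      · rw [Int.toNat_natCast]
        congr 2 <;> push_cast <;> ring

/-- All parts of `p` are zero and those of `q` are below `α`, so every condition holds
automatically, exactly as for the large parameters of `pairGF_unconstrained`. -/
theorem pairGF_free (N₁ M₁ N₂ : ℕ) {a b α β : ℤ} (hα : M₁ < α) (hβ : 1 ≤ β) :
    pairGF N₁ M₁ N₂ 0 a b α β = gauss (N₁ + M₁) N₁ := by
  classical
  rw [← pairGF_unconstrained N₁ M₁ N₂ (N₁ + M₁ + N₂ + 1) (by omega)]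
  unfold pairGF pairSum
  refine Finset.sum_congr (Finset.filter_congr ?_) fun _ _ => rfl
  rintro ⟨q, p⟩ -
  rw [isRestrictedPair_iff, isRestrictedPair_iff]
  refine and_congr_right fun _ => and_congr_right fun _ => ?_
  have hQ := boxPart_nonneg q
  have hQM := boxPart_le q
  have hP := boxPart_nonneg p
  have hPM := boxPart_le p
  simp only
  refine iff_of_true ?_ ?_
  · refine ⟨fun i _ _ => ?_, fun i _ _ => ?_, fun _ => ?_, fun _ => ?_, fun _ => ?_, fun _ => ?_⟩
    · have := hP i
      have := hQM (i + 1 - a)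
      omega
    · have := hQ i
      have := hPM (i + 1 - b)
      omega
    · have := hQM 1
      omega
    · have := hPM 1
      omega
    · have := hP N₂
      omega
    · have := hQ N₁
      omega
  · refine ⟨fun i _ _ => ?_, fun i _ _ => ?_, fun _ => ?_, fun _ => ?_, fun _ => ?_, fun _ => ?_⟩
      <;> push_cast at * <;> omega

/-- The generating function `pairGF`, extended by zero to negative arguments. -/
noncomputable def pairGFInt (a b α β N₁ M₁ N₂ M₂ : ℤ) : PowerSeries ℤ :=
  if 0 ≤ N₁ ∧ 0 ≤ M₁ ∧ 0 ≤ N₂ ∧ 0 ≤ M₂ then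
    pairGF N₁.toNat M₁.toNat N₂.toNat M₂.toNat a b α β else 0

theorem pairGFInt_swap (a b α β N₁ M₁ N₂ M₂ : ℤ) :
    pairGFInt a b α β N₁ M₁ N₂ M₂ = pairGFInt b a β α N₂ M₂ N₁ M₁ := by
  unfold pairGFInt
  by_cases h : 0 ≤ N₁ ∧ 0 ≤ M₁ ∧ 0 ≤ N₂ ∧ 0 ≤ M₂
  · rw [if_pos h, if_pos (by omega), pairGF_swap]
  · rw [if_neg h, if_neg (by omega)]

theorem pairGFInt_of_neg {a b α β N₁ M₁ N₂ M₂ : ℤ} (h : N₁ < 0 ∨ M₁ < 0 ∨ N₂ < 0 ∨ M₂ < 0) :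
    pairGFInt a b α β N₁ M₁ N₂ M₂ = 0 :=
  if_neg (by omega)

theorem pairGFInt_natCast (a b α β : ℤ) (N₁ M₁ N₂ M₂ : ℕ) :
    pairGFInt a b α β N₁ M₁ N₂ M₂ = pairGF N₁ M₁ N₂ M₂ a b α β := by
  unfold pairGFInt
  rw [if_pos (by omega)]
  simp

theorem pairGFInt_collision {a b α β N₁ M₁ N₂ M₂ : ℤ} (hx : N₂ - N₁ = a) (hy : M₂ - M₁ = -α) :
    pairGFInt a b α β N₁ M₁ N₂ M₂ = 0 := by
  unfold pairGFInt
  split_ifs with h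
  · exact pairSum_eq_zero_of_collision _ _ _ _ _ _ _ _ _ (by omega) (by omega)
  · rfl

/-- Removal of the last step of the lattice path of `q`. -/
theorem pairGFInt_trim {a b α β N₁ M₁ N₂ M₂ : ℤ} (ha : 0 ≤ a) (hxa : N₂ - N₁ < a)
    (hxb : -b ≤ N₂ - N₁) (hy : M₂ - M₁ < β) (hpos : N₁ + M₁ ≠ 0) :
    pairGFInt a b α β N₁ M₁ N₂ M₂ =
      X ^ M₁.toNat * pairGFInt a b α β (N₁ - 1) M₁ N₂ M₂
        + pairGFInt a b α β N₁ (M₁ - 1) N₂ M₂ := by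
  by_cases h : 0 ≤ N₁ ∧ 0 ≤ M₁ ∧ 0 ≤ N₂ ∧ 0 ≤ M₂
  · obtain ⟨h1, h2, h3, h4⟩ := h
    lift N₁ to ℕ using h1
    lift M₁ to ℕ using h2
    lift N₂ to ℕ using h3
    lift M₂ to ℕ using h4
    rcases N₁ with _ | N₁ <;> rcases M₁ with _ | M₁
    · simp at hpos
    · rw [pairGFInt_of_neg (N₁ := ((0 : ℕ) : ℤ) - 1) (by omega), mul_zero, zero_add,
        show ((M₁ + 1 : ℕ) : ℤ) - 1 = M₁ by push_cast; ring, pairGFInt_natCast, pairGFInt_natCast]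
      exact pairSum_zero_succ _ _ _ _ _ _ _ _ (by push_cast at hxa; omega)
    · rw [pairGFInt_of_neg (M₁ := ((0 : ℕ) : ℤ) - 1) (by omega), add_zero,
        show ((N₁ + 1 : ℕ) : ℤ) - 1 = N₁ by push_cast; ring, pairGFInt_natCast, pairGFInt_natCast,
        Int.toNat_natCast, pow_zero, one_mul]
      push_cast at hxa hxb hy
      exact pairSum_succ_zero _ _ _ _ _ _ _ _ ha hxa hxb (by omega)
    · rw [show ((M₁ + 1 : ℕ) : ℤ) - 1 = M₁ by push_cast; ring,
        show ((N₁ + 1 : ℕ) : ℤ) - 1 = N₁ by push_cast; ring, pairGFInt_natCast, pairGFInt_natCast,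
        pairGFInt_natCast, Int.toNat_natCast]
      push_cast at hxa hxb hy
      conv_lhs => unfold pairGF
      rw [pairSum_succ_succ _ _ _ _ _ _ _ _ _ ha hxa hxb hy,
        pairSum_X_pow _ _ _ _ (M₁ + 1) _ _ _ _ _ (fun i j => by push_cast; ring)]
      rfl
  · rw [pairGFInt_of_neg (by omega), pairGFInt_of_neg (by omega), pairGFInt_of_neg (by omega)]
    simp

end PairGF

/-! ## The Burge transform -/

section Transform

open PowerSeries

/-- A summand of the Burge transform. -/
noncomputable def burgeTerm (a b α β N₁ M₁ N₂ M₂ : ℤ) (k : ℕ) : PowerSeries ℤ :=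
  X ^ ((N₁ - k) * (N₂ - k)).toNat * gauss (M₁ + M₂ + k) k *
    pairGFInt a b α β (N₁ - k) (M₁ - N₂ + k) (N₂ - k) (M₂ - N₁ + k)

theorem burgeTerm_swap (a b α β N₁ M₁ N₂ M₂ : ℤ) (k : ℕ) :
    burgeTerm a b α β N₁ M₁ N₂ M₂ k = burgeTerm b a β α N₂ M₂ N₁ M₁ k := by
  unfold burgeTerm
  rw [pairGFInt_swap, mul_comm (N₁ - (k : ℤ)), add_comm M₁ M₂]

theorem burgeTerm_of_neg {a b α β N₁ M₁ N₂ M₂ : ℤ} {k : ℕ}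
    (h : N₁ < k ∨ N₂ < k ∨ M₁ + k < N₂ ∨ M₂ + k < N₁) :
    burgeTerm a b α β N₁ M₁ N₂ M₂ k = 0 := by
  unfold burgeTerm
  rw [pairGFInt_of_neg (by omega), mul_zero]

/-- The Burge transform of the generating function of restricted partition pairs. -/
noncomputable def burgeSum (K : ℕ) (a b α β N₁ M₁ N₂ M₂ : ℤ) : PowerSeries ℤ :=
  ∑ k ∈ Finset.range K, burgeTerm a b α β N₁ M₁ N₂ M₂ k

theorem burgeSum_swap (K : ℕ) (a b α β N₁ M₁ N₂ M₂ : ℤ) :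
    burgeSum K a b α β N₁ M₁ N₂ M₂ = burgeSum K b a β α N₂ M₂ N₁ M₁ :=
  Finset.sum_congr rfl fun _ _ => burgeTerm_swap _ _ _ _ _ _ _ _ _

theorem burgeSum_of_neg {K : ℕ} {a b α β N₁ M₁ N₂ M₂ : ℤ}
    (h : N₁ < 0 ∨ M₁ < 0 ∨ N₂ < 0 ∨ M₂ < 0) :
    burgeSum K a b α β N₁ M₁ N₂ M₂ = 0 :=
  Finset.sum_eq_zero fun k _ => burgeTerm_of_neg (by omega)

/-- The Burge transform satisfies the same recursion as the generating function. -/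
theorem burgeSum_trim {K : ℕ} {a b α β N₁ M₁ N₂ M₂ : ℤ} (ha : 0 ≤ a) (hb : 0 ≤ b)
    (hxa : N₂ - N₁ < a) (hxb : -b ≤ N₂ - N₁)
    (hyβ : N₂ - N₁ + (M₂ - M₁) < β) (hyα : -α ≤ N₂ - N₁ + (M₂ - M₁))
    (hM₁ : 0 ≤ M₁) (hM₂ : 0 ≤ M₂) (h1 : N₂ < N₁ + M₁) (h2 : N₁ ≤ N₂ + M₂) (hK : N₁ < K) :
    burgeSum K a b α β N₁ M₁ N₂ M₂ =
      X ^ M₁.toNat * burgeSum K a b α β (N₁ - 1) M₁ N₂ M₂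
        + burgeSum K a b α β N₁ (M₁ - 1) N₂ M₂ := by
  -- `Y k` is what remains of the `k`-th term when trimming `q` drops a part. When trimming narrows
  -- the box instead, Pascal's rule for the Gaussian splits the result into `Z k` and the `k`-th
  -- term for `M₁ - 1`.
  set Y : ℕ → PowerSeries ℤ := fun k =>
    X ^ ((N₁ - k) * (N₂ - k)).toNat * gauss (M₁ + M₂ + k) k *
      (X ^ (M₁ - N₂ + k).toNat *
        pairGFInt a b α β (N₁ - k - 1) (M₁ - N₂ + k) (N₂ - k) (M₂ - N₁ + k)) with hY
  set Z : ℕ → PowerSeries ℤ := fun k =>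
    X ^ ((N₁ - k) * (N₂ - k)).toNat * (X ^ (M₁ + M₂).toNat * gauss (M₁ + M₂ + k - 1) (k - 1)) *
      pairGFInt a b α β (N₁ - k) (M₁ - N₂ + k - 1) (N₂ - k) (M₂ - N₁ + k) with hZ
  have e1 : ∀ k : ℕ, burgeTerm a b α β N₁ M₁ N₂ M₂ k =
      Y k + Z k + burgeTerm a b α β N₁ (M₁ - 1) N₂ M₂ k := by
    intro k
    unfold burgeTerm
    rw [pairGFInt_trim ha (by omega) (by omega) (by omega) (by omega),
      gauss_pascal (by omega) k (by omega), hY, hZ]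
    simp only
    rw [gauss_pascal (m := M₁ + M₂) (by omega) k (by omega),
      show M₁ - 1 + M₂ + (k : ℤ) = M₁ + M₂ - 1 + k by ring,
      show M₁ - 1 - N₂ + (k : ℤ) = M₁ - N₂ + k - 1 by ring]
    ring
  have e2 : ∀ k : ℕ, X ^ M₁.toNat * burgeTerm a b α β (N₁ - 1) M₁ N₂ M₂ k = Y k + Z (k + 1) := by
    intro k
    unfold burgeTerm
    -- Here the other path, that of `p`, is trimmed: narrowing its box yields `Y k`, and dropping
    -- its part yields `Z (k + 1)`.
    rw [pairGFInt_swap, pairGFInt_trim hb (by omega) (by omega) (by omega) (by omega),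
      pairGFInt_swap, pairGFInt_swap b a, hY, hZ]
    simp only
    rw [mul_add, mul_add, add_comm]
    congr 1
    · rw [show N₁ - 1 - (k : ℤ) = N₁ - k - 1 by ring,
        show M₂ - (N₁ - 1) + (k : ℤ) - 1 = M₂ - N₁ + k by ring]
      by_cases h : 0 ≤ N₁ - k - 1 ∧ 0 ≤ N₂ - k ∧ 0 ≤ M₁ - N₂ + k
      · obtain ⟨h3, h4, h5⟩ := h
        have : X ^ M₁.toNat * X ^ ((N₁ - k - 1) * (N₂ - k)).toNat =
            (X : PowerSeries ℤ) ^ ((N₁ - k) * (N₂ - k)).toNat * X ^ (M₁ - N₂ + k).toNat := by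
          rw [← pow_add, ← pow_add]
          congr 1
          have h6 := mul_nonneg h3 h4
          have h7 : 0 ≤ (N₁ - k) * (N₂ - k) := mul_nonneg (by omega) h4
          zify
          rw [Int.toNat_of_nonneg h6, Int.toNat_of_nonneg h7, Int.toNat_of_nonneg hM₁,
            Int.toNat_of_nonneg h5]
          ring
        rw [← mul_assoc, ← mul_assoc, this]
        ring
      · rw [pairGFInt_of_neg (by omega)]
        simp
    · push_cast
      rw [show N₁ - 1 - (k : ℤ) = N₁ - (k + 1) by ring,
        show M₂ - (N₁ - 1) + (k : ℤ) = M₂ - N₁ + (k + 1) by ring,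
        show N₂ - (k : ℤ) - 1 = N₂ - (k + 1) by ring,
        show M₁ - N₂ + ((k : ℤ) + 1) - 1 = M₁ - N₂ + k by ring,
        show M₁ + M₂ + ((k : ℤ) + 1) - 1 = M₁ + M₂ + k by ring,
        show (k : ℤ) + 1 - 1 = k by ring]
      by_cases h : 0 ≤ N₁ - (k + 1) ∧ 0 ≤ N₂ - (k + 1) ∧ 0 ≤ M₂ - N₁ + (k + 1)
      · obtain ⟨h3, h4, h5⟩ := h
        have : X ^ M₁.toNat * X ^ ((N₁ - (k + 1)) * (N₂ - k)).toNat *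
            X ^ (M₂ - N₁ + (k + 1)).toNat =
            (X : PowerSeries ℤ) ^ ((N₁ - (k + 1)) * (N₂ - (k + 1))).toNat *
              X ^ (M₁ + M₂).toNat := by
          rw [← pow_add, ← pow_add, ← pow_add]
          congr 1
          have h6 := mul_nonneg h3 h4
          have h7 : 0 ≤ (N₁ - (k + 1)) * (N₂ - k) := mul_nonneg h3 (by omega)
          zify
          rw [Int.toNat_of_nonneg h6, Int.toNat_of_nonneg h7, Int.toNat_of_nonneg hM₁,
            Int.toNat_of_nonneg h5, Int.toNat_of_nonneg (add_nonneg hM₁ hM₂)]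
          ring
        rw [← mul_assoc (X ^ ((N₁ - (k + 1)) * (N₂ - (k + 1))).toNat), ← this]
        ring
      · rw [pairGFInt_of_neg (by omega)]
        simp
  have hZ0 : Z 0 = 0 := by
    simp only [hZ]
    rw [gauss_of_neg (k := ((0 : ℕ) : ℤ) - 1) (by omega)]
    simp
  have hZK : Z K = 0 := by
    simp only [hZ]
    rw [pairGFInt_of_neg (by omega), mul_zero]
  -- The index shift in `Z` costs nothing, because both boundary terms vanish.
  have hsum : ∑ k ∈ Finset.range K, Z k = ∑ k ∈ Finset.range K, Z (k + 1) := by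
    have h3 := Finset.sum_range_succ Z K
    have h4 := Finset.sum_range_succ' Z K
    rw [hZK, add_zero] at h3
    rw [hZ0, add_zero] at h4
    rw [← h3, h4]
  unfold burgeSum
  rw [Finset.mul_sum, Finset.sum_congr rfl fun k _ => e1 k, Finset.sum_congr rfl fun k _ => e2 k,
    Finset.sum_add_distrib, Finset.sum_add_distrib, Finset.sum_add_distrib, hsum]

theorem pairGFInt_trivial {N₂ M₂ : ℕ} {a b α β : ℤ} (h : N₂ = 0 ∨ M₂ = 0)
    (h1 : a = 0 → 1 ≤ α) (h2 : a = N₂ → 1 ≤ α) (h3 : b = 0 → M₂ < β) (hb : 0 ≤ b) :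
    pairGFInt a b α β 0 0 N₂ M₂ = 1 := by
  have h4 := pairGFInt_natCast a b α β 0 0 N₂ M₂
  simp only [Nat.cast_zero] at h4
  rw [h4, pairGF, pairSum_trivial _ _ _ _ _ _ _ _ _ (Or.inl rfl) h
    (isRestrictedPair_trivial h1 h2 h3 hb)]
  simp

/-- The cases of the Burge transform in which no step of a lattice path can be removed. -/
theorem burge_base {K : ℕ} {a b α β : ℤ} {N₁ M₁ N₂ M₂ : ℕ} (ha : 0 ≤ a) (hb : 0 ≤ b)
    (hβ : 0 ≤ β) (hab : 0 < a + b) (hαβ : 0 < α + β)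
    (h1 : ¬ ((N₂ : ℤ) - N₁ = a ∧ (N₂ : ℤ) - N₁ + (M₂ - M₁) = -α))
    (h2 : ¬ ((N₂ : ℤ) - N₁ = -b ∧ (N₂ : ℤ) - N₁ + (M₂ - M₁) = β))
    (hxb : -b ≤ (N₂ : ℤ) - N₁) (hyα : -α ≤ (N₂ : ℤ) - N₁ + (M₂ - M₁)) (h3 : N₁ = N₂ + M₂)
    (h4 : (N₂ : ℤ) - N₁ = a ∨ (N₂ : ℤ) - N₁ + (M₂ - M₁) = β ∨ N₂ = N₁ + M₁)
    (hK : N₁ < K) (hN₂ : N₂ < K) :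
    pairGFInt a b (α + a) (β + b) N₁ M₁ N₂ M₂ = burgeSum K a b α β N₁ M₁ N₂ M₂ := by
  rcases Nat.eq_zero_or_pos M₂ with rfl | hM₂
  -- Outside `k = N₁` some box dimension is negative, so the transform reduces to one Gaussian,
  -- which is the free count on the left.
  · obtain rfl : N₁ = N₂ := by omega
    rw [pairGFInt_natCast, pairGF_free _ _ _ (by omega) (by omega), burgeSum,
      Finset.sum_eq_single N₁ (fun k _ hk => burgeTerm_of_neg (by push_cast; omega))
        (fun h => absurd (Finset.mem_range.2 hK) h), burgeTerm]
    simp only [sub_self, mul_zero, Int.toNat_zero, pow_zero, one_mul, Nat.cast_zero, add_zero,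
      sub_add_cancel, zero_sub, neg_add_cancel]
    rw [pairGFInt_swap]
    have h5 := pairGFInt_trivial (N₂ := 0) (M₂ := M₁) (a := b) (b := a) (α := β) (β := α)
      (Or.inl rfl) (by omega) (by omega) (by omega) ha
    simp only [Nat.cast_zero] at h5
    rw [h5, mul_one, add_comm]
  -- Now `N₂ < N₁`, so among the alternatives of `h4` only the one with `β` remains, and it forces
  -- `M₁ = β = 0`. Only `k = N₂` contributes.
  · obtain rfl : M₁ = 0 := by omega
    obtain rfl : β = 0 := by omega
    rw [pairGFInt_swap, pairGFInt_natCast, pairGF_free _ _ _ (by omega) (by omega), burgeSum,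
      Finset.sum_eq_single N₂ (fun k _ hk => burgeTerm_of_neg (by push_cast; omega))
        (fun h => absurd (Finset.mem_range.2 hN₂) h), burgeTerm]
    rw [h3]
    simp only [sub_self, mul_zero, Int.toNat_zero, pow_zero, one_mul, Nat.cast_zero,
      zero_sub, neg_add_cancel, Nat.cast_add, add_sub_cancel_left, zero_add]
    rw [show (M₂ : ℤ) - (N₂ + M₂) + N₂ = 0 by ring, pairGFInt_swap]
    have h5 := pairGFInt_trivial (N₂ := M₂) (M₂ := 0) (a := b) (b := a) (α := 0) (β := α)
      (Or.inr rfl) (by omega) (by omega) (by omega) ha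
    simp only [Nat.cast_zero] at h5
    rw [h5, mul_one, add_comm]

/-- The Burge transform of restricted partition pairs. -/
theorem burge_transform {K : ℕ} (n : ℕ) : ∀ (a b α β N₁ M₁ N₂ M₂ : ℤ),
    N₁ + M₁ + N₂ + M₂ = n → 0 ≤ N₁ → 0 ≤ M₁ → 0 ≤ N₂ → 0 ≤ M₂ →
    0 ≤ a → 0 ≤ b → 0 ≤ α → 0 ≤ β → 0 < a + b → 0 < α + β →
    N₂ - N₁ ≤ a → -b ≤ N₂ - N₁ → N₂ - N₁ + (M₂ - M₁) ≤ β → -α ≤ N₂ - N₁ + (M₂ - M₁) →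
    N₂ ≤ N₁ + M₁ → N₁ ≤ N₂ + M₂ → N₁ < K → N₂ < K →
    pairGFInt a b (α + a) (β + b) N₁ M₁ N₂ M₂ = burgeSum K a b α β N₁ M₁ N₂ M₂ := by
  induction n with
  | zero =>
    intro a b α β N₁ M₁ N₂ M₂ hn hN₁ hM₁ hN₂ hM₂ ha hb hα hβ hab hαβ hxa hxb hyβ hyα hl₁ hl₂ hK₁ hK₂
    obtain ⟨rfl, rfl, rfl, rfl⟩ : N₁ = 0 ∧ M₁ = 0 ∧ N₂ = 0 ∧ M₂ = 0 := by omega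
    by_cases hc1 : a = 0 ∧ α = 0
    · rw [pairGFInt_collision (by omega) (by omega), burgeSum, Finset.sum_eq_zero]
      intro k _
      rw [burgeTerm, pairGFInt_collision (by omega) (by omega), mul_zero]
    by_cases hc2 : b = 0 ∧ β = 0
    · rw [pairGFInt_swap, pairGFInt_collision (by omega) (by omega), burgeSum,
        Finset.sum_eq_zero]
      intro k _
      rw [burgeTerm, pairGFInt_swap, pairGFInt_collision (by omega) (by omega), mul_zero]
    exact burge_base (N₁ := 0) (M₁ := 0) (N₂ := 0) (M₂ := 0) ha hb hβ hab hαβ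
      (by omega) (by omega) (by omega) (by omega) (by omega) (by omega) (by omega) (by omega)
  | succ n ih =>
    -- Trimming may lead to a dimension `-1`, where both sides are zero; this frees the induction
    -- hypothesis from the sign conditions.
    have ih' : ∀ (a b α β N₁ M₁ N₂ M₂ : ℤ), N₁ + M₁ + N₂ + M₂ = n →
        0 ≤ a → 0 ≤ b → 0 ≤ α → 0 ≤ β → 0 < a + b → 0 < α + β →
        N₂ - N₁ ≤ a → -b ≤ N₂ - N₁ → N₂ - N₁ + (M₂ - M₁) ≤ β → -α ≤ N₂ - N₁ + (M₂ - M₁) →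
        N₂ ≤ N₁ + M₁ → N₁ ≤ N₂ + M₂ → N₁ < K → N₂ < K →
        pairGFInt a b (α + a) (β + b) N₁ M₁ N₂ M₂ = burgeSum K a b α β N₁ M₁ N₂ M₂ := by
      intro a b α β N₁ M₁ N₂ M₂ hn
      by_cases h : 0 ≤ N₁ ∧ 0 ≤ M₁ ∧ 0 ≤ N₂ ∧ 0 ≤ M₂
      · exact ih a b α β N₁ M₁ N₂ M₂ hn h.1 h.2.1 h.2.2.1 h.2.2.2
      · intros
        rw [pairGFInt_of_neg (by omega), burgeSum_of_neg (by omega)]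
    have step : ∀ (a b α β N₁ M₁ N₂ M₂ : ℤ), N₁ + M₁ + N₂ + M₂ = (n + 1 : ℕ) →
        0 ≤ M₁ → 0 ≤ M₂ →
        0 ≤ a → 0 ≤ b → 0 ≤ α → 0 ≤ β → 0 < a + b → 0 < α + β →
        N₂ - N₁ < a → -b ≤ N₂ - N₁ → N₂ - N₁ + (M₂ - M₁) < β → -α ≤ N₂ - N₁ + (M₂ - M₁) →
        N₂ < N₁ + M₁ → N₁ ≤ N₂ + M₂ → 0 ≤ N₂ → N₁ < K → N₂ < K →
        pairGFInt a b (α + a) (β + b) N₁ M₁ N₂ M₂ = burgeSum K a b α β N₁ M₁ N₂ M₂ := by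
      intro a b α β N₁ M₁ N₂ M₂ hn hM₁ hM₂ ha hb hα hβ hab hαβ hxa hxb hyβ hyα hl₁ hl₂ hN₂ hK₁ hK₂
      rw [pairGFInt_trim ha hxa hxb (by omega) (by omega),
        burgeSum_trim ha hb hxa hxb hyβ hyα hM₁ hM₂ hl₁ hl₂ hK₁,
        ih' a b α β (N₁ - 1) M₁ N₂ M₂ (by omega) ha hb hα hβ hab hαβ (by omega) (by omega)
          (by omega) (by omega) (by omega) (by omega) (by omega) (by omega),
        ih' a b α β N₁ (M₁ - 1) N₂ M₂ (by omega) ha hb hα hβ hab hαβ (by omega) (by omega)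
          (by omega) (by omega) (by omega) (by omega) (by omega) (by omega)]
    intro a b α β N₁ M₁ N₂ M₂ hn hN₁ hM₁ hN₂ hM₂ ha hb hα hβ hab hαβ hxa hxb hyβ hyα hl₁ hl₂ hK₁ hK₂
    by_cases hc1 : N₂ - N₁ = a ∧ N₂ - N₁ + (M₂ - M₁) = -α
    · rw [pairGFInt_collision (by omega) (by omega), burgeSum, Finset.sum_eq_zero]
      intro k _
      rw [burgeTerm, pairGFInt_collision (by omega) (by omega), mul_zero]
    by_cases hc2 : N₂ - N₁ = -b ∧ N₂ - N₁ + (M₂ - M₁) = β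
    · rw [pairGFInt_swap, pairGFInt_collision (by omega) (by omega), burgeSum,
        Finset.sum_eq_zero]
      intro k _
      rw [burgeTerm, pairGFInt_swap, pairGFInt_collision (by omega) (by omega), mul_zero]
    by_cases hQ : N₂ < N₁ + M₁ ∧ N₂ - N₁ < a ∧ N₂ - N₁ + (M₂ - M₁) < β
    · exact step a b α β N₁ M₁ N₂ M₂ hn hM₁ hM₂ ha hb hα hβ hab hαβ hQ.2.1 hxb hQ.2.2 hyα hQ.1
        hl₂ hN₂ hK₁ hK₂
    by_cases hP : N₁ < N₂ + M₂ ∧ -b < N₂ - N₁ ∧ -α < N₂ - N₁ + (M₂ - M₁)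
    · rw [pairGFInt_swap, burgeSum_swap]
      exact step b a β α N₂ M₂ N₁ M₁ (by omega) hM₂ hM₁ hb ha hβ hα (by omega) (by omega)
        (by omega) (by omega) (by omega) (by omega) hP.1 hl₁ hN₁ hK₂ hK₁
    lift N₁ to ℕ using hN₁
    lift M₁ to ℕ using hM₁
    lift N₂ to ℕ using hN₂
    lift M₂ to ℕ using hM₂
    -- Collisions, `a = -b` and `β = -α` are excluded, so if neither path can be trimmed then `N₁ =
    -- N₂ + M₂` or `N₂ = N₁ + M₁`.
    by_cases h3 : N₁ = N₂ + M₂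
    · exact burge_base ha hb hβ hab hαβ hc1 hc2 hxb hyα h3 (by omega) (by omega) (by omega)
    · rw [pairGFInt_swap, burgeSum_swap]
      exact burge_base hb ha hα (by omega) (by omega) (by omega) (by omega) (by omega)
        (by omega) (by omega) (by omega) (by omega) (by omega)

/-- Substitutes `k = N - x`, so that the summation index becomes the number of remaining parts of
`q`, and drops the vanishing terms. -/
theorem burgeSum_reflect (N : ℕ) (a b α β M₁ N₂ M₂ : ℤ) (n : ℕ) (hn : n ≤ N)
    (h : ∀ x ≤ N, n < x → burgeTerm a b α β N M₁ N₂ M₂ (N - x) = 0) :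
    burgeSum (N + 1) a b α β N M₁ N₂ M₂ =
      ∑ x ∈ Finset.range (n + 1), burgeTerm a b α β N M₁ N₂ M₂ (N - x) := by
  rw [burgeSum, ← Finset.sum_range_reflect, add_tsub_cancel_right]
  refine (Finset.sum_subset (Finset.range_subset_range.2 (by omega)) fun x hx hx' => ?_).symm
  rw [Finset.mem_range] at hx hx'
  exact h x (by omega) (by omega)

/-- The Burge transform for two partitions with the same number of parts. -/
theorem burge_transform_equal {a b α β : ℤ} (ha : 0 ≤ a) (hb : 0 ≤ b) (hα : 0 ≤ α) (hβ : 0 ≤ β)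
    (hab : 0 < a + b) (hαβ : 0 < α + β) (N M : ℕ) :
    pairGF N M N M a b (α + a) (β + b) = ∑ x ∈ Finset.range (min M N + 1),
      X ^ (x ^ 2) * gauss (2 * M + N - x) (N - x) * pairGF x (M - x) x (M - x) a b α β := by
  rw [← pairGFInt_natCast, burge_transform (K := N + 1) (2 * N + 2 * M) a b α β N M N M
    (by push_cast; ring) (by omega) (by omega) (by omega) (by omega) ha hb hα hβ hab hαβ
    (by omega) (by omega) (by omega) (by omega) (by omega) (by omega) (by omega) (by omega),
    burgeSum_reflect N _ _ _ _ _ _ _ (min M N) (by omega)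
      fun x hx hx' => burgeTerm_of_neg (by omega)]
  refine Finset.sum_congr rfl fun x hx => ?_
  rw [Finset.mem_range] at hx
  have h1 : ((N - x : ℕ) : ℤ) = N - x := by omega
  have h2 : ((M - x : ℕ) : ℤ) = M - x := by omega
  rw [burgeTerm, h1, ← pairGFInt_natCast, h2, show (N : ℤ) - (N - x) = x by ring,
    show (M : ℤ) - N + (N - x) = M - x by ring, show (M : ℤ) + M + (N - x) = 2 * M + N - x by ring]
  congr 3
  rw [← sq]
  exact_mod_cast Int.toNat_natCast (x ^ 2)

/-- The generating function of the pairs `(q, p)` with `n - 1` parts of size at most `w`,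
`p_i ≥ q_i` and `q_i ≥ p_{i + 2 - P} + 2 - P'`. -/
noncomputable def orderedGF (w n P P' : ℕ) : PowerSeries ℤ :=
  if n = 0 then (if w = 0 then 1 else 0)
  else pairGF (n - 1) w (n - 1) w 1 ((P : ℤ) - 1) 1 ((P' : ℤ) - 1)

theorem pairGF_cons (N M : ℕ) {b β : ℤ} (hb : 0 ≤ b) :
    pairGF (N + 1) M N M 0 (b + 1) 1 β = pairGF N M N M 1 b 1 β :=
  pairSum_cons N M hb _

theorem pairGFInt_cons {P : ℕ} (hP : 1 ≤ P) (β : ℤ) {x w : ℕ} (hx : 1 ≤ x) (hxw : x ≤ w) :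
    pairGFInt 0 P 1 β x ((w : ℤ) - x) (x - 1) (w - x) =
      pairGF (x - 1) (w - x) (x - 1) (w - x) 1 ((P : ℤ) - 1) 1 β := by
  have h := pairGF_cons (x - 1) (w - x) (b := (P : ℤ) - 1) (β := β) (by omega)
  rw [← h, ← pairGFInt_natCast]
  congr 1 <;> omega

/-- The Burge transform of `orderedGF`. -/
theorem burge_transform_ordered (w n : ℕ) {P P' : ℕ} (hP : 1 ≤ P) (hP' : 1 ≤ P') :
    orderedGF w n P (P' + P) = ∑ x ∈ Finset.range (min w n + 1),
      X ^ (x * (x - 1)) * gauss (2 * w + n - x) (n - x) * orderedGF (w - x) x P P' := by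
  rcases n with _ | N
  · simp only [min_zero, zero_add, Finset.range_one, Finset.sum_singleton, orderedGF]
    have := gauss_zero_right (2 * w)
    push_cast at this
    simp [this]
  rcases w with _ | m
  · simp only [zero_min, zero_add, Finset.range_one, Finset.sum_singleton, orderedGF,
      add_tsub_cancel_right, N.succ_ne_zero, if_true, if_false]
    rw [pairGF_free _ _ _ (by simp) (by push_cast; omega)]
    have h1 := gauss_self N
    have h2 := gauss_self (N + 1)
    push_cast at h2
    simp [h1, h2]
  -- Prepending a zero part to `q` makes `a = 0`, so the transform lowers only `β` and keeps `α =
  -- 1`.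
  have hLHS : orderedGF (m + 1) (N + 1) P (P' + P) =
      pairGFInt 0 P (1 + 0) (((P' : ℤ) - 1) + P) (N + 1 : ℕ) (m + 1 : ℕ) N (m + 1 : ℕ) := by
    rw [orderedGF, if_neg (by omega), add_tsub_cancel_right, ← pairGF_cons _ _ (by omega),
      pairGFInt_natCast]
    congr 1
    · ring
    · push_cast
      ring
  rw [hLHS, burge_transform (K := N + 1 + 1) (2 * N + 2 * m + 3) _ _ _ _ _ _ _ _
    (by push_cast; ring) (by omega) (by omega) (by omega) (by omega) (by omega) (by omega)
    (by omega) (by omega) (by omega) (by omega) (by omega) (by omega) (by omega) (by omega)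
    (by omega) (by omega) (by omega) (by omega),
    burgeSum_reflect (N + 1) _ _ _ _ _ _ _ (min (m + 1) (N + 1)) (by omega)
      fun x hx hx' => burgeTerm_of_neg (by omega)]
  refine Finset.sum_congr rfl fun x hx => ?_
  rw [Finset.mem_range] at hx
  rcases Nat.eq_zero_or_pos x with rfl | hx0
  · rw [burgeTerm_of_neg (by omega), orderedGF]
    simp
  have h1 : ((N + 1 - x : ℕ) : ℤ) = N + 1 - x := by omega
  -- The transformed box of `q` is one unit wider than that of `p`. Trimming `q` restores equal
  -- widths, since the term with a part dropped has colliding endpoints and vanishes; the zero part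
  -- can then be removed again.
  rw [burgeTerm, orderedGF, if_neg (by omega), h1, ← pairGFInt_cons hP _ hx0 (by omega),
    pairGFInt_trim (by omega) (by push_cast; omega) (by push_cast; omega) (by push_cast; omega)
      (by push_cast; omega),
    pairGFInt_collision (N₁ := _ - 1) (by push_cast; omega) (by push_cast; omega), mul_zero,
    zero_add]
  have h2 : (((N + 1 : ℕ) : ℤ) - (N + 1 - x)) * (N - (N + 1 - x)) = ((x * (x - 1) : ℕ) : ℤ) := by
    obtain ⟨y, rfl⟩ : ∃ y, x = y + 1 := ⟨x - 1, by omega⟩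
    rw [add_tsub_cancel_right]
    push_cast
    ring
  rw [h2, Int.toNat_natCast]
  congr 1
  · congr 2
    push_cast
    ring
  · congr 1 <;> push_cast <;> ring

end Transform

/-! ## Limits of Gaussian polynomials -/

section Limits

open PowerSeries

theorem qFact_add_mul_invQFact (m k : ℕ) :
    qFact (m + k) * invQFact m = ∏ i ∈ Finset.range k, (1 - X ^ (m + i + 1)) := by
  rw [qFact, Finset.prod_range_add, mul_right_comm]
  change qFact m * invQFact m * _ = _
  rw [qFact_mul_invQFact, one_mul]

theorem tendsto_X_pow : Tendsto (fun n : ℕ => (X : PowerSeries ℤ) ^ n) atTop (𝓝 0) := by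
  rw [PowerSeries.WithPiTopology.tendsto_iff_coeff_tendsto]
  intro d
  refine tendsto_const_nhds.congr' ?_
  filter_upwards [eventually_gt_atTop d] with n hn
  rw [coeff_X_pow, if_neg (by omega), map_zero]

theorem tendsto_qFact_add_mul_invQFact (k : ℕ) :
    Tendsto (fun m : ℕ => qFact (m + k) * invQFact m) atTop (𝓝 1) := by
  simp only [qFact_add_mul_invQFact]
  rw [← Finset.prod_const_one (s := Finset.range k)]
  refine tendsto_finsetProd _ fun i _ => ?_
  have h : Tendsto (fun m : ℕ => (X : PowerSeries ℤ) ^ (m + i + 1)) atTop (𝓝 0) :=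
    tendsto_X_pow.comp (tendsto_atTop_mono (fun m => by simp only [id]; omega) tendsto_id)
  simpa using tendsto_const_nhds.sub h

/-- The Gaussian polynomial `[2 w + n - x ; n - x]` and its limits for `w = ∞` and `n = ∞`. -/
noncomputable def gaussExt (w n : ℕ∞) (x : ℕ) : PowerSeries ℤ :=
  if w = ⊤ then invQFact (n.toNat - x) else if n = ⊤ then invQFact (2 * w.toNat)
  else gauss (2 * w.toNat + n.toNat - x) (n.toNat - x)

theorem gaussExt_natCast (w n x : ℕ) :
    gaussExt w n x = gauss (2 * w + n - x) (n - x) := by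
  simp [gaussExt]

theorem gauss_eq_of_le {w n x : ℕ} (hx : x ≤ n) :
    gauss (2 * (w : ℤ) + n - x) (n - x) =
      qFact (2 * w + (n - x)) * invQFact (n - x) * invQFact (2 * w) := by
  rw [← gauss_natCast_add]
  congr 1 <;> push_cast [hx] <;> ring

theorem tendsto_gaussExt_left {n x : ℕ} (hx : x ≤ n) :
    Tendsto (fun M : ℕ => gaussExt M n x) atTop (𝓝 (gaussExt ⊤ n x)) := by
  have h1 : gaussExt ⊤ n x = 1 * invQFact (n - x) := by simp [gaussExt]
  have h2 : (fun M : ℕ => gaussExt M n x) = fun M : ℕ =>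
      qFact (2 * M + (n - x)) * invQFact (2 * M) * invQFact (n - x) := by
    funext M
    rw [gaussExt_natCast, gauss_eq_of_le hx]
    ring
  rw [h1, h2]
  exact ((tendsto_qFact_add_mul_invQFact (n - x)).comp
    (tendsto_atTop_mono (fun m => by simp only [id]; omega) tendsto_id)).mul tendsto_const_nhds

theorem tendsto_gaussExt_right (w x : ℕ) :
    Tendsto (fun M : ℕ => gaussExt w M x) atTop (𝓝 (gaussExt w ⊤ x)) := by
  have h1 : gaussExt w ⊤ x = 1 * invQFact (2 * w) := by simp [gaussExt]
  have h2 : (fun M : ℕ => gaussExt w M x) =ᶠ[atTop] fun M : ℕ =>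
      qFact ((M - x) + 2 * w) * invQFact (M - x) * invQFact (2 * w) := by
    filter_upwards [eventually_ge_atTop x] with M hM
    rw [gaussExt_natCast, gauss_eq_of_le hM, add_comm (2 * w)]
  rw [h1]
  exact (((tendsto_qFact_add_mul_invQFact (2 * w)).comp
    (tendsto_sub_atTop_nat x)).mul tendsto_const_nhds).congr' h2.symm

end Limits

/-! ## The fermionic sums, by recursion -/

section FermSum

open PowerSeries

/-- One step of the Burge transform. -/
noncomputable def stepOp (e : ℕ → ℕ) (V : ℕ∞ → ℕ∞ → PowerSeries ℤ) (w n : ℕ∞) : PowerSeries ℤ :=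
  ∑ x ∈ Finset.range ((min w n).toNat + 1), X ^ e x * gaussExt w n x * V (w - x) x

/-- The exponents `x²` and `x (x - 1)` at the levels `k ≤ u` and `k > u`. -/
def levelExponent (u x : ℕ) : ℕ := if u = 0 then x * (x - 1) else x ^ 2

/-- The passage from one level to the next.  Here `u` is the number of levels `k ≤ u` that are
left, including the present one, and `V` is the contribution of the next level. -/
noncomputable def tailSum (u : ℕ) (V : ℕ → ℕ∞ → ℕ∞ → PowerSeries ℤ) (w n : ℕ∞) : PowerSeries ℤ :=
  if u = 0 then (if n = 0 then (if w = 0 then 1 else 0) else V 0 (n - 1) (w + 1))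
  else if u = 1 then
    X ^ n.toNat * (if w = 0 then (if n = 0 then 1 else 0) else V 0 (w - 1) (n + 1))
  else V (u - 1) n w

/-- The sum over all sequences of partitions with prescribed numbers of parts. -/
noncomputable def fermSum : List ℕ → ℕ → ℕ∞ → ℕ∞ → PowerSeries ℤ
  | [], _ => fun _ n => if n = 1 then 1 else 0
  | f :: fs, u => (stepOp (levelExponent u))^[f] (tailSum u (fermSum fs))

theorem stepOp_natCast (e : ℕ → ℕ) (V : ℕ∞ → ℕ∞ → PowerSeries ℤ) (w n : ℕ) :
    stepOp e V w n = ∑ x ∈ Finset.range (min w n + 1),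
      X ^ e x * gauss (2 * w + n - x) (n - x) * V (w - x : ℕ) x := by
  unfold stepOp
  rw [show ((min (w : ℕ∞) n).toNat) = min w n by
    rw [← ENat.natCast_toNat_eq_self.2 (ENat.natCast_ne_top w)]; norm_cast]
  refine Finset.sum_congr rfl fun x _ => ?_
  rw [gaussExt_natCast, ENat.natCast_sub]

/-- Applied to families indexed by the number `f` of Burge transforms carried out, whose recursion
is the transform itself. -/
theorem iterate_stepOp_natCast {e : ℕ → ℕ} {V : ℕ∞ → ℕ∞ → PowerSeries ℤ}
    (G : ℕ → ℕ → ℕ → PowerSeries ℤ) (h0 : ∀ w n : ℕ, V w n = G 0 w n)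
    (hs : ∀ f w n : ℕ, G (f + 1) w n = ∑ x ∈ Finset.range (min w n + 1),
      X ^ e x * gauss (2 * w + n - x) (n - x) * G f (w - x) x) (f w n : ℕ) :
    (stepOp e)^[f] V w n = G f w n := by
  induction f generalizing w n with
  | zero => exact h0 w n
  | succ f ih =>
    rw [Function.iterate_succ_apply', stepOp_natCast, hs]
    exact Finset.sum_congr rfl fun x _ => by rw [ih]

/-- The pair `(num, den)` with continued fraction `(f_1, …, f_k + 2)`. -/
def quot : List ℕ → ℕ × ℕ
  | [] => (1, 2)
  | f :: fs => (f * (quot fs).1 + (quot fs).2, (quot fs).1)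

theorem quot_pos (fs : List ℕ) : 0 < (quot fs).1 ∧ 0 < (quot fs).2 := by
  induction fs with
  | nil => simp [quot]
  | cons f fs ih =>
    refine ⟨?_, ih.1⟩
    simp only [quot]
    have := ih.2
    positivity

/-- Conjugation preserves `a = α = 1` and exchanges `P` with `P'`. The shifts by one arise because
`orderedGF w n` counts pairs with `n - 1` parts. -/
theorem orderedGF_conj {w n P P' : ℕ} (hP : 0 < P) (hP' : 0 < P') :
    orderedGF w (n + 1) P P' = orderedGF n (w + 1) P' P := by
  simp only [orderedGF, Nat.succ_ne_zero, if_false, add_tsub_cancel_right]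
  exact pairSum_conj _ _ (by omega) (by omega) (by omega) (by omega) (by omega) (by omega) _

theorem tailSum_zero_eq (fs : List ℕ)
    (h : ∀ w n : ℕ, fermSum fs 0 w (n + 1 : ℕ) = orderedGF w (n + 1) (quot fs).2 (quot fs).1)
    (w n : ℕ) :
    tailSum 0 (fermSum fs) w n = orderedGF w n (quot fs).1 (quot fs).2 := by
  unfold tailSum
  rw [if_pos rfl]
  rcases n with _ | n
  · simp [orderedGF]
  · rw [if_neg (by simp), orderedGF_conj (quot_pos fs).1 (quot_pos fs).2, ← h]
    congr 1

/-- Each entry of the list is a number of ordered transforms, and between entries the pairs are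
conjugated. Positivity of the last argument is needed: at `w = n = 0` the empty list gives `0`,
whereas `orderedGF` is `1` there by convention. -/
theorem fermSum_zero_eq (fs : List ℕ) (w n : ℕ) :
    fermSum fs 0 w (n + 1 : ℕ) = orderedGF w (n + 1) (quot fs).2 (quot fs).1 := by
  induction fs generalizing w n with
  | nil =>
    simp only [quot, fermSum]
    rw [orderedGF_conj (by omega) (by omega)]
    simp only [orderedGF, Nat.succ_ne_zero, if_false, add_tsub_cancel_right]
    have := pairSum_terminal w n (fun i j => (X : PowerSeries ℤ) ^ (i + j).toNat)
    norm_num [pairGF, this]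
  | cons f fs ih =>
    have := iterate_stepOp_natCast (e := levelExponent 0) (V := tailSum 0 (fermSum fs))
      (fun f w n => orderedGF w n (quot fs).1 (f * (quot fs).1 + (quot fs).2))
      (fun w n => by simpa using tailSum_zero_eq fs ih w n)
      (fun f w n => by
        have h := burge_transform_ordered w n (P := (quot fs).1)
          (P' := f * (quot fs).1 + (quot fs).2) (quot_pos fs).1
          (by have := (quot_pos fs).2; omega)
        rw [show (f + 1) * (quot fs).1 + (quot fs).2 =
          f * (quot fs).1 + (quot fs).2 + (quot fs).1 by ring, h]
        simp [levelExponent])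
      f w (n + 1)
    exact this

/-- The parameters `(a, b, α, β)` of the restricted partition pairs that belong to a sequence of
numbers of parts, where `u` levels of the first kind are left. -/
def params : List ℕ → ℕ → ℕ × ℕ × ℕ × ℕ
  | [], _ => (0, 0, 0, 0)
  | _ :: _, 0 => (0, 0, 0, 0)
  | f :: fs, 1 => (1, (quot fs).2 - 1, f, (quot fs).1 + f * ((quot fs).2 - 1))
  | f :: fs, u + 2 =>
    let x := params fs (u + 1)
    (x.2.2.1, x.2.2.2, x.1 + f * x.2.2.1, x.2.1 + f * x.2.2.2)

theorem params_pos (fs : List ℕ) (u : ℕ) (hu : u + 1 ≤ fs.length) :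
    0 < (params fs (u + 1)).1 + (params fs (u + 1)).2.1 ∧
      0 < (params fs (u + 1)).2.2.1 + (params fs (u + 1)).2.2.2 := by
  induction fs generalizing u with
  | nil => simp at hu
  | cons f fs ih =>
    rcases u with _ | u
    · have := (quot_pos fs).1
      simp only [params]
      omega
    · have h := ih u (by simpa using hu)
      simp only [params]
      refine ⟨h.2, ?_⟩
      have h1 := h.1
      generalize f * (params fs (u + 1)).2.2.1 = A
      generalize f * (params fs (u + 1)).2.2.2 = B
      omega

/-- This is the passage at level `u`: lowering the `n` parts of `p` gives the factor `X ^ n` and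
raises `α` from `0` to `1`. -/
theorem pairGF_shift (n w P P' : ℕ) (hP : 0 < P) (hP' : 0 < P') :
    pairGF n w n w 1 ((P : ℤ) - 1) 0 P' =
      X ^ n * (if w = 0 then (if n = 0 then 1 else 0) else orderedGF (w - 1) (n + 1) P P') := by
  rcases w with _ | w
  · rw [pairGF, pairSum_zero_right _ (by omega) (by omega)]
    rcases n with _ | n <;> simp
  · rw [pairGF, pairSum_shift _ _ (by omega),
      pairSum_X_pow _ _ _ _ n _ _ _ _ _ (fun i j => by ring)]
    simp [orderedGF]

theorem fermSum_eq (fs : List ℕ) (u : ℕ) (hu : u + 1 ≤ fs.length) (w n : ℕ) :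
    fermSum fs (u + 1) w n =
      pairGF n w n w (params fs (u + 1)).1 (params fs (u + 1)).2.1
        (params fs (u + 1)).2.2.1 (params fs (u + 1)).2.2.2 := by
  induction fs generalizing u w n with
  | nil => simp at hu
  | cons f fs ih =>
    -- The `f` Burge transforms at this level add `f * (a, b)` to `(α, β)`; the two cases below
    -- differ only in how the level is entered.
    have key : ∀ a b α β : ℕ, 0 < a + b → 0 < α + β →
        (∀ w n : ℕ, tailSum (u + 1) (fermSum fs) w n = pairGF n w n w a b α β) →
        fermSum (f :: fs) (u + 1) w n = pairGF n w n w a b (α + f * a : ℕ) (β + f * b : ℕ) := by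
      intro a b α β hab hαβ h
      refine iterate_stepOp_natCast (e := levelExponent (u + 1))
        (V := tailSum (u + 1) (fermSum fs))
        (fun f w n => pairGF n w n w a b (α + f * a : ℕ) (β + f * b : ℕ))
        (fun w n => by simpa using h w n) (fun f w n => ?_) f w n
      have h2 := burge_transform_equal (a := a) (b := b) (α := (α + f * a : ℕ))
        (β := (β + f * b : ℕ)) (by omega) (by omega) (by omega) (by omega) (by omega)
        (by
          generalize f * a = A
          generalize f * b = B
          omega) n w
      have h3 : ((α + (f + 1) * a : ℕ) : ℤ) = (α + f * a : ℕ) + a := by push_cast; ring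
      have h4 : ((β + (f + 1) * b : ℕ) : ℤ) = (β + f * b : ℕ) + b := by push_cast; ring
      simp only [h3, h4, h2]
      simp [levelExponent]
    rcases u with _ | u
    · have hP := (quot_pos fs).2
      have hP' := (quot_pos fs).1
      have h := key 1 ((quot fs).2 - 1) 0 (quot fs).1 (by omega) (by omega) fun w n => by
        have h1 := pairGF_shift n w (quot fs).2 (quot fs).1 hP hP'
        have h2 : (((quot fs).2 - 1 : ℕ) : ℤ) = (quot fs).2 - 1 := by omega
        simp only [h2, Nat.cast_one, Nat.cast_zero, h1]
        unfold tailSum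
        rw [if_neg (by simp), if_pos rfl]
        rcases w with _ | w
        · simp
        · rw [if_neg (by simp), if_neg (by omega), add_tsub_cancel_right, ← fermSum_zero_eq]
          congr 1
      rw [h]
      simp [params]
    · have hu' : u + 1 ≤ fs.length := by simpa using hu
      have hpos := params_pos fs u hu'
      have h := key (params fs (u + 1)).2.2.1 (params fs (u + 1)).2.2.2 (params fs (u + 1)).1
        (params fs (u + 1)).2.1 hpos.2 hpos.1 fun w n => by
          unfold tailSum
          rw [if_neg (by simp), if_neg (by simp), add_tsub_cancel_right, ih u hu']
          exact pairSum_conj _ _ (by omega) (by omega) (by omega) (by omega) (by omega)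
            (by omega) _
      rw [h]
      rfl

end FermSum

/-! ### Passage to the limit in the fermionic recursion -/

section FermLimit

open PowerSeries

/-- `V w n → V ∞ n` for all finite `n`. -/
def ContLeft (V : ℕ∞ → ℕ∞ → PowerSeries ℤ) : Prop :=
  ∀ n : ℕ, Tendsto (fun M : ℕ => V M n) atTop (𝓝 (V ⊤ n))

/-- `V w n → V w ∞` for all finite `w`. -/
def ContRight (V : ℕ∞ → ℕ∞ → PowerSeries ℤ) : Prop :=
  ∀ w : ℕ, Tendsto (fun M : ℕ => V w M) atTop (𝓝 (V w ⊤))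

/-- Once `M ≥ n` the summation range no longer depends on `M`, so the limit is taken in finitely
many terms. -/
theorem ContLeft.stepOp {V : ℕ∞ → ℕ∞ → PowerSeries ℤ} (h : ContLeft V) (e : ℕ → ℕ) :
    ContLeft (stepOp e V) := by
  intro n
  have h1 : (fun M : ℕ => Burge.stepOp e V M n) =ᶠ[atTop] fun M : ℕ =>
      ∑ x ∈ Finset.range (n + 1), X ^ e x * gaussExt M n x * V (M - x : ℕ) x := by
    filter_upwards [eventually_ge_atTop n] with M hM
    unfold Burge.stepOp
    rw [min_eq_right (by exact_mod_cast hM)]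
    simp
  have h2 : Burge.stepOp e V ⊤ n =
      ∑ x ∈ Finset.range (n + 1), X ^ e x * gaussExt ⊤ n x * V ⊤ x := by
    unfold Burge.stepOp
    rw [min_eq_right le_top]
    simp
  rw [h2]
  refine Tendsto.congr' h1.symm (tendsto_finsetSum _ fun x hx => ?_)
  exact (tendsto_const_nhds.mul (tendsto_gaussExt_left (by
    rw [Finset.mem_range] at hx; omega))).mul ((h x).comp (tendsto_sub_atTop_nat x))

/-- No continuity of `V` is needed: the sum stops at `x = w`, and `V` is evaluated at arguments
independent of `M`. -/
theorem contRight_stepOp (V : ℕ∞ → ℕ∞ → PowerSeries ℤ) (e : ℕ → ℕ) :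
    ContRight (stepOp e V) := by
  intro w
  have h1 : (fun M : ℕ => Burge.stepOp e V w M) =ᶠ[atTop] fun M : ℕ =>
      ∑ x ∈ Finset.range (w + 1), X ^ e x * gaussExt w M x * V (w - x) x := by
    filter_upwards [eventually_ge_atTop w] with M hM
    unfold Burge.stepOp
    rw [min_eq_left (by exact_mod_cast hM)]
    simp
  have h2 : Burge.stepOp e V w ⊤ =
      ∑ x ∈ Finset.range (w + 1), X ^ e x * gaussExt w ⊤ x * V (w - x) x := by
    unfold Burge.stepOp
    rw [min_eq_left le_top]
    simp
  rw [h2]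
  refine Tendsto.congr' h1.symm (tendsto_finsetSum _ fun x hx => ?_)
  exact (tendsto_const_nhds.mul (tendsto_gaussExt_right w x)).mul tendsto_const_nhds

theorem ContLeft.fermSum {f : ℕ} {fs : List ℕ} {u : ℕ} (h : ContLeft (tailSum u (fermSum fs))) :
    ContLeft (fermSum (f :: fs) u) := by
  change ContLeft ((Burge.stepOp (levelExponent u))^[f] (tailSum u (Burge.fermSum fs)))
  induction f with
  | zero => exact h
  | succ f ih =>
    rw [Function.iterate_succ_apply']
    exact ih.stepOp _

theorem contRight_fermSum {f : ℕ} (fs : List ℕ) (u : ℕ) (hf : 0 < f) :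
    ContRight (fermSum (f :: fs) u) := by
  obtain ⟨f, rfl⟩ : ∃ g, f = g + 1 := ⟨f - 1, by omega⟩
  change ContRight ((stepOp (levelExponent u))^[f + 1] (tailSum u (fermSum fs)))
  rw [Function.iterate_succ_apply']
  exact contRight_stepOp _ _

theorem contRight_fermSum_nil (u : ℕ) : ContRight (fermSum [] u) := by
  intro w
  refine tendsto_const_nhds.congr' ?_
  filter_upwards [eventually_gt_atTop 1] with M hM
  have : (M : ℕ∞) ≠ 1 := by exact_mod_cast hM.ne'
  simp [fermSum, this]

/-- The exceptional case without any Burge step. For `M > 0` the value depends only on whether `w =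
0`. -/
theorem contRight_fermSum_zero_singleton : ContRight (fermSum [0] 0) := by
  intro w
  refine tendsto_const_nhds.congr' ?_
  filter_upwards [eventually_gt_atTop 1] with M hM
  have : M ≠ 0 := by omega
  simp [fermSum, tailSum, this]

theorem contLeft_tailSum_zero {V : ℕ → ℕ∞ → ℕ∞ → PowerSeries ℤ} (h : ContRight (V 0)) :
    ContLeft (tailSum 0 V) := by
  intro n
  unfold tailSum
  simp only [if_true]
  rcases n with _ | n
  · refine tendsto_const_nhds.congr' ?_
    filter_upwards [eventually_gt_atTop 0] with M hM
    have : M ≠ 0 := by omega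
    simp [this]
  · have h1 : ((n + 1 : ℕ) : ℕ∞) - 1 = n := by
      exact_mod_cast (ENat.natCast_sub (n + 1) 1).symm
    have h2 : ((n + 1 : ℕ) : ℕ∞) ≠ 0 := by exact_mod_cast n.succ_ne_zero
    simp only [h1, h2, if_false, top_add]
    exact (h n).comp (tendsto_add_atTop_nat 1)

theorem contLeft_tailSum_one {V : ℕ → ℕ∞ → ℕ∞ → PowerSeries ℤ} (h : ContLeft (V 0)) :
    ContLeft (tailSum 1 V) := by
  intro n
  unfold tailSum
  simp only [if_true, one_ne_zero, if_false, ENat.top_ne_zero, ENat.toNat_natCast]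
  have h1 := (h (n + 1)).comp (tendsto_sub_atTop_nat 1)
  rw [ENat.top_sub_one]
  refine tendsto_const_nhds.mul (Tendsto.congr' ?_ h1)
  filter_upwards [eventually_gt_atTop 0] with M hM
  rw [if_neg (by exact_mod_cast hM.ne')]
  simp

theorem contLeft_tailSum {V : ℕ → ℕ∞ → ℕ∞ → PowerSeries ℤ} {u : ℕ} (h : ContRight (V (u + 1))) :
    ContLeft (tailSum (u + 2) V) := by
  intro n
  unfold tailSum
  simp only [show u + 2 ≠ 0 by omega, show u + 2 ≠ 1 by omega, if_false]
  exact h n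

/-- After the first level the conjugation exchanges the infinite `w` with the finite `n`. The second
level is therefore entered with `n` infinite, and one genuine step there suffices for the limit. -/
theorem contLeft_fermSum_of_one_lt (f₁ f₂ : ℕ) (fs : List ℕ) {u : ℕ} (hf : 0 < f₂) :
    ContLeft (fermSum (f₁ :: f₂ :: fs) (u + 2)) :=
  (contLeft_tailSum (contRight_fermSum fs (u + 1) hf)).fermSum

/-- For `u = 1` the passage after the first level keeps `w` infinite, so the exchange happens one
level later. -/
theorem contLeft_fermSum_one (f₁ f₂ : ℕ) {fs : List ℕ} (h : ContRight (fermSum fs 0)) :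
    ContLeft (fermSum (f₁ :: f₂ :: fs) 1) :=
  (contLeft_tailSum_one (contLeft_tailSum_zero h).fermSum).fermSum

end FermLimit

/-! ## The fermionic sums as sums over sequences of partitions -/

section ConsUnion

variable {α : Type*}

/-- Prepending the first component of a pair to the second one. -/
def consEmbedding (α : Type*) : (Σ _ : α, List α) ↪ List α where
  toFun x := x.1 :: x.2
  inj' := by
    rintro ⟨x, l⟩ ⟨y, m⟩ h
    cases h
    rfl

/-- The lists with head `x ∈ s` and tail in `B x`. -/
def consUnion (s : Finset α) (B : α → Finset (List α)) : Finset (List α) :=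
  (s.sigma B).map (consEmbedding α)

theorem cons_mem_consUnion {s : Finset α} {B : α → Finset (List α)} {x : α} {l : List α} :
    x :: l ∈ consUnion s B ↔ x ∈ s ∧ l ∈ B x := by
  rw [consUnion, Finset.mem_map]
  constructor
  · rintro ⟨⟨a, b⟩, h, heq⟩
    cases heq
    exact Finset.mem_sigma.1 h
  · exact fun h => ⟨⟨x, l⟩, Finset.mem_sigma.2 h, rfl⟩

theorem nil_notMem_consUnion {s : Finset α} {B : α → Finset (List α)} : [] ∉ consUnion s B := by
  simp [consUnion, consEmbedding]

theorem sum_consUnion {A : Type*} [AddCommMonoid A] (s : Finset α) (B : α → Finset (List α))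
    (g : List α → A) :
    ∑ l ∈ consUnion s B, g l = ∑ x ∈ s, ∑ l ∈ B x, g (x :: l) := by
  rw [consUnion, Finset.sum_map, Finset.sum_sigma]
  rfl

end ConsUnion

/-! ### Unrolling the recursion into a sum over sequences of partitions -/

section Sequences

open PowerSeries

/-- The last part of the partition `l`, or `n` if there are no parts. -/
def lastPart : ℕ∞ → List ℕ → ℕ∞
  | n, [] => n
  | _, x :: l => lastPart x l

/-- The partitions with `f` parts of size at most `n` and weight at most `w`. -/
noncomputable def levelLists : ℕ → ℕ∞ → ℕ∞ → Finset (List ℕ)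
  | 0, _, _ => {[]}
  | f + 1, w, n =>
    consUnion (Finset.range ((min w n).toNat + 1)) fun x => levelLists f (w - x) x

/-- The contribution of a partition. -/
noncomputable def levelTerm (e : ℕ → ℕ) : ℕ∞ → ℕ∞ → List ℕ → PowerSeries ℤ
  | _, _, [] => 1
  | w, n, x :: l => X ^ e x * gaussExt w n x * levelTerm e (w - x) x l

theorem iterate_stepOp (e : ℕ → ℕ) (V : ℕ∞ → ℕ∞ → PowerSeries ℤ) (f : ℕ) (w n : ℕ∞) :
    (stepOp e)^[f] V w n =
      ∑ l ∈ levelLists f w n, levelTerm e w n l * V (w - l.sum) (lastPart n l) := by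
  induction f generalizing w n with
  | zero => simp [levelLists, levelTerm, lastPart]
  | succ f ih =>
    rw [Function.iterate_succ_apply', levelLists, sum_consUnion]
    refine Finset.sum_congr rfl fun x _ => ?_
    rw [ih, Finset.mul_sum]
    refine Finset.sum_congr rfl fun l _ => ?_
    rw [levelTerm, lastPart, List.sum_cons, Nat.cast_add, tsub_add_eq_tsub_tsub, ← mul_assoc]

/-- The pair `(w_{k+1}, n_{k+1,0})`, where `w` is the difference `w_k - wt(n^{(k)})`, `n` is the
last part of `n^{(k)}`, and `u` is the number of levels of the first kind that are left. -/
def nextBounds (u : ℕ) (w n : ℕ∞) : ℕ∞ × ℕ∞ :=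
  if u = 0 then (n - 1, w + 1) else if u = 1 then (w - 1, n + 1) else (n, w)

/-- The possible continuations of a sequence of partitions. -/
def tailSeqs (u : ℕ) (A : ℕ → ℕ∞ → ℕ∞ → Finset (List (List ℕ))) (w n : ℕ∞) :
    Finset (List (List ℕ)) :=
  if u = 0 ∧ n = 0 ∨ u = 1 ∧ w = 0 then (if w = 0 ∧ n = 0 then {[]} else ∅)
  else A (u - 1) (nextBounds u w n).1 (nextBounds u w n).2

/-- The sequences of partitions with prescribed numbers of parts over which the sum is taken. -/
noncomputable def admSeqs : List ℕ → ℕ → ℕ∞ → ℕ∞ → Finset (List (List ℕ))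
  | [], _, _, n => if n = 1 then {[]} else ∅
  | f :: fs, u, w, n =>
    consUnion (levelLists f w n) fun l => tailSeqs u (admSeqs fs) (w - l.sum) (lastPart n l)

/-- The contribution of a sequence of partitions. -/
noncomputable def seqTerm : ℕ → ℕ∞ → ℕ∞ → List (List ℕ) → PowerSeries ℤ
  | _, _, _, [] => 1
  | u, w, n, l :: S =>
    levelTerm (levelExponent u) w n l * (if u = 1 then X ^ (lastPart n l).toNat else 1) *
      seqTerm (u - 1) (nextBounds u (w - l.sum) (lastPart n l)).1
        (nextBounds u (w - l.sum) (lastPart n l)).2 S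

theorem tailSum_eq (u : ℕ) (V : ℕ → ℕ∞ → ℕ∞ → PowerSeries ℤ)
    (A : ℕ → ℕ∞ → ℕ∞ → Finset (List (List ℕ)))
    (h : ∀ u w n, V u w n = ∑ S ∈ A u w n, seqTerm u w n S) (w n : ℕ∞) :
    tailSum u V w n = ∑ S ∈ tailSeqs u A w n, (if u = 1 then X ^ n.toNat else 1) *
      seqTerm (u - 1) (nextBounds u w n).1 (nextBounds u w n).2 S := by
  rw [← Finset.mul_sum]
  unfold tailSum tailSeqs nextBounds
  rcases u with _ | _ | u
  · by_cases hn : n = 0 <;> by_cases hw : w = 0 <;> simp [hn, hw, h, seqTerm]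
  · by_cases hn : n = 0 <;> by_cases hw : w = 0 <;> simp [hn, hw, h, seqTerm]
  · simp [h]

theorem fermSum_eq_sum (fs : List ℕ) (u : ℕ) (w n : ℕ∞) :
    fermSum fs u w n = ∑ S ∈ admSeqs fs u w n, seqTerm u w n S := by
  induction fs generalizing u w n with
  | nil =>
    simp only [fermSum, admSeqs]
    split_ifs <;> simp [seqTerm]
  | cons f fs ih =>
    rw [fermSum, iterate_stepOp, admSeqs, sum_consUnion]
    refine Finset.sum_congr rfl fun l _ => ?_
    rw [tailSum_eq u _ _ ih, Finset.mul_sum]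
    exact Finset.sum_congr rfl fun S _ => by rw [seqTerm, mul_assoc]

end Sequences

/-! ## Comparison with the definition of the sequences by explicit indices -/

section Comparison

/-- The part with index `i` of the partition `l`, where the part with index `0` is `n`. -/
def extPart (n : ℕ∞) (l : List ℕ) (i : ℕ) : ℕ∞ := if i = 0 then n else (l.getD (i - 1) 0 : ℕ)

theorem extPart_cons_succ (n : ℕ∞) (x : ℕ) (l : List ℕ) (i : ℕ) :
    extPart n (x :: l) (i + 1) = extPart x l i := by
  rcases i with _ | i <;> simp [extPart]

theorem lastPart_eq (n : ℕ∞) (l : List ℕ) : lastPart n l = extPart n l l.length := by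
  induction l generalizing n with
  | nil => simp [lastPart, extPart]
  | cons x l ih => rw [lastPart, ih, List.length_cons, extPart_cons_succ]

theorem lastPart_eq_top {n : ℕ∞} {l : List ℕ} (h : lastPart n l = ⊤) : n = ⊤ ∧ l = [] := by
  rw [lastPart_eq] at h
  rcases l with _ | ⟨x, l⟩
  · exact ⟨by simpa [extPart] using h, rfl⟩
  · simp [extPart] at h

theorem natCast_add_le_iff {w : ℕ∞} {x s : ℕ} :
    ((x + s : ℕ) : ℕ∞) ≤ w ↔ (x : ℕ∞) ≤ w ∧ (s : ℕ∞) ≤ w - x := by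
  induction w using ENat.recTopCoe with
  | top => simp
  | coe w =>
    norm_cast
    omega

/-- If both bounds were infinite, `toNat` would send their minimum to `0` and the range of the first
part would collapse. -/
theorem mem_levelLists {f : ℕ} {w n : ℕ∞} (h : ¬ (w = ⊤ ∧ n = ⊤)) {l : List ℕ} :
    l ∈ levelLists f w n ↔ l.length = f ∧ (l.sum : ℕ∞) ≤ w ∧
      ∀ i < f, extPart n l (i + 1) ≤ extPart n l i := by
  induction f generalizing w n l with
  | zero =>
    simp only [levelLists, Finset.mem_singleton, List.length_eq_zero_iff, not_lt_zero]
    constructor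
    · rintro rfl
      simp
    · exact fun h => h.1
  | succ f ih =>
    rcases l with _ | ⟨x, l⟩
    · simp [levelLists, nil_notMem_consUnion]
    rw [levelLists, cons_mem_consUnion, ih (by simp), List.sum_cons, natCast_add_le_iff]
    have hx : x ∈ Finset.range ((min w n).toNat + 1) ↔ (x : ℕ∞) ≤ w ∧ (x : ℕ∞) ≤ n := by
      rw [← le_min_iff, Finset.mem_range, Nat.lt_succ_iff]
      have hm : min w n ≠ ⊤ := fun hm => h (min_eq_top.1 hm)
      obtain ⟨m, hm⟩ := ENat.ne_top_iff_exists.1 hm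
      rw [← hm]
      simp
    rw [hx, Nat.forall_lt_succ_left']
    simp only [extPart_cons_succ, List.length_cons, Nat.add_right_cancel_iff]
    have h0 : extPart (x : ℕ∞) l 0 = x := rfl
    have h1 : extPart n (x :: l) 0 = n := rfl
    rw [h0, h1]
    tauto

/-- Up to shifts by one, the next bounds are the old ones, possibly exchanged, so one of them stays
finite at every level. -/
theorem nextBounds_ne_top {u : ℕ} {w n : ℕ∞} (h : ¬ (w = ⊤ ∧ n = ⊤)) :
    ¬ ((nextBounds u w n).1 = ⊤ ∧ (nextBounds u w n).2 = ⊤) := by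
  have h1 : ∀ m : ℕ∞, m - 1 = ⊤ ↔ m = ⊤ := fun m => by simp [ENat.sub_eq_top_iff]
  have h2 : ∀ m : ℕ∞, m + 1 = ⊤ ↔ m = ⊤ := fun m => by simp
  unfold nextBounds
  split_ifs <;> simp only [h1, h2] <;> tauto

/-- The conditions of `Admissible` for the last levels of a sequence of partitions: here `u` is the
number of levels of the first kind that are left, which may be zero, and `T` bounds the number of
all levels that are left. -/
structure AdmissibleFrom (f : ℕ → ℕ) (T u : ℕ) (w n : ℕ∞) (S : List (List ℕ)) : Prop where
  le_length : u ≤ S.length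
  one_le_length : 1 ≤ S.length
  length_le : S.length ≤ T
  length_part : ∀ k, 1 ≤ k → k ≤ S.length → (nPartition S k).length = f k
  antitone : ∀ k, 1 ≤ k → k ≤ S.length → ∀ i, 1 ≤ i → i ≤ f k →
    nExt f u w n S k i ≤ nExt f u w n S k (i - 1)
  wt_le : ∀ k, 1 ≤ k → k ≤ S.length → (nWt S k : ℕ∞) ≤ wBound f u w n S k
  wt_last : (nWt S S.length : ℕ∞) = wBound f u w n S S.length
  wt_u_lt : 1 ≤ u → u < S.length → (nWt S u : ℕ∞) < wBound f u w n S u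
  pos : ∀ k, u < k → k < S.length → 0 < nExt f u w n S k (f k)
  last_zero : S.length < T → nExt f u w n S S.length (f S.length) = 0

theorem admissible_iff {f : ℕ → ℕ} {t u : ℕ} {w n : ℕ∞} {S : List (List ℕ)} (hu : 1 ≤ u) :
    Admissible f t u w n S ↔ AdmissibleFrom f (t + 1) u w n S :=
  ⟨fun h => ⟨h.1, hu.trans h.1, h.2, h.3, h.4, h.5, h.6, fun _ => h.7, h.8, h.9⟩,
    fun h => ⟨h.1, h.3, h.4, h.5, h.6, h.7, h.8 hu, h.9, h.10⟩⟩

theorem nPartition_cons (l : List ℕ) (S : List (List ℕ)) {k : ℕ} (hk : 1 ≤ k) :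
    nPartition (l :: S) (k + 1) = nPartition S k := by
  obtain ⟨k, rfl⟩ : ∃ j, k = j + 1 := ⟨k - 1, by omega⟩
  rfl

/-- The recursion after the first level is the same recursion with shifted indices and one level of
the first kind fewer. This permits induction on the sequence. -/
theorem bounds_cons (f : ℕ → ℕ) (u : ℕ) (w n : ℕ∞) (l : List ℕ) (S : List (List ℕ)) (j : ℕ) :
    bounds f u w n (l :: S) (j + 1) = bounds (fun k => f (k + 1)) (u - 1)
      (bounds f u w n (l :: S) 1).1 (bounds f u w n (l :: S) 1).2 S j := by
  generalize hW : bounds f u w n (l :: S) 1 = W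
  induction j with
  | zero => exact hW
  | succ j ih =>
    have h1 : j + 1 + 1 < u ↔ j + 1 < u - 1 := by omega
    have h2 : j + 1 + 1 = u ↔ j + 1 = u - 1 := by omega
    rw [bounds]
    simp only [ih, h1, h2, nPart, nWt, nPartition_cons l S (Nat.le_add_left 1 j)]
    rfl

theorem add_one_tsub_eq {w : ℕ∞} {s : ℕ} (h : (s : ℕ∞) ≤ w) : w + 1 - s = w - s + 1 := by
  induction w using ENat.recTopCoe with
  | top => simp
  | coe w =>
    norm_cast at h ⊢
    omega

theorem bounds_one {f : ℕ → ℕ} {u : ℕ} {w n : ℕ∞} {l : List ℕ} {S : List (List ℕ)}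
    (h1 : l.length = f 1) (h2 : (l.sum : ℕ∞) ≤ w) :
    bounds f u w n (l :: S) 1 = nextBounds u (w - l.sum) (lastPart n l) := by
  have h3 : (if f (0 + 1) = 0 then (bounds f u w n (l :: S) 0).2
      else (nPart (l :: S) (0 + 1) (f (0 + 1)) : ℕ∞)) = lastPart n l := by
    rw [lastPart_eq, h1]
    rfl
  rw [bounds, nextBounds]
  simp only [h3]
  have h4 : nWt (l :: S) (0 + 1) = l.sum := rfl
  have h5 : (bounds f u w n (l :: S) 0).1 = w := rfl
  rw [h4, h5, tsub_right_comm, add_one_tsub_eq h2]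
  rcases u with _ | _ | u <;> simp

variable {f : ℕ → ℕ} {u T : ℕ} {w n : ℕ∞} {l : List ℕ} {S : List (List ℕ)}

theorem wBound_cons (h1 : l.length = f 1) (h2 : (l.sum : ℕ∞) ≤ w) {k : ℕ} (hk : 1 ≤ k) :
    wBound f u w n (l :: S) (k + 1) = wBound (fun k => f (k + 1)) (u - 1)
      (nextBounds u (w - l.sum) (lastPart n l)).1
      (nextBounds u (w - l.sum) (lastPart n l)).2 S k := by
  obtain ⟨k, rfl⟩ : ∃ j, k = j + 1 := ⟨k - 1, by omega⟩
  unfold wBound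
  rw [← bounds_one h1 h2 (S := S)]
  exact congrArg Prod.fst (bounds_cons f u w n l S k)

theorem nExt_cons (h1 : l.length = f 1) (h2 : (l.sum : ℕ∞) ≤ w) {k : ℕ} (hk : 1 ≤ k) (i : ℕ) :
    nExt f u w n (l :: S) (k + 1) i = nExt (fun k => f (k + 1)) (u - 1)
      (nextBounds u (w - l.sum) (lastPart n l)).1
      (nextBounds u (w - l.sum) (lastPart n l)).2 S k i := by
  obtain ⟨k, rfl⟩ : ∃ j, k = j + 1 := ⟨k - 1, by omega⟩
  unfold nExt
  rw [← bounds_one h1 h2 (S := S), ← bounds_cons]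
  rfl

theorem nExt_one (i : ℕ) : nExt f u w n (l :: S) 1 i = extPart n l i := rfl

theorem nWt_cons {k : ℕ} (hk : 1 ≤ k) : nWt (l :: S) (k + 1) = nWt S k := by
  rw [nWt, nPartition_cons l S hk, nWt]

/-- Peels off the first level: the sequence either ends there or continues under the same conditions
with updated bounds. -/
theorem admissibleFrom_cons (hT : 1 ≤ T) :
    AdmissibleFrom f T u w n (l :: S) ↔
      (l.length = f 1 ∧ (l.sum : ℕ∞) ≤ w ∧ ∀ i < f 1, extPart n l (i + 1) ≤ extPart n l i) ∧
      (S = [] ∧ u ≤ 1 ∧ (l.sum : ℕ∞) = w ∧ (1 < T → lastPart n l = 0) ∨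
        S ≠ [] ∧ (u = 1 → (l.sum : ℕ∞) < w) ∧ (u = 0 → 0 < lastPart n l) ∧
          AdmissibleFrom (fun k => f (k + 1)) (T - 1) (u - 1)
            (nextBounds u (w - l.sum) (lastPart n l)).1
            (nextBounds u (w - l.sum) (lastPart n l)).2 S) := by
  constructor
  · intro h
    have hl : l.length = f 1 := h.length_part 1 le_rfl (by simp)
    have hw : (l.sum : ℕ∞) ≤ w := h.wt_le 1 le_rfl (by simp)
    have hlast : nExt f u w n (l :: S) 1 (f 1) = lastPart n l := by
      rw [lastPart_eq, hl, nExt_one]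
    refine ⟨⟨hl, hw, fun i hi => ?_⟩, ?_⟩
    · exact h.antitone 1 le_rfl (by simp) (i + 1) (by omega) (by omega)
    by_cases hS : S = []
    · left
      subst hS
      exact ⟨rfl, h.le_length, h.wt_last, fun hT => hlast ▸ h.last_zero hT⟩
    · right
      have hlen : 1 ≤ S.length := List.length_pos_iff.2 hS
      have h0 := h.le_length
      have h1 := h.length_le
      rw [List.length_cons] at h0 h1
      refine ⟨hS, ?_, ?_, ?_⟩
      · rintro rfl
        exact h.wt_u_lt le_rfl (by simpa using List.length_pos_iff.2 hS)
      · rintro rfl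
        rw [← hlast]
        exact h.pos 1 (by omega) (by simpa using List.length_pos_iff.2 hS)
      · refine ⟨by omega, hlen, by omega, ?_, ?_, ?_, ?_, ?_, ?_, ?_⟩
        · intro k hk hk'
          rw [← nPartition_cons l S hk]
          exact h.length_part (k + 1) (by omega) (by simpa using hk')
        · intro k hk hk' i hi hi'
          rw [← nExt_cons hl hw hk, ← nExt_cons hl hw hk]
          exact h.antitone (k + 1) (by omega) (by simpa using hk') i hi hi'
        · intro k hk hk'
          rw [← wBound_cons hl hw hk, ← nWt_cons hk]
          exact h.wt_le (k + 1) (by omega) (by simpa using hk')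
        · rw [← wBound_cons hl hw hlen, ← nWt_cons hlen]
          exact h.wt_last
        · intro hu hu'
          rw [← wBound_cons hl hw hu, ← nWt_cons hu]
          have := h.wt_u_lt (by omega) (by simp; omega)
          rwa [show u - 1 + 1 = u by omega]
        · intro k hk hk'
          rw [← nExt_cons hl hw (by omega)]
          exact h.pos (k + 1) (by omega) (by simpa using hk')
        · intro hlt
          rw [← nExt_cons hl hw hlen]
          exact h.last_zero (by simp; omega)
  · rintro ⟨⟨hl, hw, hanti⟩, h⟩
    have hlast : nExt f u w n (l :: S) 1 (f 1) = lastPart n l := by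
      rw [lastPart_eq, hl, nExt_one]
    have hanti' : ∀ i, 1 ≤ i → i ≤ f 1 →
        nExt f u w n (l :: S) 1 i ≤ nExt f u w n (l :: S) 1 (i - 1) := by
      intro i hi hi'
      have := hanti (i - 1) (by omega)
      rwa [show i - 1 + 1 = i by omega] at this
    rcases h with ⟨rfl, hu, hsum, hT'⟩ | ⟨hS, hu1, hu0, h⟩
    · refine ⟨hu, le_rfl, hT, ?_, ?_, ?_, hsum, ?_, ?_, fun h => hlast.trans (hT' h)⟩
      · intro k hk hk'
        obtain rfl : k = 1 := le_antisymm hk' hk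
        exact hl
      · intro k hk hk'
        obtain rfl : k = 1 := le_antisymm hk' hk
        exact hanti'
      · intro k hk hk'
        obtain rfl : k = 1 := le_antisymm hk' hk
        exact hw
      · intro h1 h2
        rw [List.length_singleton] at h2
        omega
      · intro k h1 h2
        rw [List.length_singleton] at h2
        obtain rfl : k = 0 := by omega
        omega
    · have hlen := h.one_le_length
      have h1 := h.le_length
      have h2 := h.length_le
      refine ⟨by simp; omega, by simp, by simp; omega, ?_, ?_, ?_, ?_, ?_, ?_, ?_⟩
      · intro k hk hk'
        rcases Nat.lt_or_ge 1 k with hk1 | hk1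
        · obtain ⟨j, rfl⟩ : ∃ j, k = j + 1 := ⟨k - 1, by omega⟩
          rw [nPartition_cons l S (by omega)]
          exact h.length_part j (by omega) (by simpa using hk')
        · obtain rfl : k = 1 := le_antisymm hk1 hk
          exact hl
      · intro k hk hk'
        rcases Nat.lt_or_ge 1 k with hk1 | hk1
        · obtain ⟨j, rfl⟩ : ∃ j, k = j + 1 := ⟨k - 1, by omega⟩
          intro i
          rw [nExt_cons hl hw (by omega), nExt_cons hl hw (by omega)]
          exact h.antitone j (by omega) (by simpa using hk') i
        · obtain rfl : k = 1 := le_antisymm hk1 hk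
          exact hanti'
      · intro k hk hk'
        rcases Nat.lt_or_ge 1 k with hk1 | hk1
        · obtain ⟨j, rfl⟩ : ∃ j, k = j + 1 := ⟨k - 1, by omega⟩
          rw [wBound_cons hl hw (by omega), nWt_cons (by omega)]
          exact h.wt_le j (by omega) (by simpa using hk')
        · obtain rfl : k = 1 := le_antisymm hk1 hk
          exact hw
      · rw [List.length_cons, wBound_cons hl hw hlen, nWt_cons hlen]
        exact h.wt_last
      · intro hu hu'
        rcases Nat.lt_or_ge 1 u with hk1 | hk1
        · have := h.wt_u_lt (by omega) (by simp at hu'; omega)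
          rw [← wBound_cons hl hw (by omega), ← nWt_cons (l := l) (by omega)] at this
          rwa [show u - 1 + 1 = u by omega] at this
        · obtain rfl : u = 1 := le_antisymm hk1 hu
          exact hu1 rfl
      · intro k hk hk'
        rcases Nat.lt_or_ge 1 k with hk1 | hk1
        · obtain ⟨j, rfl⟩ : ∃ j, k = j + 1 := ⟨k - 1, by omega⟩
          rw [nExt_cons hl hw (by omega)]
          exact h.pos j (by omega) (by simpa using hk')
        · obtain rfl : k = 1 := by omega
          rw [hlast]
          exact hu0 (by omega)
      · intro hlt
        rw [List.length_cons, nExt_cons hl hw hlen]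
        exact h.last_zero (by simp at hlt; omega)

theorem AdmissibleFrom.ne_nil (h : AdmissibleFrom f T u w n S) : S ≠ [] :=
  List.length_pos_iff.1 h.one_le_length

theorem nil_mem_admSeqs {fs : List ℕ} {u : ℕ} {w n : ℕ∞} :
    [] ∈ admSeqs fs u w n ↔ fs = [] ∧ n = 1 := by
  rcases fs with _ | ⟨f, fs⟩
  · simp only [admSeqs]
    split_ifs with h <;> simp [h]
  · simp [admSeqs, nil_notMem_consUnion]

/-- The stopping rules agree. Before level `T` a sequence can end only when the remaining weight and
the last part are both zero. At level `T` with nonzero last part, the requirement `n = 1` for the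
empty list means that the remaining weight `n - 1` is zero; it says nothing about the last part. -/
theorem mem_admSeqs (f : ℕ → ℕ) (T u : ℕ) (hu : u = 0 ∨ u < T) (hT : 1 ≤ T) (w n : ℕ∞)
    (h : ¬ (w = ⊤ ∧ n = ⊤)) (S : List (List ℕ)) :
    S ∈ admSeqs ((List.range T).map fun k => f (k + 1)) u w n ↔ AdmissibleFrom f T u w n S := by
  induction S generalizing f T u w n with
  | nil =>
    rw [nil_mem_admSeqs]
    refine iff_of_false (fun h => ?_) fun h => h.ne_nil rfl
    simp only [List.map_eq_nil_iff, List.range_eq_nil] at h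
    omega
  | cons l S ih =>
    rw [admissibleFrom_cons hT]
    obtain ⟨T, rfl⟩ : ∃ j, T = j + 1 := ⟨T - 1, by omega⟩
    rw [List.range_succ_eq_map, List.map_cons, List.map_map, admSeqs, cons_mem_consUnion,
      mem_levelLists h, add_tsub_cancel_right, zero_add]
    refine and_congr_right fun ⟨hl, hw, hanti⟩ => ?_
    have hlast : ¬ (w - l.sum = ⊤ ∧ lastPart n l = ⊤) := by
      -- An infinite last part means an empty partition with `n` infinite, so both bounds would
      -- already be infinite before this level.
      rintro ⟨h1, h2⟩
      exact h ⟨(ENat.sub_eq_top_iff.1 h1).1, (lastPart_eq_top h2).1⟩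
    have hsum : w - l.sum = 0 ↔ (l.sum : ℕ∞) = w := by
      rw [tsub_eq_zero_iff_le]
      exact ⟨fun h => le_antisymm hw h, fun h => h.ge⟩
    have hlt : (l.sum : ℕ∞) < w ↔ ¬ (w - l.sum = 0) := by
      rw [hsum, lt_iff_le_and_ne]
      exact ⟨fun h => h.2, fun h => ⟨hw, h⟩⟩
    rw [hlt, ← hsum]
    generalize w - (l.sum : ℕ∞) = w' at *
    generalize lastPart n l = n' at *
    have hih : 1 ≤ T → (u - 1 = 0 ∨ u - 1 < T) →
        (S ∈ admSeqs ((List.range T).map ((fun k => f (k + 1)) ∘ Nat.succ)) (u - 1)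
          (nextBounds u w' n').1 (nextBounds u w' n').2 ↔
        AdmissibleFrom (fun k => f (k + 1)) T (u - 1)
          (nextBounds u w' n').1 (nextBounds u w' n').2 S) := fun h1 h2 =>
      ih (fun k => f (k + 1)) T (u - 1) h2 h1 _ _ (nextBounds_ne_top hlast)
    unfold tailSeqs
    rcases u with _ | _ | u
    · by_cases hn : n' = 0
      · rw [if_pos (Or.inl ⟨rfl, hn⟩)]
        by_cases hw' : w' = 0 <;> simp [hn, hw']
      · rw [if_neg (by simp [hn])]
        by_cases hS : S = []
        · subst hS
          rw [nil_mem_admSeqs]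
          simp only [List.map_eq_nil_iff, List.range_eq_nil, hn]
          rcases T with _ | T <;> simp [nextBounds]
        · rcases T with _ | T
          · refine iff_of_false ?_ ?_
            · simp only [List.range_zero, List.map_nil, admSeqs]
              split_ifs <;> simp [hS]
            · rintro (h1 | h1)
              · exact hS h1.1
              · have := h1.2.2.2.length_le
                have := h1.2.2.2.one_le_length
                omega
          · rw [hih (by omega) (by omega)]
            simp [hS, pos_iff_ne_zero, hn]
    · by_cases hw' : w' = 0
      · rw [if_pos (Or.inr ⟨rfl, hw'⟩)]
        by_cases hn : n' = 0 <;> simp [hn, hw']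
        all_goals omega
      · rw [if_neg (by simp [hw']), hih (by omega) (by omega)]
        simp only [hw']
        constructor
        · exact fun h => Or.inr ⟨h.ne_nil, by simp, by simp, h⟩
        · rintro (h | h)
          · simp at h
          · exact h.2.2.2
    · rw [if_neg (by simp), hih (by omega) (by omega)]
      constructor
      · exact fun h => Or.inr ⟨h.ne_nil, by simp, by simp, h⟩
      · rintro (h | h)
        · simp at h
        · exact h.2.2.2

end Comparison

/-! ## The contribution of a sequence as an explicit product -/

section Terms

open PowerSeries

variable {f : ℕ → ℕ} {u T : ℕ} {w n : ℕ∞} {l : List ℕ} {S : List (List ℕ)}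

theorem levelTerm_eq (e : ℕ → ℕ) (w n : ℕ∞) (l : List ℕ) :
    levelTerm e w n l = ∏ i ∈ Finset.range l.length, (X ^ e (l.getD i 0) *
      gaussExt (w - (∑ j ∈ Finset.range i, l.getD j 0 : ℕ)) (extPart n l i) (l.getD i 0)) := by
  induction l generalizing w n with
  | nil => simp [levelTerm]
  | cons x l ih =>
    rw [levelTerm, ih, List.length_cons, Finset.prod_range_succ', mul_comm]
    congr 1
    · refine Finset.prod_congr rfl fun i _ => ?_
      rw [extPart_cons_succ, Finset.sum_range_succ', ← tsub_add_eq_tsub_tsub, List.getD_cons_succ,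
        List.getD_cons_zero, add_comm (∑ j ∈ Finset.range i, _), Nat.cast_add]
      simp only [List.getD_cons_succ]
    · simp [extPart]

/-- The factor of `seqTerm` with Gaussian polynomials at one level. -/
noncomputable def levelGauss (f : ℕ → ℕ) (u : ℕ) (w n : ℕ∞) (S : List (List ℕ)) (k : ℕ) :
    PowerSeries ℤ :=
  ∏ i ∈ Finset.range (f k),
    gaussExt (wBound f u w n S k - (∑ j ∈ Finset.range i, nPart S k (j + 1) : ℕ))
      (nExt f u w n S k i) (nPart S k (i + 1))

/-- The nested product is flattened by induction, with `wBound_cons` and `nExt_cons` translating the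
indices. The natural subtraction `u - k` is zero exactly at the levels `k + 1 > u`. -/
theorem seqTerm_eq (h : AdmissibleFrom f T u w n S) :
    seqTerm u w n S = (∏ k ∈ Finset.range S.length, levelGauss f u w n S (k + 1)) *
      X ^ ((∑ k ∈ Finset.range S.length,
          if u = k + 1 then (nExt f u w n S (k + 1) (f (k + 1))).toNat else 0) +
        ∑ k ∈ Finset.range S.length, ∑ i ∈ Finset.range (f (k + 1)),
          levelExponent (u - k) (nPart S (k + 1) (i + 1))) := by
  induction S generalizing f T u w n with
  | nil => exact absurd rfl h.ne_nil
  | cons l S ih =>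
    have hT : 1 ≤ T := h.one_le_length.trans h.length_le
    obtain ⟨⟨hl, hw, -⟩, h2⟩ := (admissibleFrom_cons hT).1 h
    have hlast : nExt f u w n (l :: S) 1 (f 1) = lastPart n l := by
      rw [lastPart_eq, hl, nExt_one]
    have hS : seqTerm (u - 1) (nextBounds u (w - l.sum) (lastPart n l)).1
        (nextBounds u (w - l.sum) (lastPart n l)).2 S =
        (∏ k ∈ Finset.range S.length, levelGauss f u w n (l :: S) (k + 1 + 1)) *
        X ^ ((∑ k ∈ Finset.range S.length, if u = k + 1 + 1 then
            (nExt f u w n (l :: S) (k + 1 + 1) (f (k + 1 + 1))).toNat else 0) +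
          ∑ k ∈ Finset.range S.length, ∑ i ∈ Finset.range (f (k + 1 + 1)),
            levelExponent (u - (k + 1)) (nPart (l :: S) (k + 1 + 1) (i + 1))) := by
      rcases h2 with ⟨rfl, -⟩ | ⟨-, -, -, h3⟩
      · simp [seqTerm]
      · rw [ih h3]
        have e1 : ∀ k : ℕ, u = k + 1 + 1 ↔ u - 1 = k + 1 := by omega
        have e3 := fun k i : ℕ => nExt_cons (u := u) (n := n) (S := S) hl hw (Nat.le_add_left 1 k) i
        have e4 := fun k : ℕ => wBound_cons (u := u) (n := n) (S := S) hl hw (Nat.le_add_left 1 k)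
        have e5 : ∀ k : ℕ, u - (k + 1) = u - 1 - k := by omega
        refine congrArg₂ (· * ·) ?_ (congrArg (X ^ ·) (congrArg₂ (· + ·) ?_ ?_))
        · refine Finset.prod_congr rfl fun k _ => ?_
          rw [levelGauss, levelGauss, e4]
          refine Finset.prod_congr rfl fun i _ => ?_
          rw [e3]
          rfl
        · refine Finset.sum_congr rfl fun k _ => ?_
          rw [e3, if_congr (e1 k) rfl rfl]
        · refine Finset.sum_congr rfl fun k _ => ?_
          rw [e5 k]
          rfl
    rw [seqTerm, hS, levelTerm_eq, List.length_cons, Finset.prod_range_succ',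
      Finset.sum_range_succ', Finset.sum_range_succ', Finset.prod_mul_distrib,
      Finset.prod_pow_eq_pow_sum, hl]
    have e6 : (if u = 1 then X ^ (lastPart n l).toNat else 1 : PowerSeries ℤ) =
        X ^ (if u = 0 + 1 then (nExt f u w n (l :: S) (0 + 1) (f (0 + 1))).toNat else 0) := by
      rw [zero_add, hlast]
      split_ifs <;> simp
    have e7 : levelGauss f u w n (l :: S) (0 + 1) = ∏ i ∈ Finset.range (f 1),
        gaussExt (w - (∑ j ∈ Finset.range i, l.getD j 0 : ℕ)) (extPart n l i) (l.getD i 0) := rfl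
    have e8 : ∑ i ∈ Finset.range (f (0 + 1)), levelExponent (u - 0) (nPart (l :: S) (0 + 1) (i + 1))
        = ∑ i ∈ Finset.range (f 1), levelExponent u (l.getD i 0) := rfl
    rw [e6, e7, e8]
    simp only [pow_add]
    ring

theorem prod_Icc_one {A : Type*} [CommMonoid A] (m : ℕ) (g : ℕ → A) :
    ∏ k ∈ Finset.Icc 1 m, g k = ∏ k ∈ Finset.range m, g (k + 1) := by
  rw [Finset.range_eq_Ico, Finset.prod_Ico_add' g 0 m 1]
  rfl

theorem sum_Icc_one {A : Type*} [AddCommMonoid A] (m : ℕ) (g : ℕ → A) :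
    ∑ k ∈ Finset.Icc 1 m, g k = ∑ k ∈ Finset.range m, g (k + 1) := by
  rw [Finset.range_eq_Ico, Finset.sum_Ico_add' g 0 m 1]
  rfl

/-- Since `f_u = d ≥ 1`, the last part `n_{u,f_u}` picked out by the first sum is the genuine part
`n_{u,d}`. -/
theorem fermExponent_eq {d : ℕ} (hu : 1 ≤ u) (hd : f u = d) (hd' : 1 ≤ d) (hS : u ≤ S.length) :
    fermExponent f u d S = (∑ k ∈ Finset.range S.length,
          if u = k + 1 then (nExt f u w n S (k + 1) (f (k + 1))).toNat else 0) +
        ∑ k ∈ Finset.range S.length, ∑ i ∈ Finset.range (f (k + 1)),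
          levelExponent (u - k) (nPart S (k + 1) (i + 1)) := by
  have h1 : (∑ k ∈ Finset.range S.length,
      if u = k + 1 then (nExt f u w n S (k + 1) (f (k + 1))).toNat else 0) = nPart S u d := by
    rw [Finset.sum_eq_single (u - 1)]
    · rw [if_pos (by omega), show u - 1 + 1 = u by omega, hd, nExt, if_neg (by omega)]
      simp
    · intro k _ hk
      rw [if_neg (by omega)]
    · intro h
      rw [Finset.mem_range] at h
      omega
  have h2 : ∑ k ∈ Finset.range S.length, ∑ i ∈ Finset.range (f (k + 1)),
      levelExponent (u - k) (nPart S (k + 1) (i + 1)) = ∑ k ∈ Finset.Icc 1 S.length,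
        ∑ i ∈ Finset.Icc 1 (f k), levelExponent (u + 1 - k) (nPart S k i) := by
    rw [sum_Icc_one]
    refine Finset.sum_congr rfl fun k _ => ?_
    rw [sum_Icc_one, Nat.add_sub_add_right]
  rw [h1, h2, fermExponent, add_assoc]
  congr 1
  have h3 : ∀ a b : ℕ, Finset.Icc (a + 1) b = Finset.Ioc a b := fun a b => by
    ext
    simp
  have h4 := h3 0 S.length
  have h5 := h3 0 u
  rw [zero_add] at h4 h5
  rw [h4, h5, h3 u, ← Finset.sum_Ioc_consecutive _ (Nat.zero_le u) hS]
  congr 1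
  · refine Finset.sum_congr rfl fun k hk => Finset.sum_congr rfl fun i _ => ?_
    rw [Finset.mem_Ioc] at hk
    rw [levelExponent, if_neg (by omega)]
  · refine Finset.sum_congr rfl fun k hk => Finset.sum_congr rfl fun i _ => ?_
    rw [Finset.mem_Ioc] at hk
    rw [levelExponent, if_pos (by omega)]

theorem levelGauss_of_top {k : ℕ} (hw : wBound f u w n S k = ⊤) :
    levelGauss f u w n S k = qFactLevel f u w n S k := by
  rw [levelGauss, qFactLevel, prod_Icc_one]
  refine Finset.prod_congr rfl fun i _ => ?_
  rw [hw, ENat.top_sub_natCast, gaussExt, if_pos rfl, add_tsub_cancel_right]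
  simp [nExt]

/-- Guarantees that no truncation occurs when partial sums are subtracted from `w_k`, so that these
differences agree with the integers in `gaussFactor`. -/
theorem AdmissibleFrom.sum_le (h : AdmissibleFrom f T u w n S) {k i : ℕ} (hk : 1 ≤ k)
    (hk' : k ≤ S.length) (hi : i ≤ f k) :
    ((∑ j ∈ Finset.range i, nPart S k (j + 1) : ℕ) : ℕ∞) ≤ wBound f u w n S k := by
  refine le_trans ?_ (h.wt_le k hk hk')
  have h1 := h.length_part k hk hk'
  have h2 : ∀ l : List ℕ, l.sum = ∑ j ∈ Finset.range l.length, l.getD j 0 := by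
    intro l
    induction l with
    | nil => simp
    | cons x l ih => simp [Finset.sum_range_succ', ih, add_comm]
  rw [nWt, h2, h1]
  exact_mod_cast Finset.sum_le_sum_of_subset (Finset.range_subset_range.2 hi)

theorem gaussExt_eq_gaussFactor (h : AdmissibleFrom f T u w n S) {k i : ℕ} (hk : 1 ≤ k)
    (hk' : k ≤ S.length) (hi : i < f k) (hw : wBound f u w n S k ≠ ⊤)
    (hn : nExt f u w n S k i ≠ ⊤) :
    gaussExt (wBound f u w n S k - (∑ j ∈ Finset.range i, nPart S k (j + 1) : ℕ))
      (nExt f u w n S k i) (nPart S k (i + 1)) = gaussFactor f u w n S k (i + 1) := by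
  have h1 := h.sum_le hk hk' hi.le
  obtain ⟨W, hW⟩ := ENat.ne_top_iff_exists.1 hw
  obtain ⟨m, hm⟩ := ENat.ne_top_iff_exists.1 hn
  rw [gaussFactor, add_tsub_cancel_right, sum_Icc_one, Finset.sum_range_succ, ← hW, ← hm]
  rw [← hW, Nat.cast_le] at h1
  have h2 : nExt f u w n S k (i + 1) = nPart S k (i + 1) := rfl
  rw [h2, ← ENat.natCast_sub, gaussExt_natCast]
  simp only [ENat.toNat_natCast]
  congr 1
  rw [Nat.cast_sub h1]
  push_cast
  ring

theorem levelGauss_eq_prod (h : AdmissibleFrom f T u w n S) {k : ℕ} (hk : 1 ≤ k)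
    (hk' : k ≤ S.length) (hw : wBound f u w n S k ≠ ⊤) (hn : nExt f u w n S k 0 ≠ ⊤) :
    levelGauss f u w n S k = ∏ i ∈ Finset.Icc 1 (f k), gaussFactor f u w n S k i := by
  rw [levelGauss, prod_Icc_one]
  refine Finset.prod_congr rfl fun i hi => ?_
  rw [Finset.mem_range] at hi
  refine gaussExt_eq_gaussFactor h hk hk' hi hw ?_
  rcases i with _ | i
  · exact hn
  · simp [nExt]

/-- Only the first factor involves the infinite `n_{k,0}`; it degenerates to a reciprocal
`q`-factorial, while all later ones are Gaussians. -/
theorem levelGauss_eq_prod_of_top (h : AdmissibleFrom f T u w n S) {k : ℕ} (hk : 1 ≤ k)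
    (hk' : k ≤ S.length) (hw : wBound f u w n S k ≠ ⊤) (hn : nExt f u w n S k 0 = ⊤)
    (hf : 1 ≤ f k) :
    levelGauss f u w n S k = invQFact (2 * (wBound f u w n S k).toNat) *
      ∏ i ∈ Finset.Icc 2 (f k), gaussFactor f u w n S k i := by
  obtain ⟨m, hm⟩ : ∃ m, f k = m + 1 := ⟨f k - 1, by omega⟩
  have h2 : ∏ i ∈ Finset.Icc 2 (f k), gaussFactor f u w n S k i =
      ∏ i ∈ Finset.range m, gaussFactor f u w n S k (i + 1 + 1) := by
    rw [hm, Finset.range_eq_Ico, Finset.prod_Ico_add' (gaussFactor f u w n S k <| · + 1) 0 m 1,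
      Finset.prod_Ico_add' (gaussFactor f u w n S k) _ _ 1]
    rfl
  rw [h2, levelGauss, hm, Finset.prod_range_succ', mul_comm]
  congr 1
  · rw [hn]
    simp [gaussExt, hw]
  · refine Finset.prod_congr rfl fun i hi => ?_
    rw [Finset.mem_range] at hi
    exact gaussExt_eq_gaussFactor h hk hk' (by omega) hw (by simp [nExt])

theorem bounds_ne_top_succ {j : ℕ} (h1 : (bounds f u w n S j).1 ≠ ⊤)
    (h2 : (bounds f u w n S j).2 ≠ ⊤ ∨ 1 ≤ f (j + 1)) :
    (bounds f u w n S (j + 1)).1 ≠ ⊤ ∧ (bounds f u w n S (j + 1)).2 ≠ ⊤ := by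
  have hlast : (if f (j + 1) = 0 then (bounds f u w n S j).2
      else (nPart S (j + 1) (f (j + 1)) : ℕ∞)) ≠ ⊤ := by
    split_ifs with h
    · exact h2.resolve_right (by omega)
    · exact ENat.natCast_ne_top _
  rw [bounds]
  generalize (if f (j + 1) = 0 then (bounds f u w n S j).2
      else (nPart S (j + 1) (f (j + 1)) : ℕ∞)) = a at *
  generalize (bounds f u w n S j).1 = b at *
  obtain ⟨a, rfl⟩ := ENat.ne_top_iff_exists.1 hlast
  obtain ⟨b, rfl⟩ := ENat.ne_top_iff_exists.1 h1
  have h3 : ∀ x y : ℕ, (x : ℕ∞) - y ≠ ⊤ := fun x y => by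
    rw [← ENat.natCast_sub]
    exact ENat.natCast_ne_top _
  have h4 : ∀ x : ℕ, (x : ℕ∞) - 1 = ((x - 1 : ℕ) : ℕ∞) := fun x => by
    exact_mod_cast (ENat.natCast_sub x 1).symm
  have h5 : ∀ x : ℕ, (x : ℕ∞) + 1 = ((x + 1 : ℕ) : ℕ∞) := fun x => by push_cast; rfl
  split_ifs <;> simp only [h4, h5] <;> exact ⟨by first | exact h3 _ _ | exact ENat.natCast_ne_top _,
    by first | exact h3 _ _ | exact ENat.natCast_ne_top _⟩

/-- The product of all levels `k ≥ m` if `n_{m,0}` is infinite and `w_m` is finite. -/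
theorem prod_levelGauss (h : AdmissibleFrom f T u w n S) {m : ℕ} (hm : 1 ≤ m)
    (hm' : m ≤ S.length) (hw : wBound f u w n S m ≠ ⊤) (hn : nExt f u w n S m 0 = ⊤)
    (hf : 1 ≤ f m ∨ m = S.length) :
    ∏ k ∈ Finset.Icc m S.length, levelGauss f u w n S k =
      invQFact (2 * (wBound f u w n S m).toNat) * gaussLevels f u w n S m := by
  have hfin : ∀ j, m ≤ j → j + 1 ≤ S.length →
      (bounds f u w n S j).1 ≠ ⊤ ∧ (bounds f u w n S j).2 ≠ ⊤ := by
    intro j hj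
    induction j, hj using Nat.le_induction with
    | base =>
      intro hlen
      have := bounds_ne_top_succ (f := f) (u := u) (w := w) (n := n) (S := S) (j := m - 1) hw
        (Or.inr (by rw [show m - 1 + 1 = m by omega]; omega))
      rwa [show m - 1 + 1 = m by omega] at this
    | succ j hj ih =>
      intro hlen
      have h1 := ih (by omega)
      exact bounds_ne_top_succ h1.1 (Or.inl h1.2)
  have hrest : ∏ k ∈ Finset.Icc (m + 1) S.length, levelGauss f u w n S k =
      ∏ k ∈ Finset.Icc (m + 1) S.length, ∏ i ∈ Finset.Icc (1 + if k = m then 1 else 0) (f k),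
        gaussFactor f u w n S k i := by
    refine Finset.prod_congr rfl fun k hk => ?_
    rw [Finset.mem_Icc] at hk
    have h1 := hfin (k - 1) (by omega) (by omega)
    rw [if_neg (by omega), add_zero]
    exact levelGauss_eq_prod h (by omega) hk.2 h1.1 h1.2
  have hfirst : levelGauss f u w n S m = invQFact (2 * (wBound f u w n S m).toNat) *
      ∏ i ∈ Finset.Icc 2 (f m), gaussFactor f u w n S m i := by
    -- A level without parts is the last one by `hf`, so its weight condition forces `w_m = 0` and
    -- the factor is `1 / (q)_0 = 1`.
    rcases Nat.eq_zero_or_pos (f m) with h0 | h0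
    · have h1 := h.wt_last
      have h2 := h.length_part m hm hm'
      obtain rfl : m = S.length := by omega
      rw [nWt, List.eq_nil_of_length_eq_zero (h2.trans h0)] at h1
      rw [← h1, levelGauss, h0]
      simp [invQFact_zero]
    · exact levelGauss_eq_prod_of_top h hm hm' hw hn h0
  rw [gaussLevels, ← Finset.insert_Icc_add_one_left_eq_Icc hm', Finset.prod_insert (by simp),
    Finset.prod_insert (by simp), hrest, hfirst, if_pos rfl, mul_assoc]

theorem termOfOneLt_eq {d N : ℕ} (hu : 1 < u) (hd : f u = d) (hd' : 1 ≤ d) (hf : 1 ≤ f 2)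
    (h : AdmissibleFrom f T u ⊤ N S) : seqTerm u ⊤ N S = termOfOneLt f u d N S := by
  have hlen := h.le_length
  have hb : bounds f u ⊤ N S 1 = (nExt f u ⊤ N S 1 (f 1), ⊤) := by
    rw [bounds, if_pos (by omega)]
    simp only [bounds, nExt, zero_add, Nat.sub_self]
    rw [ENat.top_sub_natCast]
  have hlast : nExt f u ⊤ N S 1 (f 1) ≠ ⊤ := by
    unfold nExt
    split_ifs
    · exact ENat.natCast_ne_top N
    · exact ENat.natCast_ne_top _
  have hw2 : wBound f u ⊤ N S 2 = nExt f u ⊤ N S 1 (f 1) := congrArg Prod.fst hb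
  have hn2 : nExt f u ⊤ N S 2 0 = ⊤ := congrArg Prod.snd hb
  rw [seqTerm_eq h, ← fermExponent_eq hu.le hd hd' hlen, ← prod_Icc_one,
    ← Finset.insert_Icc_add_one_left_eq_Icc (show 1 ≤ S.length by omega),
    Finset.prod_insert (by simp), levelGauss_of_top rfl,
    show 1 + 1 = 2 from rfl,
    prod_levelGauss h one_le_two (by omega) (hw2 ▸ hlast) hn2 (Or.inl hf), hw2, termOfOneLt]
  ring

theorem termOfEqOne_eq {d N : ℕ} (hd : f 1 = d) (hd' : 1 ≤ d)
    (hf : 1 ≤ f 3 ∨ T ≤ 3) (h : AdmissibleFrom f T 1 ⊤ N S) :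
    seqTerm 1 ⊤ N S = termOfEqOne f d N S := by
  have hlen := h.le_length
  have hb : bounds f 1 ⊤ N S 1 = (⊤, nExt f 1 ⊤ N S 1 (f 1) + 1) := by
    rw [bounds, if_neg (by omega), if_pos (by omega)]
    simp only [bounds, nExt, zero_add, Nat.sub_self]
    rw [ENat.top_sub_one, ENat.top_sub_natCast]
  have hw2 : wBound f 1 ⊤ N S 2 = ⊤ := congrArg Prod.fst hb
  have hlast : nExt f 1 ⊤ N S 1 (f 1) ≠ ⊤ := by
    unfold nExt
    split_ifs
    · exact ENat.natCast_ne_top N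
    · exact ENat.natCast_ne_top _
  have hlast2 : nExt f 1 ⊤ N S 2 (f 2) ≠ ⊤ := by
    unfold nExt
    split_ifs
    · rw [hb]
      simpa using hlast
    · exact ENat.natCast_ne_top _
  have hb2 : bounds f 1 ⊤ N S 2 = (nExt f 1 ⊤ N S 2 (f 2) - 1, ⊤) := by
    rw [bounds, if_neg (by omega), if_neg (by omega)]
    have h1 : (bounds f 1 ⊤ N S 1).1 = ⊤ := hw2
    simp only [h1, nExt]
    rw [top_add, ENat.top_sub_natCast]
  have hw3 : wBound f 1 ⊤ N S 3 = nExt f 1 ⊤ N S 2 (f 2) - 1 := congrArg Prod.fst hb2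
  have hn3 : nExt f 1 ⊤ N S 3 0 = ⊤ := congrArg Prod.snd hb2
  -- A sequence ending at level one or two would have finite weight equal to an infinite bound.
  have hlen3 : 3 ≤ S.length := by
    by_contra hlt
    have h1 := h.wt_last
    obtain h2 | h2 : S.length = 1 ∨ S.length = 2 := by omega
    · rw [h2] at h1
      exact ENat.natCast_ne_top _ h1
    · rw [h2, hw2] at h1
      exact ENat.natCast_ne_top _ h1
  have hw3' : wBound f 1 ⊤ N S 3 ≠ ⊤ := by
    rw [hw3]
    exact fun h => hlast2 (ENat.sub_eq_top_iff.1 h).1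
  have hL := h.length_le
  rw [seqTerm_eq h, ← fermExponent_eq le_rfl hd hd' hlen, ← prod_Icc_one,
    ← Finset.insert_Icc_add_one_left_eq_Icc (show 1 ≤ S.length by omega),
    Finset.prod_insert (by simp), levelGauss_of_top rfl,
    ← Finset.insert_Icc_add_one_left_eq_Icc (show 1 + 1 ≤ S.length by omega),
    Finset.prod_insert (by simp), levelGauss_of_top hw2,
    prod_levelGauss h (show 1 ≤ 1 + 1 + 1 by omega) hlen3 hw3' hn3
      (hf.imp id fun hT => by omega), termOfEqOne]
  have h3 : (wBound f 1 ⊤ N S (1 + 1 + 1)).toNat = (nExt f 1 ⊤ N S 2 (f 2)).toNat - 1 := by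
    rw [show (1 + 1 + 1 : ℕ) = 3 from rfl, hw3, ENat.toNat_sub (by simp)]
    simp
  rw [h3]
  ring

end Terms

/-! ## Continued fractions and the parameters of the restricted partition pairs -/

section ContFrac

/-- The pair `(num, den)` with continued fraction `(c_1, …, c_k)`. -/
def evalFrac : List ℕ → ℕ × ℕ
  | [] => (1, 0)
  | c :: l => (c * (evalFrac l).1 + (evalFrac l).2, (evalFrac l).1)

theorem contFrac_of_pos {s r : ℕ} (hr : r ≠ 0) : contFrac s r = (s / r) :: contFrac r (s % r) := by
  rw [contFrac, dif_neg hr]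

theorem evalFrac_contFrac {s r : ℕ} (h : s.Coprime r) : evalFrac (contFrac s r) = (s, r) := by
  induction r using Nat.strong_induction_on generalizing s with
  | _ r ih =>
    rcases Nat.eq_zero_or_pos r with rfl | hr
    · rw [Nat.coprime_zero_right] at h
      rw [h, contFrac, dif_pos rfl, evalFrac]
    · rw [contFrac_of_pos hr.ne', evalFrac, ih (s % r) (Nat.mod_lt s hr)
        (by
          rw [Nat.Coprime, Nat.gcd_comm, ← Nat.gcd_rec, Nat.gcd_comm]
          exact h)]
      rw [mul_comm, Nat.div_add_mod]

theorem evalFrac_append_one (l : List ℕ) (e : ℕ) :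
    evalFrac (l ++ [e, 1]) = evalFrac (l ++ [e + 1]) := by
  induction l with
  | nil => simp [evalFrac]
  | cons c l ih => simp [evalFrac, ih]

theorem IsContFrac.evalFrac_eq {s r : ℕ} {l : List ℕ} (h : IsContFrac s r l) :
    evalFrac l = (s, r) := by
  obtain ⟨-, h1, rfl | ⟨l', e, rfl, h2⟩⟩ := h
  · exact evalFrac_contFrac h1
  · rw [evalFrac_append_one, ← h2, evalFrac_contFrac h1]

theorem evalFrac_append_add_two (l : List ℕ) (c : ℕ) :
    evalFrac (l ++ [c + 2]) = quot (l ++ [c]) := by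
  induction l with
  | nil => simp [evalFrac, quot]
  | cons f l ih => simp [evalFrac, quot, ih]

/-- Only the first partial quotient can vanish, since the later ones are quotients of a divisor by a
smaller remainder. -/
theorem one_le_of_contFrac_eq {s r x y : ℕ} {l : List ℕ} (h : contFrac s r = x :: y :: l) :
    1 ≤ y := by
  have hr : r ≠ 0 := fun hr => by simp [contFrac, hr] at h
  rw [contFrac_of_pos hr, List.cons.injEq] at h
  have hr' : s % r ≠ 0 := fun hr => by simp [contFrac, hr] at h
  rw [contFrac_of_pos hr', List.cons.injEq] at h
  rw [← h.2.1]
  exact Nat.div_pos (Nat.mod_lt s (Nat.pos_of_ne_zero hr)).le (Nat.pos_of_ne_zero hr')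

/-- The alternative expansion ends in `1`, which a last entry `m + 2` excludes. -/
theorem IsContFrac.eq_contFrac {s r m : ℕ} {l : List ℕ} (h : IsContFrac s r (l ++ [m + 2])) :
    contFrac s r = l ++ [m + 2] := by
  obtain ⟨-, -, h1 | ⟨l', e, h1, -⟩⟩ := h
  · exact h1.symm
  · rw [show l' ++ [e, 1] = l' ++ [e] ++ [1] by simp] at h1
    have := (List.append_inj' h1 rfl).2
    simp at this

/-- The totals `α + β` and `a + b` obey the Euclidean recursion of the whole list, while `α` and `a`
obey that of its truncation after `d`. Prepending an entry acts in the same way on both, so only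
level `u` needs a computation. -/
theorem params_append (pre rest : List ℕ) (d e : ℕ) :
    evalFrac (pre ++ [d]) = ((params (pre ++ d :: e :: rest) (pre.length + 1)).2.2.1,
        (params (pre ++ d :: e :: rest) (pre.length + 1)).1) ∧
      quot (pre ++ (d + e) :: rest) =
        ((params (pre ++ d :: e :: rest) (pre.length + 1)).2.2.1 +
          (params (pre ++ d :: e :: rest) (pre.length + 1)).2.2.2,
        (params (pre ++ d :: e :: rest) (pre.length + 1)).1 +
          (params (pre ++ d :: e :: rest) (pre.length + 1)).2.1) := by
  induction pre with
  | nil =>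
    obtain ⟨A, hA⟩ : ∃ A, (quot rest).1 = A + 1 :=
      ⟨(quot rest).1 - 1, by have := (quot_pos rest).1; omega⟩
    simp only [List.nil_append, evalFrac, params, quot, List.length_nil, zero_add, hA,
      add_tsub_cancel_right]
    refine ⟨by simp, Prod.ext ?_ ?_⟩ <;> simp only <;> ring
  | cons f pre ih =>
    simp only [List.cons_append, evalFrac, params, quot, List.length_cons, ih.1, ih.2]
    refine ⟨Prod.ext ?_ rfl, Prod.ext ?_ rfl⟩ <;> simp only <;> ring

end ContFrac

/-! ### Matching the continued fractions with the fermionic recursion -/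

section Assembly

variable {c : ℕ → ℕ} {t u d : ℕ}

theorem map_fSeq (c : ℕ → ℕ) (v m d : ℕ) :
    (List.range (v + 1 + m + 1)).map (fun k => fSeq c (v + 1) d (k + 1)) =
      (List.range v).map (fun k => c (k + 1)) ++
        d :: (c (v + 1) - d) :: (List.range m).map (fun k => c (v + 1 + k + 1)) := by
  rw [show v + 1 + m + 1 = v + (m + 1 + 1) by ring, List.range_add, List.map_append,
    List.range_succ_eq_map, List.range_succ_eq_map]
  simp only [List.map_map, List.map_cons]
  congr 1
  · refine List.map_congr_left fun k hk => ?_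
    rw [List.mem_range] at hk
    rw [fSeq, if_pos (by omega)]
  · simp only [List.cons.injEq]
    refine ⟨?_, ?_, List.map_congr_left fun k hk => ?_⟩
    · rw [fSeq, if_neg (by omega), if_pos (by omega)]
    · simp [fSeq, add_assoc]
    · simp only [Function.comp, fSeq]
      rw [if_neg (by omega), if_neg (by omega), if_neg (by omega)]
      congr 1
      omega

theorem map_range_split (c : ℕ → ℕ) (v m : ℕ) :
    (List.range (v + m)).map (fun k => c (k + 1)) ++ [c (v + m + 1)] =
      (List.range v).map (fun k => c (k + 1)) ++
        c (v + 1) :: (List.range m).map (fun k => c (v + 1 + k + 1)) := by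
  have h1 : (List.range (v + m)).map (fun k => c (k + 1)) ++ [c (v + m + 1)] =
      (List.range (v + (m + 1))).map (fun k => c (k + 1)) := by
    rw [← add_assoc, List.range_succ, List.map_append]
    rfl
  rw [h1, List.range_add, List.map_append, List.range_succ_eq_map]
  simp only [List.map_map, List.map_cons]
  congr 2
  refine List.map_congr_left fun k _ => ?_
  simp only [Function.comp]
  congr 1
  omega

theorem fermSum_eq_R {p p' r s N : ℕ}
    (hcf : IsContFrac p' p ((List.range (t - 1)).map (fun k => c (k + 1)) ++ [c t + 2]))
    (hu : 1 ≤ u) (hut : u ≤ t) (hdc : d ≤ c u)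
    (hrs : IsContFrac s r ((List.range (u - 1)).map (fun k => c (k + 1)) ++ [d])) (M : ℕ) :
    (R N M r ((p : ℤ) - r) s ((p' : ℤ) - s) : PowerSeries ℤ) =
      fermSum ((List.range (t + 1)).map fun k => fSeq c u d (k + 1)) u M N := by
  obtain ⟨v, rfl⟩ : ∃ v, u = v + 1 := ⟨u - 1, by omega⟩
  obtain ⟨m, rfl⟩ : ∃ m, t = v + 1 + m := ⟨t - (v + 1), by omega⟩
  have h1 := hcf.evalFrac_eq
  have h2 := hrs.evalFrac_eq
  have h3 := params_append ((List.range v).map fun k => c (k + 1))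
    ((List.range m).map (fun k => c (v + 1 + k + 1))) d (c (v + 1) - d)
  rw [evalFrac_append_add_two, show v + 1 + m - 1 = v + m by omega,
    show v + 1 + m = v + m + 1 by omega, map_range_split, ← Nat.add_sub_cancel' hdc] at h1
  rw [add_tsub_cancel_right] at h2
  rw [h1, h2, List.length_map, List.length_range, ← map_fSeq, Prod.mk.injEq, Prod.mk.injEq] at h3
  rw [fermSum_eq _ _ (by simp; omega), R, coe_genFun]
  obtain ⟨⟨h4, h5⟩, h6, h7⟩ := h3
  rw [← h4, ← h5] at *
  congr 1 <;> omega

/-- For `t ≥ 3` the second entry is neither the first nor the modified last one, so it is a genuine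
later partial quotient. -/
theorem one_le_second {p p' : ℕ} (ht : 3 ≤ t)
    (hcf : IsContFrac p' p ((List.range (t - 1)).map (fun k => c (k + 1)) ++ [c t + 2])) :
    1 ≤ c 2 := by
  have h := hcf.eq_contFrac
  obtain ⟨m, rfl⟩ : ∃ m, t = m + 3 := ⟨t - 3, by omega⟩
  rw [show m + 3 - 1 = m + 1 + 1 by omega, List.range_succ_eq_map, List.range_succ_eq_map] at h
  exact one_le_of_contFrac_eq h

theorem fSeq_two_pos {p p' : ℕ}
    (hcf : IsContFrac p' p ((List.range (t - 1)).map (fun k => c (k + 1)) ++ [c t + 2]))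
    (hu : 1 < u) (hut : u ≤ t) (hd : 1 ≤ d) : 1 ≤ fSeq c u d 2 := by
  unfold fSeq
  split_ifs with h1 h2 h3
  · exact one_le_second (by omega) hcf
  · exact hd
  · omega
  · omega

theorem fSeq_three {p p' : ℕ}
    (hcf : IsContFrac p' p ((List.range (t - 1)).map (fun k => c (k + 1)) ++ [c t + 2])) :
    1 ≤ fSeq c 1 d 3 ∨ t + 1 ≤ 3 := by
  rcases le_or_gt t 2 with ht | ht
  · exact Or.inr (by omega)
  · exact Or.inl (one_le_second ht hcf)

theorem fSeq_self : fSeq c u d u = d := by simp [fSeq]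

theorem contLeft_of_one_lt (hu : 1 < u) (hut : u ≤ t) (h : 1 ≤ fSeq c u d 2) :
    ContLeft (fermSum ((List.range (t + 1)).map fun k => fSeq c u d (k + 1)) u) := by
  obtain ⟨m, rfl⟩ : ∃ m, t = m + 1 := ⟨t - 1, by omega⟩
  obtain ⟨v, rfl⟩ : ∃ v, u = v + 2 := ⟨u - 2, by omega⟩
  rw [List.range_succ_eq_map, List.range_succ_eq_map]
  exact contLeft_fermSum_of_one_lt _ _ _ h

theorem contLeft_of_eq_one (ht : 1 ≤ t) (h : 1 ≤ fSeq c 1 d 3 ∨ t + 1 ≤ 3) :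
    ContLeft (fermSum ((List.range (t + 1)).map fun k => fSeq c 1 d (k + 1)) 1) := by
  obtain ⟨m, rfl⟩ : ∃ m, t = m + 1 := ⟨t - 1, by omega⟩
  rw [List.range_succ_eq_map, List.range_succ_eq_map]
  refine contLeft_fermSum_one _ _ ?_
  rcases m with _ | m
  · exact contRight_fermSum_nil 0
  · rw [List.range_succ_eq_map]
    rcases Nat.eq_zero_or_pos (fSeq c 1 d 3) with h0 | h0
    -- A vanishing third entry is possible only for `t = 2`, where no level follows it.
    · obtain rfl : m = 0 := by omega
      have : ContRight (fermSum [fSeq c 1 d 3] 0) := h0 ▸ contRight_fermSum_zero_singleton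
      exact this
    · exact contRight_fermSum _ 0 h0

theorem mem_admSeqs_iff_admissible {N : ℕ} (hu : 1 ≤ u) (hut : u ≤ t) (S : List (List ℕ)) :
    S ∈ admSeqs ((List.range (t + 1)).map fun k => fSeq c u d (k + 1)) u ⊤ N ↔
      Admissible (fSeq c u d) t u ⊤ N S := by
  rw [admissible_iff hu]
  exact mem_admSeqs (fSeq c u d) (t + 1) u (Or.inr (by omega)) (by omega) ⊤ N (by simp) S

end Assembly

end Burge

theorem mainTheorem10 (p p' r s t u d N : ℕ) (c : ℕ → ℕ)
    (hp : 0 < p) (hp' : 0 < p') (hcop : Nat.Coprime p p')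
    (ht : 1 ≤ t)
    (hcf : Burge.IsContFrac p' p ((List.range (t - 1)).map (fun k => c (k + 1)) ++ [c t + 2]))
    (hu : 1 ≤ u) (hut : u ≤ t) (hd : 1 ≤ d) (hdc : d ≤ c u)
    (hrs : Burge.IsContFrac s r ((List.range (u - 1)).map (fun k => c (k + 1)) ++ [d])) :
    ∃ hfin : {S | Burge.Admissible (Burge.fSeq c u d) t u ⊤ N S}.Finite,
      (1 < u →
        Tendsto
          (fun M : ℕ => (Burge.R N M r ((p : ℤ) - r) s ((p' : ℤ) - s) : PowerSeries ℤ))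
          atTop
          (𝓝 (∑ S ∈ hfin.toFinset, Burge.termOfOneLt (Burge.fSeq c u d) u d N S))) ∧
      (u = 1 →
        Tendsto
          (fun M : ℕ => (Burge.R N M r ((p : ℤ) - r) s ((p' : ℤ) - s) : PowerSeries ℤ))
          atTop
          (𝓝 (∑ S ∈ hfin.toFinset, Burge.termOfEqOne (Burge.fSeq c u d) d N S))) := by
  have hmem := Burge.mem_admSeqs_iff_admissible (c := c) (d := d) (N := N) hu hut
  have hfin : {S | Burge.Admissible (Burge.fSeq c u d) t u ⊤ N S}.Finite :=
    (Finset.finite_toSet _).subset fun S hS => Finset.mem_coe.2 ((hmem S).2 hS)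
  have hset : hfin.toFinset = Burge.admSeqs
      ((List.range (t + 1)).map fun k => Burge.fSeq c u d (k + 1)) u ⊤ N := by
    ext S
    rw [hmem, Set.Finite.mem_toFinset, Set.mem_ofPred_eq]
  refine ⟨hfin, fun hu1 => ?_, fun hu1 => ?_⟩
  · have h2 := Burge.fSeq_two_pos hcf hu1 hut hd
    have h3 := Burge.contLeft_of_one_lt hu1 hut h2 N
    simp only [Burge.fermSum_eq_R hcf hu hut hdc hrs]
    rw [Burge.fermSum_eq_sum, ← hset] at h3
    rw [Finset.sum_congr rfl fun S hS => (Burge.termOfOneLt_eq hu1 Burge.fSeq_self hd h2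
      ((Burge.admissible_iff hu).1 (hfin.mem_toFinset.1 hS))).symm]
    exact h3
  · subst hu1
    have h2 := Burge.fSeq_three (d := d) hcf
    have h3 := Burge.contLeft_of_eq_one ht h2 N
    simp only [Burge.fermSum_eq_R hcf hu hut hdc hrs]
    rw [Burge.fermSum_eq_sum, ← hset] at h3
    rw [Finset.sum_congr rfl fun S hS => (Burge.termOfEqOne_eq Burge.fSeq_self hd h2
      ((Burge.admissible_iff hu).1 (hfin.mem_toFinset.1 hS))).symm]
    exact h3
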